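/- **Setting.** Fix $n\ge 1$. Cubes in $\mathbb R^n$ have sides parallel to the axes, $b_Q=\frac1{|Q|}\int_Q b$, and a weight is a locally integrable, a.e. positive function; for a weight $w$ and a measurable set $E$, $w(E)=\int_E w$. For weights $u,v$ put $$[v]_{A_p(u)}=\sup_Q \frac1{u(Q)}\int_Q vu\Big(\frac1{u(Q)}\int_Q v^{-\frac1{p-1}}u\Big)^{p-1}\ (1<p<\infty),\qquad [v]_{A_1(u)}=\Big\|\frac{M_uv}{v}\Big\|_\infty,\quad M_uv(x)=\sup_{Q\ni x}\frac1{u(Q)}\int_Q vu,$$ $A_p=A_p(1)$, $M=M_1$, $[w]_{A_\infty}=\sup_Q\frac1{w(Q)}\int_Q M(\chi_Qw)$ and $[w]_{RH_q}=\sup_Q\big(\frac1{|Q|}\int_Qw^q\big)^{1/q}\big(\frac{w(Q)}{|Q|}\big)^{-1}$; $v\in A_p(u)$ and $w\in RH_q$ mean that the corresponding constant is finite. A Young function is a convex non-decreasing $A:[0,\infty)\to[0,\infty)$ with $A(0)=0$ and $A(t)\to\infty$ as $t\to\infty$; $A^{-1}(t)=\inf\{x\ge0: A(x)\ge t\}$;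 $A\in B_\rho$ means $\int_1^\infty \frac{A(t)}{t^\rho}\frac{dt}t<\infty$; $\|h\|_{A,Q}=\inf\{\lambda>0:\frac1{|Q|}\int_QA(|h|/\lambda)\le1\}$, and $\|h\|_{1,Q}=\frac1{|Q|}\int_Q|h|$. A locally integrable $b$ is in $\mathrm{Osc}_{\exp L^r}$ if $\|b\|_{\mathrm{Osc}_{\exp L^r}}=\sup_Q\|b-b_Q\|_{\exp L^r,Q}<\infty$, where $\exp L^r$ is given by $t\mapsto e^{t^r}-1$. A dyadic grid is a set of half-open cubes, any two of them nested or disjoint, whose side lengths are of the form $\ell2^k$, $k\in\mathbb Z$ ($\ell>0$ fixed), and such that for each $k$ the cubes of side $\ell2^k$ cover $\mathbb R^n$. A family $\mathcal S$ of cubes is $\eta$-sparse if there are pairwise disjoint measurable sets $E_Q\subseteq Q$, $Q\in\mathcal S$, with $|E_Q|\ge\eta|Q|$. **Sparse bound.** Let $T$ be an operator on real functions on $\mathbb R^n$ and $\mathbf b=(b_1,\dots,b_m)$. Put $[b,T]f=bTf-T(bf)$, $T_{\mathbf b}=[b_m,\dots,[b_2,[b_1,T]]]$, $|b-b_Q|_\sigma=\prod_{i\in\sigma}|b_i-(b_i)_Q|$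 for $\sigma\subseteq\{1,\dots,m\}$, $\sigma'=\{1,\dots,m\}\setminus\sigma$, and let $C_h(\mathbf b)$ be the set of all $\sigma$ with $h$ elements. Let $\mathcal D_1,\dots,\mathcal D_{3^n}$ be dyadic grids and $\mathcal F$ a class of measurable functions such that $T_{\mathbf b}f$ is measurable for $f\in\mathcal F$. Assume that for all $f\in\mathcal F$ and all bounded measurable compactly supported $g$ with $T_{\mathbf b}(f)g$ integrable there are $\eta$-sparse families $\mathcal S_j\subseteq\mathcal D_j$ with $$\int T_{\mathbf b}(f)g\le c_0\sum_{j=1}^{3^n}\sum_{h=0}^m\sum_{\sigma\in C_h(\mathbf b)}\sum_{Q\in\mathcal S_j}\big\|f|b-b_Q|_\sigma\big\|_{1,Q}\,\big\|g|b-b_Q|_{\sigma'}\big\|_{A,Q}\,|Q|.\tag{$*$}$$ **Theorem 1.2.** Let $1\le p,s<\infty$, $u\in A_1\cap RH_q$ with $q=2s-1$, and $v\in A_p(u)$. Let $m\ge1$, $r_1,\dots,r_m\ge1$, $\frac1r=\sum_{i=1}^m\frac1{r_i}$, $b_i\in\mathrm{Osc}_{\exp L^{r_i}}$ and $\|\mathbf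 b\|=\prod_{i=1}^m\|b_i\|_{\mathrm{Osc}_{\exp L^{r_i}}}$. Let $A,B$ be Young functions with $B^{-1}(t)\log(t)^{1/r}\lesssim A^{-1}(t)$ for all $t\ge e$ and $B\in B_\rho$ for all $\rho>s$, and let $T$ satisfy $(*)$. Then $[uv]_{A_\infty}$ and $[u^s]_{A_\infty}$ are finite, and for every $\lambda>0$ and every $f$ with $fv\in\mathcal F$, $$uv\Big(\Big\{x\in\mathbb R^n:\frac{T_{\mathbf b}(fv)(x)}{v(x)}>\lambda\Big\}\Big)\le C\,C_{u,v}\int_{\mathbb R^n}\varphi_{\frac1r}\Big(\frac{|f(x)|\,\|\mathbf b\|}{\lambda}\Big)u(x)v(x)\,dx,\qquad \varphi_{\frac1r}(t)=t(1+\log^+t)^{\frac1r},$$ $$C_{u,v}=\sum_{h=0}^m\kappa_u[u]_{RH_q}^{1+\frac q{4s}}[u]_{A_1}[uv]_{A_\infty}^{1+\frac{m-h}r}\log\Big(e+[uv]_{A_\infty}^{1+\frac{m-h}r}\kappa_u[u]_{RH_q}^{1+\frac q{4s}}[u]_{A_1}[v]_{A_p(u)}\Big)^{1+\frac1r}.$$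 Here $C$ depends only on $n,p,s,m,r_1,\dots,r_m,\eta,c_0,A,B$, and $\kappa_u$ is any positive number such that $$B(t)\le(\kappa_u t)^{s(1+\varepsilon_u)}\quad\text{for all }t\ge1,\qquad \varepsilon_u=\frac1{2\tau_n[u^s]_{A_\infty}},$$ where $\tau_n>0$ depends only on $n$. If $B(t)=t^s(1+\log^+t)^\gamma$ with $\gamma\ge0$, one may take $\kappa_u=[u^s]_{A_\infty}^{\gamma/s}$, and for all $s\ge1$, $\gamma\ge0$ and $u\in A_1\cap RH_{2s-1}$ one has $[u^s]_{A_\infty}^{\gamma/s}\le c_{n,s,\gamma}[u]_{RH_q}^{\gamma/s}[u]_{A_1}^{\gamma/s}$. -/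

import Mathlib

open MeasureTheory Set Filter
open scoped ENNReal

namespace MixedWeak

noncomputable section

/-- A cube in `ℝⁿ` with sides parallel to the axes, given by its lower corner and its side length. -/
structure Cube (n : ℕ) where
  corner : Fin n → ℝ
  side : ℝ
  side_pos : 0 < side

/-- The points of a cube (half-open). -/
def Cube.set {n : ℕ} (Q : Cube n) : Set (Fin n → ℝ) :=
  {x | ∀ i, Q.corner i ≤ x i ∧ x i < Q.corner i + Q.side}

/-! ### Weights -/

/-- A weight: locally integrable and positive almost everywhere. -/
def IsWeight {n : ℕ} (w : (Fin n → ℝ) → ℝ) : Prop :=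
  LocallyIntegrable w volume ∧ ∀ᵐ x, 0 < w x

/-- The average `u(Q)⁻¹ ∫_Q h u` of a nonnegative function `h` with respect to the weight `u`. -/
def wAvg {n : ℕ} (u : (Fin n → ℝ) → ℝ) (Q : Cube n) (h : (Fin n → ℝ) → ℝ) : ℝ≥0∞ :=
  (∫⁻ x in Q.set, ENNReal.ofReal (h x * u x)) / ∫⁻ x in Q.set, ENNReal.ofReal (u x)

/-- The weighted maximal function `M_u h (x) = sup_{Q ∋ x} u(Q)⁻¹ ∫_Q h u` of a nonnegative `h`. -/
def maxFn {n : ℕ} (u h : (Fin n → ℝ) → ℝ) (x : Fin n → ℝ) : ℝ≥0∞ :=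
  ⨆ (Q : Cube n) (_ : x ∈ Q.set), wAvg u Q h

/-- The constant `[v]_{A_p(u)}`, for `1 ≤ p < ∞`; `[v]_{A_p}` is the case `u = 1`. -/
def ApConst {n : ℕ} (u : (Fin n → ℝ) → ℝ) (p : ℝ) (v : (Fin n → ℝ) → ℝ) : ℝ≥0∞ :=
  if p = 1 then essSup (fun x => maxFn u v x / ENNReal.ofReal (v x)) volume
  else ⨆ Q : Cube n, wAvg u Q v * wAvg u Q (fun x => v x ^ (-(1 / (p - 1)))) ^ (p - 1)

/-- `v ∈ A_p(u)`. -/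
def MemAp {n : ℕ} (u : (Fin n → ℝ) → ℝ) (p : ℝ) (v : (Fin n → ℝ) → ℝ) : Prop :=
  IsWeight v ∧ ApConst u p v < ⊤

/-- The constant `[w]_{A_∞} = sup_Q w(Q)⁻¹ ∫_Q M(χ_Q w)`. -/
def AinftyConst {n : ℕ} (w : (Fin n → ℝ) → ℝ) : ℝ≥0∞ :=
  ⨆ Q : Cube n, (∫⁻ x in Q.set, maxFn (fun _ => 1) (Q.set.indicator w) x) /
    ∫⁻ x in Q.set, ENNReal.ofReal (w x)

/-- The reverse Hölder constant `[w]_{RH_q} = sup_Q (⨍_Q w^q)^{1/q} / ⨍_Q w`. -/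
def RHConst {n : ℕ} (q : ℝ) (w : (Fin n → ℝ) → ℝ) : ℝ≥0∞ :=
  ⨆ Q : Cube n, (⨍⁻ x in Q.set, ENNReal.ofReal (w x ^ q) ∂volume) ^ (1 / q) /
    ⨍⁻ x in Q.set, ENNReal.ofReal (w x) ∂volume

/-! ### Young functions and Orlicz averages -/

/-- Young functions; only the values on `[0, ∞)` matter. -/
structure IsYoung (A : ℝ → ℝ) : Prop where
  convex : ConvexOn ℝ (Ici 0) A
  mono : MonotoneOn A (Ici 0)
  zero : A 0 = 0
  tendsto : Tendsto A atTop atTop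

/-- The (generalized) inverse `A⁻¹(t)` of a Young function. -/
def youngInv (A : ℝ → ℝ) (t : ℝ) : ℝ := sInf {x | 0 ≤ x ∧ t ≤ A x}

/-- The class `B_ρ`: `∫_1^∞ A(t) t^{-ρ} dt/t < ∞`. -/
def MemB (ρ : ℝ) (A : ℝ → ℝ) : Prop :=
  IntegrableOn (fun t => A t / t ^ ρ / t) (Ioi 1) volume

/-- The Luxemburg average `‖h‖_{A,Q} = inf {λ > 0 : ⨍_Q A(|h|/λ) ≤ 1}` (`⊤` if there is no such
`λ`). -/
def luxNorm {n : ℕ} (A : ℝ → ℝ) (Q : Cube n) (h : (Fin n → ℝ) → ℝ) : ℝ≥0∞ :=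
  ⨅ (lam : ℝ) (_ : 0 < lam)
    (_ : (⨍⁻ x in Q.set, ENNReal.ofReal (A (|h x| / lam)) ∂volume) ≤ 1), ENNReal.ofReal lam

/-- The average `b_Q`. -/
def cubeAvg {n : ℕ} (Q : Cube n) (b : (Fin n → ℝ) → ℝ) : ℝ := ⨍ x in Q.set, b x ∂volume

/-- `‖b‖_{Osc_{exp L^r}} = sup_Q ‖b - b_Q‖_{exp L^r, Q}`. -/
def oscNorm {n : ℕ} (r : ℝ) (b : (Fin n → ℝ) → ℝ) : ℝ≥0∞ :=
  ⨆ Q : Cube n, luxNorm (fun t => Real.exp (t ^ r) - 1) Q (fun x => b x - cubeAvg Q b)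

/-- `b ∈ Osc_{exp L^r}`. -/
def MemOsc {n : ℕ} (r : ℝ) (b : (Fin n → ℝ) → ℝ) : Prop :=
  LocallyIntegrable b volume ∧ oscNorm r b < ⊤

/-- `‖𝐛‖ = ∏ ‖b_i‖_{Osc_{exp L^{r_i}}}`. -/
def symbolNorm {n m : ℕ} (r : Fin m → ℝ) (b : Fin m → (Fin n → ℝ) → ℝ) : ℝ :=
  ∏ i, (oscNorm (r i) (b i)).toReal

/-- The number `1/r = ∑ 1/r_i`. -/
def recipSum {m : ℕ} (r : Fin m → ℝ) : ℝ := ∑ i, 1 / r i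

/-- `φ_α(t) = t (1 + log⁺ t)^α`. -/
def phi (α t : ℝ) : ℝ := t * (1 + Real.posLog t) ^ α

/-! ### Dyadic grids and sparse families -/

/-- A dyadic grid: the side lengths are `ℓ 2^k`, the cubes of each of these sizes cover `ℝⁿ`, and
two cubes are nested or disjoint. -/
structure IsDyadicGrid {n : ℕ} (D : Set (Cube n)) : Prop where
  sides : ∃ l : ℝ, 0 < l ∧ (∀ Q ∈ D, ∃ k : ℤ, Q.side = l * 2 ^ k) ∧
    ∀ (k : ℤ) (x : Fin n → ℝ), ∃ Q ∈ D, Q.side = l * 2 ^ k ∧ x ∈ Q.set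
  nested : ∀ P ∈ D, ∀ Q ∈ D, P.set ⊆ Q.set ∨ Q.set ⊆ P.set ∨ Disjoint P.set Q.set

/-- `η`-sparse families of cubes. -/
def IsSparse {n : ℕ} (η : ℝ) (S : Set (Cube n)) : Prop :=
  ∃ E : Cube n → Set (Fin n → ℝ),
    (∀ Q ∈ S, MeasurableSet (E Q) ∧ E Q ⊆ Q.set ∧
      ENNReal.ofReal η * volume Q.set ≤ volume (E Q)) ∧
    S.PairwiseDisjoint E

/-! ### Commutators and the bilinear sparse bound -/

/-- `[b, T] f = b T f - T (b f)`. -/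
def opComm {X : Type*} (b : X → ℝ) (T : (X → ℝ) → X → ℝ) : (X → ℝ) → X → ℝ :=
  fun f x => b x * T f x - T (fun y => b y * f y) x

/-- `T_𝐛 = [b_m, … [b_2, [b_1, T]]]`. -/
def iterComm {X : Type*} : (m : ℕ) → (Fin m → X → ℝ) → ((X → ℝ) → X → ℝ) → (X → ℝ) → X → ℝ
  | 0, _, T => T
  | m + 1, b, T => opComm (b (Fin.last m)) (iterComm m (fun i => b i.castSucc) T)

/-- `|b - b_Q|_σ (x) = ∏_{i ∈ σ} |b_i(x) - (b_i)_Q|`. -/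
def oscProd {n m : ℕ} (b : Fin m → (Fin n → ℝ) → ℝ) (Q : Cube n) (σ : Finset (Fin m))
    (x : Fin n → ℝ) : ℝ :=
  ∏ i ∈ σ, |b i x - cubeAvg Q (b i)|

/-- `∑_j ∑_h ∑_{σ ∈ C_h(𝐛)} ∑_{Q ∈ S_j} ‖f |b - b_Q|_σ‖_{1,Q} ‖g |b - b_Q|_{σ'}‖_{A,Q} |Q|`. -/
def sparseForm {n m N : ℕ} (A : ℝ → ℝ) (b : Fin m → (Fin n → ℝ) → ℝ) (S : Fin N → Set (Cube n))
    (f g : (Fin n → ℝ) → ℝ) : ℝ≥0∞ :=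
  ∑ j, ∑ h ∈ Finset.range (m + 1), ∑ σ ∈ Finset.powersetCard h (Finset.univ : Finset (Fin m)),
    ∑' Q : S j,
      (⨍⁻ x in (Q : Cube n).set, ENNReal.ofReal |f x * oscProd b Q σ x| ∂volume) *
        luxNorm A (Q : Cube n) (fun x => g x * oscProd b Q σᶜ x) * volume (Q : Cube n).set

/-- The bilinear sparse bound, with constant `c₀`, sparseness `η` and dyadic grids `D j`, for an
operator `G` on a class `F` of measurable functions: `G f` is measurable for `f ∈ F`, and
`∫ (G f) g` is at most `c₀` times the sparse form, for every bounded compactly supported `g` for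
which the integral exists. The sparse families may depend on `f` and `g`. -/
def SparseBound {n m : ℕ} (A : ℝ → ℝ) (b : Fin m → (Fin n → ℝ) → ℝ) (η c₀ : ℝ)
    (D : Fin (3 ^ n) → Set (Cube n)) (F : Set ((Fin n → ℝ) → ℝ))
    (G : ((Fin n → ℝ) → ℝ) → (Fin n → ℝ) → ℝ) : Prop :=
  ∀ f ∈ F, AEMeasurable f volume ∧ AEMeasurable (G f) volume ∧
    ∀ g : (Fin n → ℝ) → ℝ, Measurable g → (∃ M : ℝ, ∀ x, |g x| ≤ M) → HasCompactSupport g →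
      Integrable (fun x => G f x * g x) volume →
      ∃ S : Fin (3 ^ n) → Set (Cube n), (∀ j, S j ⊆ D j ∧ IsSparse η (S j)) ∧
        ENNReal.ofReal (∫ x, G f x * g x) ≤ ENNReal.ofReal c₀ * sparseForm A b S f g

/-! ### The estimate -/

/-- The constant `C_{u,v}`, as a function of the number `κ = κ_u`; here `α = 1/r`. -/
def Cuv {n : ℕ} (m : ℕ) (α p s κ : ℝ) (u v : (Fin n → ℝ) → ℝ) : ℝ :=
  let R := (RHConst (2 * s - 1) u).toReal ^ (1 + (2 * s - 1) / (4 * s))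
  let a := (ApConst (fun _ => 1) 1 u).toReal
  let W := (AinftyConst (fun x => u x * v x)).toReal
  let K := (ApConst u p v).toReal
  ∑ h ∈ Finset.range (m + 1),
    κ * R * a * W ^ (1 + ((m : ℝ) - h) * α) *
      Real.log (Real.exp 1 + W ^ (1 + ((m : ℝ) - h) * α) * κ * R * a * K) ^ (1 + α)

/-- `uv({G(fv)/v > λ}) ≤ C ∫ φ_α(|f| N / λ) uv` for all `λ > 0` and all `f` with `f v ∈ F`. -/
def MixedEstimate {n : ℕ} (C α N : ℝ) (u v : (Fin n → ℝ) → ℝ) (F : Set ((Fin n → ℝ) → ℝ))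
    (G : ((Fin n → ℝ) → ℝ) → (Fin n → ℝ) → ℝ) : Prop :=
  ∀ f : (Fin n → ℝ) → ℝ, (fun x => f x * v x) ∈ F → ∀ lam : ℝ, 0 < lam →
    (volume.withDensity fun x => ENNReal.ofReal (u x * v x))
        {x | lam < G (fun y => f y * v y) x / v x} ≤
      ENNReal.ofReal C *
        ∫⁻ x, ENNReal.ofReal (phi α (|f x| * N / lam) * (u x * v x))

end

end MixedWeak

open MixedWeak

namespace MixedWeak

/-! ### Cubes -/

namespace Cube

variable {n : ℕ}

/-! Write w = uv, α = 1/r and Φ = ∫ φ_α(|f| ‖b‖/λ) w, and suppose Φ is finite. The weak type bound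
follows by testing the sparse bound. Let E be a bounded part of the level set {T_b(fv) > λv} on
which the data are bounded, and take g = χ_E u. The left side of the sparse bound is then at least λ
w(E), so it suffices to dominate the sparse form by λ(C C_{u,v} Φ + w(E)/2): as w(E) is finite, the
last term is absorbed. The grid cubes on which the w-average of φ_α(|f| ‖b‖/λ) exceeds 1 are
discarded beforehand. Their union has w-measure at most 3^n Φ (`measure_biUnion_le_of_grid`). The
reduction to such sets E is `SparseBound.measure_le`.

Each remaining cube Q gets two levels: the Orlicz size of f on Q with respect to w is about 2^{-k}
(`exists_phi_level`), and u(E ∩ Q)/u(Q) is about 2^{-l} (`exists_ratio_level`). By `sparseTerm_le`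
the cube contributes at most a constant times λ 2^{-k} 2^{-l/(8s)} w(Q). In the factor with f, the
A_1 condition replaces the average of u by u(x) and so turns v dx into w dx; the oscillations of the
symbols are exponentially integrable also with respect to w, at the price of [w]_{A_∞}^α, by the
sharp reverse Hölder inequality. In the factor with g, an Orlicz-Hölder inequality passes from A to
B, the bound on B passes to the power s(1+ε), and two applications of Cauchy-Schwarz
(`lavg_indicator_rpow_le`) keep a power of 2^{-l}. The first one splits s = 1/2 + q/2, which forces
q = 2s - 1; the second one uses the sharp reverse Hölder inequality for u^s, which dictates ε.

For fixed k and l, sparseness and the A_∞ property (`mul_sum_le_of_nested`) bound the sum of w(Q) in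
two ways, both with the factor [w]_{A_∞}/η: by about 2^k (k+2)^α Φ, and by [v]_{A_p(u)} 2^{(l+1)p}
w(E). In `exists_sum_levels_le` the first bound serves for k below a threshold growing linearly in l
and starting at the logarithm of the constants; this range produces the factor log^{1+α}. The second
bound serves for the other k, where 2^{-k} makes the total at most w(E)/2.

The facts on weights come from stopping cubes. The level sets of the local dyadic maximal function
decay geometrically in mass, which gives the sharp reverse Hölder inequality
(`lavg_rpow_le_of_maxL`). Conversely a reverse Hölder inequality gives a finite Fujii-Wilson
constant through Kolmogorov's inequality (`lintegral_maxL_indicator_le`); this yields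
`exists_AinftyConst_rpow_le` and `AinftyConst_mul_lt_top`. -/

theorem set_eq_pi (Q : Cube n) :
    Q.set = Set.pi univ fun i => Ico (Q.corner i) (Q.corner i + Q.side) := by
  ext x; simp [Cube.set, Set.mem_pi]

theorem measurableSet_set (Q : Cube n) : MeasurableSet Q.set := by
  rw [set_eq_pi]; exact MeasurableSet.univ_pi fun i => measurableSet_Ico

theorem volume_set (Q : Cube n) : volume Q.set = ENNReal.ofReal Q.side ^ n := by
  rw [set_eq_pi, Real.volume_pi_Ico]
  simp

theorem volume_ne_zero (Q : Cube n) : volume Q.set ≠ 0 := by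
  rw [volume_set]
  exact pow_ne_zero _ (by simpa using Q.side_pos)

theorem volume_ne_top (Q : Cube n) : volume Q.set ≠ ∞ := by
  rw [volume_set]
  exact ENNReal.pow_ne_top ENNReal.ofReal_ne_top

theorem interior_nonempty (Q : Cube n) : (interior Q.set).Nonempty := by
  rw [set_eq_pi, interior_pi_set finite_univ]
  refine ⟨fun i => Q.corner i + Q.side / 2, fun i _ => ?_⟩
  have := Q.side_pos
  simp only [interior_Ico, mem_Ioo]
  constructor <;> linarith

/-- The centre of a cube. -/
noncomputable def center (Q : Cube n) : Fin n → ℝ := fun i => Q.corner i + Q.side / 2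

theorem subset_closedBall (Q : Cube n) : Q.set ⊆ Metric.closedBall Q.center (Q.side / 2) := by
  intro x hx
  have := Q.side_pos
  rw [Metric.mem_closedBall, dist_pi_le_iff (by linarith)]
  intro i
  obtain ⟨h1, h2⟩ := hx i
  rw [Real.dist_eq, abs_le]
  simp only [center]
  constructor <;> linarith

theorem volume_closedBall (Q : Cube n) :
    volume (Metric.closedBall Q.center (Q.side / 2)) = volume Q.set := by
  have := Q.side_pos
  rw [Real.volume_pi_closedBall _ (by linarith), volume_set, ← ENNReal.ofReal_pow this.le,
    mul_div_cancel₀ _ two_ne_zero, Fintype.card_fin]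

/-- In the sup norm a closed cube is a closed ball. This makes the Vitali covering and
differentiation theorems for balls available for cubes. -/
theorem set_ae_eq_closedBall (Q : Cube n) :
    Q.set =ᵐ[volume] Metric.closedBall Q.center (Q.side / 2) :=
  ae_eq_of_subset_of_measure_ge Q.subset_closedBall Q.volume_closedBall.le
    Q.measurableSet_set.nullMeasurableSet (by rw [volume_closedBall]; exact Q.volume_ne_top)

theorem corner_mem (Q : Cube n) : Q.corner ∈ Q.set := fun i =>
  ⟨le_rfl, by linarith [Q.side_pos]⟩

theorem lintegral_lt_top_of_locallyIntegrable {w : (Fin n → ℝ) → ℝ}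
    (hw : LocallyIntegrable w volume) (Q : Cube n) :
    ∫⁻ x in Q.set, ENNReal.ofReal (w x) < ∞ := by
  have h := (hw.integrableOn_isCompact (isCompact_closedBall Q.center (Q.side / 2))).mono_set
    Q.subset_closedBall
  refine lt_of_le_of_lt (lintegral_mono fun x => ?_) h.2
  exact Real.ofReal_le_enorm _

theorem corner_le_of_subset {P Q : Cube n} (h : P.set ⊆ Q.set) (i : Fin n) :
    Q.corner i ≤ P.corner i ∧ P.corner i + P.side ≤ Q.corner i + Q.side := by
  refine ⟨(h P.corner_mem i).1, le_of_forall_lt fun c hc => ?_⟩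
  have hs := P.side_pos
  -- All coordinates move along the diagonal of `P` by the same amount, so that coordinate `i`
  -- reaches `c`; the maximum covers values of `c` below the corner.
  have hm : (fun j => max (P.corner j) (c - P.corner i + P.corner j)) ∈ P.set := by
    intro j
    refine ⟨le_max_left _ _, max_lt (by linarith) (by linarith)⟩
  have := (h hm i).2
  have h2 := le_max_right (P.corner i) (c - P.corner i + P.corner i)
  linarith

theorem eq_of_subset_of_side_eq {P Q : Cube n} (h : P.set ⊆ Q.set) (hs : P.side = Q.side) :
    P = Q := by
  have h1 := fun i => corner_le_of_subset h i
  have hc : P.corner = Q.corner := funext fun i => by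
    have := h1 i
    rw [hs] at this
    linarith
  cases P; cases Q; simp_all

end Cube

/-! ### Averages and the maximal function of extended nonnegative functions -/

section Averages

variable {n : ℕ}

/-- The average of a nonnegative function over a cube. -/
noncomputable def lavg (Q : Cube n) (f : (Fin n → ℝ) → ℝ≥0∞) : ℝ≥0∞ :=
  (∫⁻ x in Q.set, f x) / volume Q.set

/-- The maximal function over cubes of a nonnegative function. -/
noncomputable def maxL (f : (Fin n → ℝ) → ℝ≥0∞) (x : Fin n → ℝ) : ℝ≥0∞ :=
  ⨆ (Q : Cube n) (_ : x ∈ Q.set), lavg Q f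

theorem setLAverage_eq_lavg (Q : Cube n) (f : (Fin n → ℝ) → ℝ≥0∞) :
    ⨍⁻ x in Q.set, f x ∂volume = lavg Q f := by
  rw [setLAverage_eq, lavg]

theorem lavg_mul_volume (Q : Cube n) (f : (Fin n → ℝ) → ℝ≥0∞) :
    lavg Q f * volume Q.set = ∫⁻ x in Q.set, f x :=
  ENNReal.div_mul_cancel Q.volume_ne_zero Q.volume_ne_top

theorem lavg_le_iff {Q : Cube n} {f : (Fin n → ℝ) → ℝ≥0∞} {c : ℝ≥0∞} :
    lavg Q f ≤ c ↔ ∫⁻ x in Q.set, f x ≤ c * volume Q.set :=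
  ENNReal.div_le_iff Q.volume_ne_zero Q.volume_ne_top

theorem lt_lavg_iff {Q : Cube n} {f : (Fin n → ℝ) → ℝ≥0∞} {c : ℝ≥0∞} :
    c < lavg Q f ↔ c * volume Q.set < ∫⁻ x in Q.set, f x :=
  ENNReal.lt_div_iff_mul_lt (Or.inl Q.volume_ne_zero) (Or.inl Q.volume_ne_top)

theorem lavg_mono {Q : Cube n} {f g : (Fin n → ℝ) → ℝ≥0∞} (h : ∀ x, f x ≤ g x) :
    lavg Q f ≤ lavg Q g :=
  ENNReal.div_le_div_right (lintegral_mono h) _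

theorem lavg_le_maxL {Q : Cube n} {x : Fin n → ℝ} (hx : x ∈ Q.set) (f : (Fin n → ℝ) → ℝ≥0∞) :
    lavg Q f ≤ maxL f x :=
  le_iSup₂_of_le Q hx le_rfl

theorem lavg_indicator_of_subset {P Q : Cube n} (h : P.set ⊆ Q.set)
    (f : (Fin n → ℝ) → ℝ≥0∞) : lavg P (Q.set.indicator f) = lavg P f := by
  rw [lavg, lavg, setLIntegral_indicator Q.measurableSet_set, inter_eq_self_of_subset_right h]

theorem wAvg_one (Q : Cube n) (h : (Fin n → ℝ) → ℝ) :
    wAvg (fun _ => 1) Q h = lavg Q fun x => ENNReal.ofReal (h x) := by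
  simp [wAvg, lavg]

theorem maxFn_one (h : (Fin n → ℝ) → ℝ) (x : Fin n → ℝ) :
    maxFn (fun _ => 1) h x = maxL (fun x => ENNReal.ofReal (h x)) x := by
  simp only [maxFn, maxL, wAvg_one]

theorem ofReal_indicator (s : Set (Fin n → ℝ)) (w : (Fin n → ℝ) → ℝ) :
    (fun x => ENNReal.ofReal (s.indicator w x)) = s.indicator fun x => ENNReal.ofReal (w x) := by
  ext x
  by_cases hx : x ∈ s <;> simp [hx]

theorem lintegral_weight_ne_zero {w : (Fin n → ℝ) → ℝ} (hw : IsWeight w) (Q : Cube n) :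
    ∫⁻ x in Q.set, ENNReal.ofReal (w x) ≠ 0 := by
  intro h0
  rw [lintegral_eq_zero_iff' hw.1.aestronglyMeasurable.aemeasurable.ennreal_ofReal.restrict] at h0
  refine Q.volume_ne_zero ?_
  have : ∀ᵐ x ∂volume.restrict Q.set, False := by
    filter_upwards [h0, ae_restrict_of_ae hw.2] with x hx hx'
    simp at hx
    linarith
  rwa [ae_iff, show {a : Fin n → ℝ | ¬False} = univ by simp, Measure.restrict_apply_univ] at this

/-- The Fujii-Wilson constant controls the maximal function on every cube. -/
theorem lintegral_maxL_le {w : (Fin n → ℝ) → ℝ} (hw : IsWeight w) (Q : Cube n) :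
    ∫⁻ x in Q.set, maxL (Q.set.indicator fun x => ENNReal.ofReal (w x)) x ≤
      AinftyConst w * ∫⁻ x in Q.set, ENNReal.ofReal (w x) := by
  have h : (∫⁻ x in Q.set, maxL (Q.set.indicator fun x => ENNReal.ofReal (w x)) x) /
      ∫⁻ x in Q.set, ENNReal.ofReal (w x) ≤ AinftyConst w := by
    refine le_iSup_of_le Q (le_of_eq ?_)
    simp only [maxFn_one, ofReal_indicator]
  refine (ENNReal.div_le_iff ?_ (Q.lintegral_lt_top_of_locallyIntegrable hw.1).ne).1 h
  exact lintegral_weight_ne_zero hw Q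

end Averages

/-! ### Weak type and Kolmogorov estimates for the maximal function. -/

section MaximalFunction

variable {n : ℕ}

/-- The average as an integral against a normalized measure: Hölder's inequality for integrals then
applies to averages directly. -/
theorem lavg_eq_lintegral (Q : Cube n) (f : (Fin n → ℝ) → ℝ≥0∞) :
    lavg Q f = ∫⁻ x, f x ∂((volume Q.set)⁻¹ • volume.restrict Q.set) := by
  rw [lintegral_smul_measure, lavg, ENNReal.div_eq_inv_mul, smul_eq_mul]

theorem lavg_const (Q : Cube n) (c : ℝ≥0∞) : lavg Q (fun _ => c) = c := by
  rw [lavg, setLIntegral_const, ENNReal.mul_div_cancel_right Q.volume_ne_zero Q.volume_ne_top]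

/-- Hölder's inequality for averages. -/
theorem lavg_mul_le {p q : ℝ} (hpq : p.HolderConjugate q) (Q : Cube n)
    {f g : (Fin n → ℝ) → ℝ≥0∞} (hf : AEMeasurable f (volume.restrict Q.set))
    (hg : AEMeasurable g (volume.restrict Q.set)) :
    lavg Q (fun x => f x * g x) ≤
      lavg Q (fun x => f x ^ p) ^ (1 / p) * lavg Q (fun x => g x ^ q) ^ (1 / q) := by
  simp only [lavg_eq_lintegral]
  exact ENNReal.lintegral_mul_le_Lp_mul_Lq _ hpq (hf.smul_measure _) (hg.smul_measure _)

/-- Jensen's inequality for averages. -/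
theorem lavg_rpow_le {t : ℝ} (ht : 1 ≤ t) (Q : Cube n) {f : (Fin n → ℝ) → ℝ≥0∞}
    (hf : AEMeasurable f (volume.restrict Q.set)) :
    lavg Q f ^ t ≤ lavg Q (fun x => f x ^ t) := by
  rcases ht.eq_or_lt with rfl | ht
  · simp
  have h := lavg_mul_le (Real.HolderConjugate.conjExponent ht) Q hf
    (aemeasurable_const (b := (1 : ℝ≥0∞)))
  simp only [mul_one, ENNReal.one_rpow, lavg_const] at h
  calc lavg Q f ^ t ≤ (lavg Q (fun x => f x ^ t) ^ (1 / t)) ^ t :=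
        ENNReal.rpow_le_rpow h (by linarith)
    _ = _ := by rw [← ENNReal.rpow_mul, one_div_mul_cancel (by linarith), ENNReal.rpow_one]

/-- The weak type `(1, 1)` estimate for the maximal function over cubes. -/
theorem mul_volume_maxL_gt_le (hn : 0 < n) {f : (Fin n → ℝ) → ℝ≥0∞} (hf : ∫⁻ x, f x ≠ ∞)
    {c : ℝ≥0∞} (hc : c ≠ 0) (hc' : c ≠ ∞) :
    c * volume {x | c < maxL f x} ≤ 5 ^ n * ∫⁻ x, f x := by
  set S : Set (Cube n) := {Q | c < lavg Q f}
  -- The Vitali covering lemma needs bounded radii. A cube with average above `c` has volume at most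
  -- `(∫ f) / c`, and a side exceeding 1 is at most the volume because `n ≥ 1`.
  have hR : ∀ Q ∈ S, Q.side / 2 ≤ max 1 ((∫⁻ x, f x) / c).toReal := by
    intro Q hQ
    have hT : (∫⁻ x, f x) / c ≠ ∞ := ENNReal.div_ne_top hf hc
    have h1 : ENNReal.ofReal Q.side ^ n ≤ (∫⁻ x, f x) / c := by
      rw [ENNReal.le_div_iff_mul_le (Or.inl hc) (Or.inl hc'), mul_comm, ← Q.volume_set]
      exact (lt_lavg_iff.1 hQ).le.trans (setLIntegral_le_lintegral _ _)
    rw [← ENNReal.ofReal_pow Q.side_pos.le, ENNReal.ofReal_le_iff_le_toReal hT] at h1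
    have h2 := Q.side_pos
    rcases le_total Q.side 1 with h | h
    · exact le_max_of_le_left (by linarith)
    · exact le_max_of_le_right (by linarith [le_self_pow₀ h hn.ne'])
  obtain ⟨u, huS, hud, hcov⟩ := Vitali.exists_disjoint_subfamily_covering_enlargement_closedBall S
    Cube.center (fun Q => Q.side / 2) _ hR 5 (by norm_num)
  have hud' : u.PairwiseDisjoint Cube.set := fun P hP Q hQ hPQ =>
    (hud hP hQ hPQ).mono P.subset_closedBall Q.subset_closedBall
  have huc : u.Countable := hud'.countable_of_nonempty_interior fun Q _ => Q.interior_nonempty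
  have hsub : {x | c < maxL f x} ⊆
      ⋃ Q ∈ u, Metric.closedBall (Cube.center Q) (5 * (Q.side / 2)) := by
    intro x hx
    obtain ⟨Q, hQ⟩ := lt_iSup_iff.1 (show c < maxL f x from hx)
    obtain ⟨hxQ, hQ⟩ := lt_iSup_iff.1 hQ
    obtain ⟨P, hP, hQP⟩ := hcov Q hQ
    exact mem_biUnion hP (hQP (Q.subset_closedBall hxQ))
  have hvol : ∀ Q : Cube n, volume (Metric.closedBall Q.center (5 * (Q.side / 2))) =
      5 ^ n * volume Q.set := by
    intro Q
    have := Q.side_pos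
    rw [Real.volume_pi_closedBall _ (by linarith), Q.volume_set, Fintype.card_fin,
      show 2 * (5 * (Q.side / 2)) = 5 * Q.side by ring, mul_pow,
      ENNReal.ofReal_mul (by positivity), ENNReal.ofReal_pow this.le,
      ENNReal.ofReal_pow (by norm_num)]
    simp
  calc c * volume {x | c < maxL f x}
      ≤ c * ∑' Q : u, volume (Metric.closedBall (Q : Cube n).center (5 * ((Q : Cube n).side / 2))) :=
        mul_le_mul_right ((measure_mono hsub).trans (measure_biUnion_le _ huc _)) _
    _ = ∑' Q : u, 5 ^ n * (c * volume (Q : Cube n).set) := by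
        rw [← ENNReal.tsum_mul_left]
        simp only [hvol]
        congr 1; ext Q; ring
    _ ≤ ∑' Q : u, 5 ^ n * ∫⁻ x in (Q : Cube n).set, f x :=
        ENNReal.tsum_le_tsum fun Q => mul_le_mul_right (lt_lavg_iff.1 (huS Q.2)).le _
    _ = 5 ^ n * ∫⁻ x in ⋃ Q ∈ u, Q.set, f x := by
        rw [ENNReal.tsum_mul_left, lintegral_biUnion huc (fun Q _ => Q.measurableSet_set) hud']
    _ ≤ _ := mul_le_mul_right (setLIntegral_le_lintegral _ _) _

/-- The constant in Kolmogorov's inequality for the maximal function. -/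
noncomputable def kolmogorovConst (n : ℕ) (t : ℝ) : ℝ≥0∞ :=
  1 + 2 * 5 ^ n * (1 - 2 ^ (1 - t))⁻¹

theorem kolmogorovConst_ne_top (n : ℕ) {t : ℝ} (ht : 1 < t) : kolmogorovConst n t ≠ ∞ := by
  have h : (2 : ℝ≥0∞) ^ (1 - t) < 1 :=
    ENNReal.rpow_lt_one_of_one_lt_of_neg (by norm_num) (by linarith)
  refine ENNReal.add_ne_top.2 ⟨by simp, ENNReal.mul_ne_top (ENNReal.mul_ne_top (by simp) ?_) ?_⟩
  · exact ENNReal.pow_ne_top (by simp)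
  · exact ENNReal.inv_ne_top.2 (tsub_pos_of_lt h).ne'

/-- Kolmogorov's inequality for the localized maximal function. -/
theorem lintegral_maxL_indicator_le (hn : 0 < n) {t : ℝ} (ht : 1 < t) (Q : Cube n)
    {w : (Fin n → ℝ) → ℝ≥0∞} (hw : AEMeasurable w volume) {A : ℝ≥0∞} (hA : A ≠ 0)
    (hA' : A ≠ ∞) (h : lavg Q (fun x => w x ^ t) ≤ A ^ t) :
    ∫⁻ x in Q.set, maxL (Q.set.indicator w) x ≤ kolmogorovConst n t * (A * volume Q.set) := by
  have ht0 : 0 < t := by linarith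
  set M := maxL (Q.set.indicator w) with hM
  -- By Jensen's inequality the level sets of `M` lie in those of the maximal function of `w ^ t`,
  -- whose weak type bound decays like `c ^ (-t)`.
  have hjen : ∀ (c : ℝ≥0∞) (x : Fin n → ℝ), c < M x →
      c ^ t < maxL (Q.set.indicator fun x => w x ^ t) x := by
    intro c x hx
    obtain ⟨P, hP⟩ := lt_iSup_iff.1 (show c < maxL _ x from hx)
    obtain ⟨hxP, hP⟩ := lt_iSup_iff.1 hP
    refine lt_of_lt_of_le (ENNReal.rpow_lt_rpow hP ht0) ?_
    refine (lavg_rpow_le ht.le P (hw.indicator Q.measurableSet_set).restrict).trans ?_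
    refine le_trans (le_of_eq ?_) (lavg_le_maxL hxP _)
    congr 1; ext y
    by_cases hy : y ∈ Q.set <;> simp [hy, ht0]
  have hint : ∫⁻ x, Q.set.indicator (fun x => w x ^ t) x ≤ A ^ t * volume Q.set := by
    rw [lintegral_indicator Q.measurableSet_set]
    exact lavg_le_iff.1 h
  have hAt : A ^ t * volume Q.set ≠ ∞ :=
    ENNReal.mul_ne_top (ENNReal.rpow_ne_top_of_nonneg ht0.le hA') Q.volume_ne_top
  -- Measurable hulls have the same measure and spare a proof that the maximal function is
  -- measurable.
  set H : ℕ → Set (Fin n → ℝ) := fun k => toMeasurable volume {x | 2 ^ k * A < M x} with hH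
  have hlevel : ∀ k : ℕ, 2 ^ (k + 1) * A * volume (H k) ≤
      (2 * 5 ^ n * (A * volume Q.set)) * (2 ^ (1 - t)) ^ k := by
    intro k
    have hck : (2 ^ k * A : ℝ≥0∞) ≠ 0 := mul_ne_zero (by simp) hA
    have hck' : (2 ^ k * A : ℝ≥0∞) ≠ ∞ := ENNReal.mul_ne_top (ENNReal.pow_ne_top (by simp)) hA'
    have h1 : (2 ^ k * A) ^ t * volume (H k) ≤ 5 ^ n * (A ^ t * volume Q.set) := by
      rw [hH, measure_toMeasurable]
      refine le_trans (mul_le_mul_right (measure_mono (hjen _)) _) ?_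
      refine (mul_volume_maxL_gt_le hn (ne_top_of_le_ne_top hAt hint) ?_ ?_).trans
        (mul_le_mul_right hint _)
      · exact (ENNReal.rpow_pos (pos_iff_ne_zero.2 hck) hck').ne'
      · exact ENNReal.rpow_ne_top_of_nonneg ht0.le hck'
    have hAt0 : A ^ t ≠ 0 := (ENNReal.rpow_pos (pos_iff_ne_zero.2 hA) hA').ne'
    have hAtt : A ^ t ≠ ∞ := ENNReal.rpow_ne_top_of_nonneg ht0.le hA'
    have h2 : ((2 : ℝ≥0∞) ^ k) ^ t * volume (H k) ≤ 5 ^ n * volume Q.set := by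
      rw [ENNReal.mul_rpow_of_nonneg _ _ ht0.le] at h1
      rw [← ENNReal.mul_le_mul_iff_right hAt0 hAtt]
      calc A ^ t * (((2 : ℝ≥0∞) ^ k) ^ t * volume (H k)) = _ := by ring
        _ ≤ _ := h1
        _ = _ := by ring
    have h3 : (2 : ℝ≥0∞) ^ k = ((2 : ℝ≥0∞) ^ (1 - t)) ^ k * ((2 : ℝ≥0∞) ^ k) ^ t := by
      rw [← ENNReal.rpow_natCast, ← ENNReal.rpow_natCast, ← ENNReal.rpow_mul, ← ENNReal.rpow_mul,
        ← ENNReal.rpow_add _ _ (by simp) (by simp)]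
      congr 1; ring
    calc 2 ^ (k + 1) * A * volume (H k)
        = 2 * A * (((2 : ℝ≥0∞) ^ (1 - t)) ^ k * ((2 : ℝ≥0∞) ^ k) ^ t) * volume (H k) := by
          rw [← h3, pow_succ]; ring
      _ = 2 * A * ((2 : ℝ≥0∞) ^ (1 - t)) ^ k * (((2 : ℝ≥0∞) ^ k) ^ t * volume (H k)) := by ring
      _ ≤ 2 * A * ((2 : ℝ≥0∞) ^ (1 - t)) ^ k * (5 ^ n * volume Q.set) := mul_le_mul_right h2 _
      _ = _ := by ring
  -- Layer decomposition: on `2 ^ k * A < M x ≤ 2 ^ (k + 1) * A` the term of index `k` suffices, and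
  -- where `M` is infinite all terms are present and the series diverges.
  have hpt : ∀ x, M x ≤ A + ∑' k : ℕ, (H k).indicator (fun _ => 2 ^ (k + 1) * A) x := by
    intro x
    have hmem : ∀ k, 2 ^ k * A < M x → (H k).indicator (fun _ => 2 ^ (k + 1) * A) x =
        2 ^ (k + 1) * A := fun k hk =>
      indicator_of_mem (subset_toMeasurable volume {x | 2 ^ k * A < M x} hk) _
    by_cases hex : ∃ k : ℕ, M x ≤ 2 ^ k * A
    · classical
      have hk := Nat.find_spec hex
      rcases hk' : Nat.find hex with _ | k
      · rw [hk'] at hk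
        simp only [pow_zero, one_mul] at hk
        exact hk.trans le_self_add
      · rw [hk'] at hk
        have hlt : 2 ^ k * A < M x := not_le.1 (Nat.find_min hex (by omega))
        refine le_trans ?_ le_add_self
        exact (hk.trans (hmem k hlt).ge).trans (ENNReal.le_tsum k)
    · simp only [not_exists, not_le] at hex
      have : ∑' k : ℕ, (H k).indicator (fun _ => 2 ^ (k + 1) * A) x = ∞ := by
        rw [eq_top_iff, ← ENNReal.tsum_const_eq_top_of_ne_zero (α := ℕ) hA]
        refine ENNReal.tsum_le_tsum fun k => ?_
        rw [hmem k (hex k)]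
        exact le_mul_of_one_le_left' (one_le_pow₀ (by norm_num))
      rw [this]; simp
  calc ∫⁻ x in Q.set, M x
      ≤ ∫⁻ x in Q.set, (A + ∑' k : ℕ, (H k).indicator (fun _ => 2 ^ (k + 1) * A) x) :=
        lintegral_mono hpt
    _ = A * volume Q.set + ∑' k : ℕ, ∫⁻ x in Q.set, (H k).indicator (fun _ => 2 ^ (k + 1) * A) x := by
        rw [lintegral_add_left measurable_const, setLIntegral_const, lintegral_tsum]
        exact fun k => (measurable_const.indicator (measurableSet_toMeasurable _ _)).aemeasurable
    _ ≤ A * volume Q.set + ∑' k : ℕ, (2 * 5 ^ n * (A * volume Q.set)) * (2 ^ (1 - t)) ^ k := by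
        gcongr with k
        refine le_trans (setLIntegral_le_lintegral _ _) ?_
        rw [lintegral_indicator_const (measurableSet_toMeasurable _ _)]
        exact hlevel k
    _ = kolmogorovConst n t * (A * volume Q.set) := by
        rw [ENNReal.tsum_mul_left, ENNReal.tsum_geometric, kolmogorovConst]
        ring

end MaximalFunction

/-! ### Dyadic subcubes and stopping cubes -/

section Dyadic

variable {n : ℕ}

namespace Cube

/-- The dyadic subcube of generation `m` of `Q` (or of a translate of `Q`) containing `x`. -/
noncomputable def sub (Q : Cube n) (m : ℕ) (x : Fin n → ℝ) : Cube n where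
  corner i := Q.corner i + Q.side / 2 ^ m * ⌊(x i - Q.corner i) / (Q.side / 2 ^ m)⌋
  side := Q.side / 2 ^ m
  side_pos := div_pos Q.side_pos (by positivity)

theorem mem_sub_iff (Q : Cube n) (m : ℕ) (x y : Fin n → ℝ) :
    y ∈ (Q.sub m x).set ↔ ∀ i, ⌊(y i - Q.corner i) / (Q.side / 2 ^ m)⌋ =
      ⌊(x i - Q.corner i) / (Q.side / 2 ^ m)⌋ := by
  have hs : 0 < Q.side / 2 ^ m := (Q.sub m x).side_pos
  simp only [Cube.set, sub, mem_ofPred_eq]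
  refine forall_congr' fun i => ?_
  rw [Int.floor_eq_iff, le_div_iff₀ hs, div_lt_iff₀ hs]
  constructor <;> rintro ⟨h1, h2⟩ <;> constructor <;> nlinarith

theorem mem_sub (Q : Cube n) (m : ℕ) (x : Fin n → ℝ) : x ∈ (Q.sub m x).set :=
  (Q.mem_sub_iff m x x).2 fun _ => rfl

theorem sub_eq_of_mem {Q : Cube n} {m : ℕ} {x y : Fin n → ℝ} (h : y ∈ (Q.sub m x).set) :
    Q.sub m y = Q.sub m x := by
  rw [mem_sub_iff] at h
  simp only [sub, h]

theorem sub_succ_subset (Q : Cube n) (m : ℕ) (x : Fin n → ℝ) :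
    (Q.sub (m + 1) x).set ⊆ (Q.sub m x).set := by
  intro y hy
  rw [mem_sub_iff] at hy ⊢
  intro i
  have hs : 0 < Q.side / 2 ^ m := (Q.sub m x).side_pos
  -- The index of the parent is the integer half of the index of the child, so equal children have
  -- equal parents.
  have key : ∀ z : ℝ, ⌊z / (Q.side / 2 ^ m)⌋ = ⌊z / (Q.side / 2 ^ (m + 1))⌋ / 2 := by
    intro z
    have h2 : z / (Q.side / 2 ^ m) = z / (Q.side / 2 ^ (m + 1)) / (2 : ℕ) := by
      have := Q.side_pos.ne'
      field_simp
      push_cast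
      ring
    rw [h2, Int.floor_div_natCast]
    norm_num
  rw [key, key, hy i]

theorem sub_subset_of_le (Q : Cube n) {m k : ℕ} (h : m ≤ k) (x : Fin n → ℝ) :
    (Q.sub k x).set ⊆ (Q.sub m x).set := by
  induction k, h using Nat.le_induction with
  | base => exact Subset.rfl
  | succ k _ ih => exact (Q.sub_succ_subset k x).trans ih

theorem sub_zero_of_mem {Q : Cube n} {x : Fin n → ℝ} (hx : x ∈ Q.set) : Q.sub 0 x = Q := by
  have h : ∀ i, ⌊(x i - Q.corner i) / Q.side⌋ = 0 := by
    intro i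
    obtain ⟨h1, h2⟩ := hx i
    rw [Int.floor_eq_zero_iff]
    exact ⟨div_nonneg (by linarith) Q.side_pos.le, (div_lt_one Q.side_pos).2 (by linarith)⟩
  cases Q
  simp only [sub, pow_zero, div_one] at h ⊢
  simp [h]

theorem sub_subset {Q : Cube n} (m : ℕ) {x : Fin n → ℝ} (hx : x ∈ Q.set) :
    (Q.sub m x).set ⊆ Q.set := by
  have := Q.sub_subset_of_le (Nat.zero_le m) x
  rwa [sub_zero_of_mem hx] at this

theorem volume_sub (Q : Cube n) (m : ℕ) (x : Fin n → ℝ) :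
    volume (Q.sub m x).set = 2 ^ n * volume (Q.sub (m + 1) x).set := by
  rw [volume_set, volume_set, ← mul_pow]
  congr 1
  simp only [sub]
  rw [show (2 : ℝ≥0∞) = ENNReal.ofReal 2 by simp, ← ENNReal.ofReal_mul (by norm_num)]
  congr 1
  rw [pow_succ]; field_simp

/-- A measure comparison on a set that is partitioned into cubes. -/
theorem measure_le_of_partition {Ω : Set (Fin n → ℝ)} {P : (Fin n → ℝ) → Cube n}
    (hmem : ∀ x ∈ Ω, x ∈ (P x).set) (hsub : ∀ x ∈ Ω, (P x).set ⊆ Ω)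
    (heq : ∀ x ∈ Ω, ∀ y ∈ (P x).set, P y = P x) :
    MeasurableSet Ω ∧ ∀ μ ν : Measure (Fin n → ℝ),
      (∀ x ∈ Ω, μ (P x).set ≤ ν (P x).set) → μ Ω ≤ ν Ω := by
  -- Two of the cubes that share a point coincide by `heq`; disjoint cubes with nonempty interior
  -- form a countable family, so both measures can be summed over it.
  have hd : (P '' Ω).PairwiseDisjoint Cube.set := by
    rintro _ ⟨x, hx, rfl⟩ _ ⟨y, hy, rfl⟩ hne
    refine disjoint_left.2 fun z hz hz' => hne ?_
    rw [← heq x hx z hz, heq y hy z hz']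
  have hc : (P '' Ω).Countable := hd.countable_of_nonempty_interior fun Q _ => Q.interior_nonempty
  have hU : Ω = ⋃ Q ∈ P '' Ω, Q.set := by
    refine Subset.antisymm (fun x hx => mem_biUnion (mem_image_of_mem P hx) (hmem x hx)) ?_
    refine iUnion₂_subset ?_
    rintro _ ⟨x, hx, rfl⟩
    exact hsub x hx
  refine ⟨hU ▸ MeasurableSet.biUnion hc fun Q _ => Q.measurableSet_set, fun μ ν h => ?_⟩
  rw [hU, measure_biUnion hc hd fun Q _ => Q.measurableSet_set,
    measure_biUnion hc hd fun Q _ => Q.measurableSet_set]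
  refine ENNReal.tsum_le_tsum ?_
  rintro ⟨_, x, hx, rfl⟩
  exact h x hx

end Cube

/-- The set where the dyadic maximal function relative to `Q` exceeds `c`. -/
def levelSet (w : (Fin n → ℝ) → ℝ≥0∞) (Q : Cube n) (c : ℝ≥0∞) : Set (Fin n → ℝ) :=
  {x | x ∈ Q.set ∧ ∃ m, c < lavg (Q.sub m x) w}

/-- The maximal dyadic subcube of `Q` containing `x` on which the average of `w` exceeds `c`. -/
noncomputable def stopCube (w : (Fin n → ℝ) → ℝ≥0∞) (Q : Cube n) (c : ℝ≥0∞) (x : Fin n → ℝ) :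
    Cube n :=
  Q.sub (sInf {m | c < lavg (Q.sub m x) w}) x

variable {w : (Fin n → ℝ) → ℝ≥0∞} {Q : Cube n} {c c' : ℝ≥0∞} {x y : Fin n → ℝ}

theorem mem_stopCube : x ∈ (stopCube w Q c x).set := Q.mem_sub _ x

theorem lt_lavg_stopCube (hx : x ∈ levelSet w Q c) : c < lavg (stopCube w Q c x) w :=
  Nat.sInf_mem (s := {m | c < lavg (Q.sub m x) w}) hx.2

/-- The parent of a stopping cube was not selected, so its average is at most `c`; passing to the
child costs the volume ratio `2 ^ n`. If the stopping cube is `Q` itself, `hc` is used instead. -/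
theorem lavg_stopCube_le (hc : lavg Q w ≤ c) (hx : x ∈ levelSet w Q c) :
    lavg (stopCube w Q c x) w ≤ 2 ^ n * c := by
  rw [stopCube]
  rcases h : sInf {m | c < lavg (Q.sub m x) w} with _ | m
  · rw [Cube.sub_zero_of_mem hx.1]
    exact hc.trans (le_mul_of_one_le_left' (one_le_pow₀ (by norm_num)))
  · have hm : m ∉ {m | c < lavg (Q.sub m x) w} := Nat.notMem_of_lt_sInf (by omega)
    have hm' := lavg_le_iff.1 (not_lt.1 hm)
    rw [lavg_le_iff]
    refine (lintegral_mono_set (Q.sub_succ_subset m x)).trans (hm'.trans (le_of_eq ?_))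
    rw [Q.volume_sub]; ring

theorem stopCube_subset (hx : x ∈ levelSet w Q c) : (stopCube w Q c x).set ⊆ Q.set :=
  Cube.sub_subset _ hx.1

theorem lavg_sub_eq_of_mem {m k : ℕ} (h : y ∈ (Q.sub m x).set) (hk : k ≤ m) :
    Q.sub k y = Q.sub k x :=
  Cube.sub_eq_of_mem (Q.sub_subset_of_le hk x h)

theorem mem_levelSet_of_mem_stopCube (hx : x ∈ levelSet w Q c)
    (hy : y ∈ (stopCube w Q c x).set) : y ∈ levelSet w Q c := by
  refine ⟨stopCube_subset hx hy, sInf {m | c < lavg (Q.sub m x) w}, ?_⟩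
  rw [lavg_sub_eq_of_mem hy le_rfl]
  exact lt_lavg_stopCube hx

/-- Points of one stopping cube have the same dyadic ancestors down to its generation, hence the
same stopping generation. -/
theorem stopCube_eq_of_mem (hx : x ∈ levelSet w Q c) (hy : y ∈ (stopCube w Q c x).set) :
    stopCube w Q c y = stopCube w Q c x := by
  have hle : sInf {m | c < lavg (Q.sub m y) w} ≤ sInf {m | c < lavg (Q.sub m x) w} := by
    refine Nat.sInf_le ?_
    rw [mem_ofPred_eq, lavg_sub_eq_of_mem hy le_rfl]
    exact lt_lavg_stopCube hx
  have hge : sInf {m | c < lavg (Q.sub m x) w} ≤ sInf {m | c < lavg (Q.sub m y) w} := by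
    refine Nat.sInf_le ?_
    rw [mem_ofPred_eq, ← lavg_sub_eq_of_mem hy hle]
    exact lt_lavg_stopCube (mem_levelSet_of_mem_stopCube hx hy)
  rw [stopCube, le_antisymm hle hge, lavg_sub_eq_of_mem hy le_rfl, stopCube]

theorem levelSet_anti (h : c ≤ c') : levelSet w Q c' ⊆ levelSet w Q c :=
  fun _ hx => ⟨hx.1, hx.2.imp fun _ hm => h.trans_lt hm⟩

theorem stopCube_anti (h : c ≤ c') (hx : x ∈ levelSet w Q c') :
    (stopCube w Q c' x).set ⊆ (stopCube w Q c x).set := by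
  refine Q.sub_subset_of_le (Nat.sInf_le ?_) x
  exact h.trans_lt (lt_lavg_stopCube hx)

/-- Measure comparison on level sets, localized to a set saturated for the stopping cubes. -/
theorem levelSet_inter_measure {S : Set (Fin n → ℝ)}
    (hS : ∀ x ∈ levelSet w Q c ∩ S, (stopCube w Q c x).set ⊆ S) :
    MeasurableSet (levelSet w Q c ∩ S) ∧ ∀ μ ν : Measure (Fin n → ℝ),
      (∀ x ∈ levelSet w Q c ∩ S, μ (stopCube w Q c x).set ≤ ν (stopCube w Q c x).set) →
        μ (levelSet w Q c ∩ S) ≤ ν (levelSet w Q c ∩ S) :=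
  Cube.measure_le_of_partition (fun _ _ => mem_stopCube)
    (fun x hx => subset_inter (fun _ hy => mem_levelSet_of_mem_stopCube hx.1 hy) (hS x hx))
    (fun _ hx _ hy => stopCube_eq_of_mem hx.1 hy)

theorem measurableSet_levelSet : MeasurableSet (levelSet w Q c) := by
  have := (levelSet_inter_measure (w := w) (Q := Q) (c := c) (S := univ)
    fun _ _ => subset_univ _).1
  rwa [inter_univ] at this

/-- A higher threshold stops later, so the higher level set inside a stopping cube is a union of
whole stopping cubes. This is the hypothesis of `levelSet_inter_measure`. -/
theorem stopCube_saturated (h : c ≤ c') (hx : x ∈ levelSet w Q c) :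
    ∀ y ∈ levelSet w Q c' ∩ (stopCube w Q c x).set,
      (stopCube w Q c' y).set ⊆ (stopCube w Q c x).set := fun _ hy =>
  (stopCube_anti h hy.1).trans (congrArg Cube.set (stopCube_eq_of_mem hx hy.2)).subset

theorem withDensity_set (P : Cube n) : volume.withDensity w P.set = ∫⁻ x in P.set, w x :=
  withDensity_apply _ P.measurableSet_set

/-- The stopping cube has mass at most `2 ^ n * c` times its volume, while each stopping cube of the
next level has average above `2 ^ (n + 1) * c`; the latter can therefore fill at most half of it. -/
theorem two_mul_volume_levelSet_inter_le (hc : lavg Q w ≤ c) (hc0 : c ≠ 0) (hct : c ≠ ∞)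
    (hx : x ∈ levelSet w Q c) :
    2 * volume (levelSet w Q (2 ^ (n + 1) * c) ∩ (stopCube w Q c x).set) ≤
      volume (stopCube w Q c x).set := by
  have hcc : c ≤ 2 ^ (n + 1) * c := le_mul_of_one_le_left' (one_le_pow₀ (by norm_num))
  have h1 := (levelSet_inter_measure (stopCube_saturated hcc hx)).2
    ((2 ^ (n + 1) * c) • volume) (volume.withDensity w) (fun y hy => by
      rw [withDensity_set, Measure.smul_apply, smul_eq_mul]
      exact (lt_lavg_iff.1 (lt_lavg_stopCube hy.1)).le)
  have h2 := h1.trans (measure_mono inter_subset_right)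
  rw [withDensity_set] at h2
  have h3 := h2.trans (lavg_le_iff.1 (lavg_stopCube_le hc hx))
  rw [Measure.smul_apply, smul_eq_mul] at h3
  have h0 : (2 ^ n * c : ℝ≥0∞) ≠ 0 := mul_ne_zero (by simp) hc0
  have ht : (2 ^ n * c : ℝ≥0∞) ≠ ∞ := ENNReal.mul_ne_top (ENNReal.pow_ne_top (by simp)) hct
  rw [← ENNReal.mul_le_mul_iff_right h0 ht]
  refine le_trans (le_of_eq ?_) h3
  rw [pow_succ]; ring

theorem volume_stopCube_le (hc : lavg Q w ≤ c) (hc0 : c ≠ 0) (hct : c ≠ ∞)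
    (hx : x ∈ levelSet w Q c) :
    volume (stopCube w Q c x).set ≤
      2 * volume ((stopCube w Q c x).set \ levelSet w Q (2 ^ (n + 1) * c)) := by
  have h := two_mul_volume_levelSet_inter_le hc hc0 hct hx
  have h2 := measure_inter_add_sdiff (μ := volume) (stopCube w Q c x).set
    (measurableSet_levelSet (w := w) (Q := Q) (c := 2 ^ (n + 1) * c))
  rw [inter_comm] at h2
  set V := volume (stopCube w Q c x).set with hV
  have hVt : V ≠ ∞ := Cube.volume_ne_top _
  have hfin : volume (levelSet w Q (2 ^ (n + 1) * c) ∩ (stopCube w Q c x).set) ≠ ∞ :=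
    ne_top_of_le_ne_top hVt (measure_mono inter_subset_right)
  have h3 : V + V ≤ V + 2 * volume ((stopCube w Q c x).set \ levelSet w Q (2 ^ (n + 1) * c)) := by
    calc V + V = 2 * V := by ring
      _ = 2 * volume (levelSet w Q (2 ^ (n + 1) * c) ∩ (stopCube w Q c x).set) +
          2 * volume ((stopCube w Q c x).set \ levelSet w Q (2 ^ (n + 1) * c)) := by
        rw [← mul_add, h2]
      _ ≤ _ := by gcongr
  exact (ENNReal.add_le_add_iff_left hVt).1 h3

/-- Lebesgue differentiation along dyadic subcubes. -/
theorem ae_le_of_notMem_levelSet (hw : AEMeasurable w volume) (hint : ∫⁻ x in Q.set, w x ≠ ∞) :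
    ∀ᵐ x, x ∈ Q.set → ∀ c, x ∉ levelSet w Q c → w x ≤ c := by
  have h := (IsUnifLocDoublingMeasure.vitaliFamily (volume : Measure (Fin n → ℝ))
    1).ae_tendsto_lintegral_div (f := Q.set.indicator w) (hw.indicator Q.measurableSet_set)
    (by rwa [lintegral_indicator Q.measurableSet_set])
  filter_upwards [h] with x hx hxQ c hxc
  have hball : Tendsto (fun m : ℕ => (Q.sub m x).side / 2) atTop (nhdsWithin 0 (Ioi 0)) := by
    refine tendsto_nhdsWithin_iff.2 ⟨?_, Eventually.of_forall fun m => by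
      have := (Q.sub m x).side_pos
      simp only [mem_Ioi]; linarith⟩
    have : Tendsto (fun m : ℕ => Q.side / 2 * (1 / 2 : ℝ) ^ m) atTop (nhds (Q.side / 2 * 0)) :=
      (tendsto_pow_atTop_nhds_zero_of_lt_one (by norm_num) (by norm_num)).const_mul _
    rw [mul_zero] at this
    refine this.congr fun m => ?_
    simp only [Cube.sub, one_div, inv_pow]
    ring
  -- The subcubes contain `x` without being centred at it, so convergence is needed along the Vitali
  -- family with `K = 1`.
  have ht := hx.comp (IsUnifLocDoublingMeasure.tendsto_closedBall_filterAt (volume) (K := 1)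
    (fun m : ℕ => (Q.sub m x).center) (fun m : ℕ => (Q.sub m x).side / 2) hball
    (Eventually.of_forall fun m => by
      rw [one_mul]
      exact (Q.sub m x).subset_closedBall (Q.mem_sub m x)))
  rw [indicator_of_mem hxQ] at ht
  refine le_of_tendsto ht (Eventually.of_forall fun m => ?_)
  simp only [Function.comp]
  rw [Cube.volume_closedBall, ← setLIntegral_congr (Q.sub m x).set_ae_eq_closedBall]
  change lavg (Q.sub m x) _ ≤ c
  rw [lavg_indicator_of_subset (Cube.sub_subset m hxQ)]
  by_contra hcon
  exact hxc ⟨hxQ, m, not_le.1 hcon⟩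

end Dyadic

/-! ### Reverse Hölder inequalities -/

section ReverseHolder

variable {n : ℕ} {w : (Fin n → ℝ) → ℝ≥0∞} {Q : Cube n}

/-- Geometric decay of the level sets yields a reverse Hölder inequality. -/
theorem lavg_rpow_le_of_decay (hw : AEMeasurable w volume) (hL0 : lavg Q w ≠ 0)
    (hLt : lavg Q w ≠ ∞) {b θ : ℝ≥0∞} (hb : 1 ≤ b) {δ : ℝ} (hδ : 0 < δ)
    (hdec : ∀ m : ℕ, volume.withDensity w (levelSet w Q (b ^ m * lavg Q w)) ≤
      θ ^ m * ∫⁻ x in Q.set, w x) :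
    lavg Q (fun x => w x ^ (1 + δ)) ≤
      (1 + b ^ δ * (1 - b ^ δ * θ)⁻¹) * lavg Q w ^ (1 + δ) := by
  classical
  set L := lavg Q w with hL
  have hI : ∫⁻ x in Q.set, w x = L * volume Q.set := (lavg_mul_volume Q w).symm
  have hIt : ∫⁻ x in Q.set, w x ≠ ∞ := by
    rw [hI]; exact ENNReal.mul_ne_top hLt Q.volume_ne_top
  -- Outside the level set of height `c` one has `w ≤ c` almost everywhere, so `w ^ (1 + δ) ≤ c ^ δ
  -- * w`. The height used at `x` is that of the first level set missing `x`; if there is none, the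
  -- series diverges.
  have hpt : ∀ᵐ x, x ∈ Q.set → w x ^ (1 + δ) ≤ L ^ δ * w x +
      ∑' m : ℕ, (levelSet w Q (b ^ m * L)).indicator (fun x => (b ^ (m + 1) * L) ^ δ * w x) x := by
    filter_upwards [ae_le_of_notMem_levelSet hw hIt] with x hx hxQ
    have hx := hx hxQ
    -- Zeros of `w` are treated apart because the divergence argument below needs nonzero terms.
    rcases eq_or_ne (w x) 0 with h0 | h0
    · simp [h0, show 0 < 1 + δ by linarith]
    have hle : ∀ c, x ∉ levelSet w Q c → w x ^ (1 + δ) ≤ c ^ δ * w x := by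
      intro c hc
      have hwc := hx c hc
      rw [ENNReal.rpow_add_of_nonneg _ _ zero_le_one hδ.le, ENNReal.rpow_one, mul_comm]
      gcongr
    by_cases hex : ∃ m : ℕ, x ∉ levelSet w Q (b ^ m * L)
    · have hm := Nat.find_spec hex
      rcases hm' : Nat.find hex with _ | m
      · rw [hm', pow_zero, one_mul] at hm
        exact (hle _ hm).trans le_self_add
      · rw [hm'] at hm
        have hmem : x ∈ levelSet w Q (b ^ m * L) := not_not.1 (Nat.find_min hex (by omega))
        refine le_trans ((hle _ hm).trans ?_) le_add_self
        refine le_trans (le_of_eq ?_) (ENNReal.le_tsum m)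
        rw [indicator_of_mem hmem]
    · simp only [not_exists, not_not] at hex
      have : ∑' m : ℕ, (levelSet w Q (b ^ m * L)).indicator
          (fun x => (b ^ (m + 1) * L) ^ δ * w x) x = ∞ := by
        have h1 : L ^ δ * w x ≠ 0 :=
          mul_ne_zero (ENNReal.rpow_pos (pos_iff_ne_zero.2 hL0) hLt).ne' h0
        rw [eq_top_iff, ← ENNReal.tsum_const_eq_top_of_ne_zero (α := ℕ) h1]
        refine ENNReal.tsum_le_tsum fun m => ?_
        rw [indicator_of_mem (hex m)]
        gcongr
        exact le_mul_of_one_le_left' (one_le_pow₀ hb)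
      rw [this]; simp
  have hterm : ∀ m : ℕ, ∫⁻ x in Q.set,
      (levelSet w Q (b ^ m * L)).indicator (fun x => (b ^ (m + 1) * L) ^ δ * w x) x ≤
        b ^ δ * L ^ δ * (L * volume Q.set) * (b ^ δ * θ) ^ m := by
    intro m
    refine (setLIntegral_le_lintegral _ _).trans ?_
    rw [lintegral_indicator measurableSet_levelSet, lintegral_const_mul'' _ hw.restrict,
      ← withDensity_apply _ measurableSet_levelSet]
    calc (b ^ (m + 1) * L) ^ δ * volume.withDensity w (levelSet w Q (b ^ m * L))
        ≤ (b ^ (m + 1) * L) ^ δ * (θ ^ m * (L * volume Q.set)) := by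
          rw [← hI]; exact mul_le_mul_right (hdec m) _
      _ = b ^ δ * L ^ δ * (L * volume Q.set) * (b ^ δ * θ) ^ m := by
          rw [ENNReal.mul_rpow_of_nonneg _ _ hδ.le, pow_succ,
            ENNReal.mul_rpow_of_nonneg _ _ hδ.le, mul_pow,
            show (b ^ m) ^ δ = (b ^ δ) ^ m by
              rw [← ENNReal.rpow_natCast, ← ENNReal.rpow_natCast, ← ENNReal.rpow_mul,
                ← ENNReal.rpow_mul, mul_comm]]
          ring
  rw [lavg_le_iff]
  calc ∫⁻ x in Q.set, w x ^ (1 + δ)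
      ≤ ∫⁻ x in Q.set, (L ^ δ * w x + ∑' m : ℕ,
          (levelSet w Q (b ^ m * L)).indicator (fun x => (b ^ (m + 1) * L) ^ δ * w x) x) :=
        setLIntegral_mono_ae' Q.measurableSet_set hpt
    _ = L ^ δ * (L * volume Q.set) + ∑' m : ℕ, ∫⁻ x in Q.set,
          (levelSet w Q (b ^ m * L)).indicator (fun x => (b ^ (m + 1) * L) ^ δ * w x) x := by
        rw [lintegral_add_left' (hw.restrict.const_mul _), lintegral_const_mul'' _ hw.restrict, hI,
          lintegral_tsum fun m => ((hw.const_mul _).indicator measurableSet_levelSet).restrict]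
    _ ≤ L ^ δ * (L * volume Q.set) +
          ∑' m : ℕ, b ^ δ * L ^ δ * (L * volume Q.set) * (b ^ δ * θ) ^ m := by
        gcongr with m
        exact hterm m
    _ = _ := by
        rw [ENNReal.tsum_mul_left, ENNReal.tsum_geometric,
          ENNReal.rpow_add_of_nonneg _ _ zero_le_one hδ.le, ENNReal.rpow_one]
        ring

/-- The level sets lose half of their mass after a number of generations comparable to the
Fujii-Wilson constant. -/
theorem two_mul_withDensity_levelSet_le {W : ℝ≥0∞}
    (hW : ∀ P : Cube n, ∫⁻ x in P.set, maxL (P.set.indicator w) x ≤ W * ∫⁻ x in P.set, w x)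
    {N : ℕ} (hN0 : N ≠ 0) (hN : 2 ^ (n + 2) * W ≤ N) {c : ℝ≥0∞} (hc : lavg Q w ≤ c) (hc0 : c ≠ 0)
    (hct : c ≠ ∞) :
    2 * volume.withDensity w (levelSet w Q ((2 ^ (n + 1)) ^ N * c)) ≤
      volume.withDensity w (levelSet w Q c) := by
  set a : ℝ≥0∞ := 2 ^ (n + 1) with ha
  have ha1 : 1 ≤ a := one_le_pow₀ (by norm_num)
  have hat : a ≠ ∞ := ENNReal.pow_ne_top (by simp)
  set μ := volume.withDensity w with hμ
  set Ω : ℕ → Set (Fin n → ℝ) := fun j => levelSet w Q (a ^ j * c) with hΩ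
  have hle : ∀ j, c ≤ a ^ j * c := fun j => le_mul_of_one_le_left' (one_le_pow₀ ha1)
  have hmono : ∀ i j, i ≤ j → Ω j ⊆ Ω i := fun i j hij =>
    levelSet_anti (mul_le_mul_left (pow_le_pow_right₀ ha1 hij) c)
  have hcj0 : ∀ j, a ^ j * c ≠ 0 := fun j => mul_ne_zero (by simp [ha]) hc0
  have hcjt : ∀ j, a ^ j * c ≠ ∞ := fun j => ENNReal.mul_ne_top (ENNReal.pow_ne_top hat) hct
  -- It is enough to halve the mass inside each stopping cube of the lowest level, where the
  -- Fujii-Wilson hypothesis can be used on that cube.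
  have key : ∀ x ∈ levelSet w Q c, 2 * μ (Ω N ∩ (stopCube w Q c x).set) ≤
      μ (stopCube w Q c x).set := by
    intro x hx
    set P := stopCube w Q c x with hP
    -- A stopping cube of level `j` has mass at most `2 ^ n` times the height times its volume, and
    -- at least half of that volume lies outside `Ω (j + 1)`. There the maximal function localized
    -- to `P` is above the height, so the mass is paid by its integral over the layer.
    have hlev : ∀ j, μ (Ω j ∩ P.set) ≤
        a * ∫⁻ y in (Ω j ∩ P.set) \ Ω (j + 1), maxL (P.set.indicator w) y := by
      intro j
      obtain ⟨hmeas, hcomp⟩ := levelSet_inter_measure (stopCube_saturated (hle j) hx)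
      have h1 := hcomp μ ((a * (a ^ j * c)) • volume.restrict (Ω (j + 1))ᶜ) (fun y hy => by
        rw [withDensity_set, Measure.smul_apply, Measure.restrict_apply (Cube.measurableSet_set _),
          smul_eq_mul, ← Set.sdiff_eq]
        refine (lavg_le_iff.1 (lavg_stopCube_le (hc.trans (hle j)) hy.1)).trans ?_
        refine (mul_le_mul_right (volume_stopCube_le (hc.trans (hle j)) (hcj0 j) (hcjt j) hy.1)
          _).trans (le_of_eq ?_)
        have : (2 ^ (n + 1) * (a ^ j * c) : ℝ≥0∞) = a ^ (j + 1) * c := by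
          rw [← ha, pow_succ]; ring
        rw [this]
        calc _ = 2 ^ (n + 1) * (a ^ j * c) *
              volume ((stopCube w Q (a ^ j * c) y).set \ Ω (j + 1)) := by
              rw [pow_succ 2 n, mul_assoc, mul_assoc, mul_assoc, mul_assoc, mul_assoc,
                mul_left_comm _ 2, mul_left_comm _ 2]
          _ = _ := by rw [← ha, ← this, ← ha])
      refine h1.trans ?_
      rw [Measure.smul_apply, Measure.restrict_apply hmeas, smul_eq_mul, mul_assoc, ← Set.sdiff_eq]
      refine mul_le_mul_right ?_ a
      rw [← setLIntegral_const]
      refine setLIntegral_mono' (hmeas.diff measurableSet_levelSet) fun y hy => ?_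
      refine (lt_lavg_stopCube hy.1.1).le.trans ?_
      rw [← lavg_indicator_of_subset (stopCube_saturated (hle j) hx y hy.1)]
      exact lavg_le_maxL mem_stopCube _
    have hmeasD : ∀ j, MeasurableSet ((Ω j ∩ P.set) \ Ω (j + 1)) := fun j =>
      (measurableSet_levelSet.inter P.measurableSet_set).diff measurableSet_levelSet
    have hdisj : (Finset.range N : Set ℕ).PairwiseDisjoint
        fun j => (Ω j ∩ P.set) \ Ω (j + 1) := by
      intro i _ j _ hij
      rcases lt_or_gt_of_ne hij with h | h
      · exact disjoint_left.2 fun y hy hy' => hy.2 (hmono _ _ h hy'.1.1)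
      · exact disjoint_left.2 fun y hy hy' => hy'.2 (hmono _ _ h hy.1.1)
    -- `Ω N` lies in every earlier level set and the layers are disjoint, so `N` copies of its mass
    -- cost a single integral of the maximal function over `P`.
    have hsum : (N : ℝ≥0∞) * μ (Ω N ∩ P.set) ≤ a * (W * μ P.set) := by
      calc (N : ℝ≥0∞) * μ (Ω N ∩ P.set) = ∑ j ∈ Finset.range N, μ (Ω N ∩ P.set) := by simp
        _ ≤ ∑ j ∈ Finset.range N,
            a * ∫⁻ y in (Ω j ∩ P.set) \ Ω (j + 1), maxL (P.set.indicator w) y :=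
          Finset.sum_le_sum fun j hj => (measure_mono (inter_subset_inter_left _
            (hmono _ _ (Finset.mem_range.1 hj).le))).trans (hlev j)
        _ = a * ∫⁻ y in ⋃ j ∈ Finset.range N, (Ω j ∩ P.set) \ Ω (j + 1),
            maxL (P.set.indicator w) y := by
          rw [← Finset.mul_sum, lintegral_biUnion_finset hdisj fun j _ => hmeasD j]
        _ ≤ a * ∫⁻ y in P.set, maxL (P.set.indicator w) y := by
          refine mul_le_mul_right (lintegral_mono_set ?_) a
          exact iUnion₂_subset fun j _ y hy => hy.1.2
        _ ≤ _ := mul_le_mul_right ((hW P).trans_eq (by rw [hμ, withDensity_set])) a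
    have hNt : (N : ℝ≥0∞) ≠ ∞ := ENNReal.natCast_ne_top N
    rw [← ENNReal.mul_le_mul_iff_right (Nat.cast_ne_zero.2 hN0) hNt]
    calc (N : ℝ≥0∞) * (2 * μ (Ω N ∩ P.set)) = 2 * (N * μ (Ω N ∩ P.set)) := by ring
      _ ≤ 2 * (a * (W * μ P.set)) := mul_le_mul_right hsum _
      _ = 2 ^ (n + 2) * W * μ P.set := by rw [ha]; ring
      _ ≤ N * μ P.set := mul_le_mul_left hN _
  have hfin := (levelSet_inter_measure (w := w) (Q := Q) (c := c) (S := univ)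
    fun _ _ => subset_univ _).2 ((2 : ℝ≥0∞) • μ.restrict (Ω N)) μ (fun x hx => by
      rw [Measure.smul_apply, Measure.restrict_apply (Cube.measurableSet_set _), inter_comm,
        smul_eq_mul]
      exact key x hx.1)
  rw [inter_univ, Measure.smul_apply, Measure.restrict_apply measurableSet_levelSet,
    smul_eq_mul] at hfin
  refine le_trans (le_of_eq ?_) hfin
  congr 2
  exact (inter_eq_self_of_subset_right (levelSet_anti (hle N))).symm

/-- Iteration of the halving in blocks of `N` generations, which raises the height by `(2 ^ (n + 1))
^ N` each time. -/
theorem withDensity_levelSet_le_half_pow {W : ℝ≥0∞}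
    (hW : ∀ P : Cube n, ∫⁻ x in P.set, maxL (P.set.indicator w) x ≤ W * ∫⁻ x in P.set, w x)
    {N : ℕ} (hN0 : N ≠ 0) (hN : 2 ^ (n + 2) * W ≤ N) (hL0 : lavg Q w ≠ 0) (hLt : lavg Q w ≠ ∞)
    (m : ℕ) :
    volume.withDensity w (levelSet w Q (((2 ^ (n + 1)) ^ N) ^ m * lavg Q w)) ≤
      2⁻¹ ^ m * ∫⁻ x in Q.set, w x := by
  induction m with
  | zero =>
    rw [pow_zero, pow_zero, one_mul, one_mul, ← withDensity_set]
    exact measure_mono fun x hx => hx.1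
  | succ m ih =>
    have ha1 : (1 : ℝ≥0∞) ≤ ((2 ^ (n + 1)) ^ N) ^ m :=
      one_le_pow₀ (one_le_pow₀ (one_le_pow₀ (by norm_num)))
    have h := two_mul_withDensity_levelSet_le (Q := Q) hW hN0 hN
      (c := ((2 ^ (n + 1)) ^ N) ^ m * lavg Q w) (le_mul_of_one_le_left' ha1)
      (mul_ne_zero (by simp) hL0)
      (ENNReal.mul_ne_top (ENNReal.pow_ne_top (ENNReal.pow_ne_top (ENNReal.pow_ne_top (by simp))))
        hLt)
    rw [← mul_assoc, ← pow_succ'] at h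
    have h2 : (2 : ℝ≥0∞)⁻¹ * 2 = 1 := ENNReal.inv_mul_cancel (by simp) (by simp)
    calc volume.withDensity w (levelSet w Q (((2 ^ (n + 1)) ^ N) ^ (m + 1) * lavg Q w))
        = 2⁻¹ * (2 * volume.withDensity w
            (levelSet w Q (((2 ^ (n + 1)) ^ N) ^ (m + 1) * lavg Q w))) := by
          rw [← mul_assoc, h2, one_mul]
      _ ≤ 2⁻¹ * (2⁻¹ ^ m * ∫⁻ x in Q.set, w x) := mul_le_mul_right (h.trans ih) _
      _ = _ := by rw [pow_succ]; ring

/-- The dimensional constant in the sharp reverse Hölder inequality. -/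
noncomputable def rhDim (n : ℕ) : ℝ := (n + 1) * 2 ^ (n + 4)

theorem rhDim_pos (n : ℕ) : 0 < rhDim n := by unfold rhDim; positivity

theorem rhDim_ge_one (n : ℕ) : 1 ≤ rhDim n := by
  unfold rhDim
  have : (1 : ℝ) ≤ 2 ^ (n + 4) := one_le_pow₀ (by norm_num)
  have h2 : (0 : ℝ) ≤ n := Nat.cast_nonneg n
  nlinarith

/-- The sharp reverse Hölder inequality. -/
theorem lavg_rpow_le_of_maxL (hw : AEMeasurable w volume) {W : ℝ} (hW1 : 1 ≤ W)
    (hW : ∀ P : Cube n, ∫⁻ x in P.set, maxL (P.set.indicator w) x ≤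
      ENNReal.ofReal W * ∫⁻ x in P.set, w x)
    (hL0 : lavg Q w ≠ 0) (hLt : lavg Q w ≠ ∞) {δ : ℝ} (hδ : 0 < δ) (hδW : δ ≤ 1 / (rhDim n * W)) :
    lavg Q (fun x => w x ^ (1 + δ)) ≤ 7 * lavg Q w ^ (1 + δ) := by
  set N := ⌈2 ^ (n + 2) * W⌉₊ with hN
  have hpow : (1 : ℝ) ≤ 2 ^ (n + 2) := one_le_pow₀ (by norm_num)
  have hge : 2 ^ (n + 2) * W ≤ (N : ℝ) := Nat.le_ceil _
  have hlt : (N : ℝ) < 2 ^ (n + 2) * W + 1 := Nat.ceil_lt_add_one (by positivity)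
  have hNle : (N : ℝ) ≤ 2 ^ (n + 3) * W := by
    have : (2 : ℝ) ^ (n + 3) = 2 * 2 ^ (n + 2) := by rw [pow_succ]; ring
    rw [this]; nlinarith
  have hN0 : N ≠ 0 := by
    intro h0
    rw [h0] at hge
    norm_num at hge
    nlinarith
  have hdec := withDensity_levelSet_le_half_pow (Q := Q) hW hN0 (by
    rw [show (2 : ℝ≥0∞) ^ (n + 2) = ENNReal.ofReal (2 ^ (n + 2)) by
      rw [ENNReal.ofReal_pow (by norm_num)]; simp, ← ENNReal.ofReal_mul (by positivity),
      ← ENNReal.ofReal_natCast]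
    exact ENNReal.ofReal_le_ofReal hge) hL0 hLt
  have h := lavg_rpow_le_of_decay hw hL0 hLt (b := (2 ^ (n + 1)) ^ N) (θ := 2⁻¹)
    (one_le_pow₀ (one_le_pow₀ (by norm_num))) hδ hdec
  refine h.trans (mul_le_mul_left ?_ _)
  -- `rhDim` is made for this bound. With `b = 2 ^ ((n + 1) * N)` it gives `b ^ δ ≤ √2 ≤ 3/2`, so
  -- the geometric ratio is at most `3/4` and the constant is `1 + (3/2) * 4 = 7`.
  have hexp : ((n + 1 : ℕ) * N : ℝ) * δ ≤ 1 / 2 := by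
    have hτ : 0 < rhDim n * W := mul_pos (rhDim_pos n) (by linarith)
    rw [le_div_iff₀ hτ] at hδW
    unfold rhDim at hδW
    have h16 : (2 : ℝ) ^ (n + 4) = 2 * 2 ^ (n + 3) := by rw [pow_succ _ (n + 3)]; ring
    rw [h16] at hδW
    push_cast
    have : ((n : ℝ) + 1) * N * δ ≤ ((n : ℝ) + 1) * (2 ^ (n + 3) * W) * δ := by gcongr
    nlinarith
  have hb : (((2 : ℝ≥0∞) ^ (n + 1)) ^ N) ^ δ ≤ ENNReal.ofReal (3 / 2) := by
    rw [← pow_mul, ← ENNReal.rpow_natCast, ← ENNReal.rpow_mul]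
    have h2 : (2 : ℝ≥0∞) = ENNReal.ofReal 2 := by simp
    rw [h2, ENNReal.ofReal_rpow_of_pos (by norm_num)]
    refine ENNReal.ofReal_le_ofReal ?_
    calc (2 : ℝ) ^ (((n + 1) * N : ℕ) * δ) ≤ 2 ^ (1 / 2 : ℝ) :=
          Real.rpow_le_rpow_of_exponent_le (by norm_num) (by push_cast at hexp ⊢; exact hexp)
      _ ≤ 3 / 2 := by
          rw [← Real.sqrt_eq_rpow, Real.sqrt_le_left (by norm_num)]
          norm_num
  have h2 : ENNReal.ofReal (3 / 2) * 2⁻¹ = ENNReal.ofReal (3 / 4) := by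
    rw [show (2 : ℝ≥0∞)⁻¹ = ENNReal.ofReal (1 / 2) by
      rw [one_div, ENNReal.ofReal_inv_of_pos (by norm_num)]; simp, ← ENNReal.ofReal_mul (by norm_num)]
    norm_num
  calc 1 + (((2 : ℝ≥0∞) ^ (n + 1)) ^ N) ^ δ * (1 - (((2 : ℝ≥0∞) ^ (n + 1)) ^ N) ^ δ * 2⁻¹)⁻¹
      ≤ 1 + ENNReal.ofReal (3 / 2) * (1 - ENNReal.ofReal (3 / 4))⁻¹ := by
        rw [← h2]
        gcongr
    _ = 7 := by
        rw [← ENNReal.ofReal_one, ← ENNReal.ofReal_sub _ (by norm_num),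
          ← ENNReal.ofReal_inv_of_pos (by norm_num), ← ENNReal.ofReal_mul (by norm_num),
          ← ENNReal.ofReal_add (by norm_num) (by norm_num)]
        norm_num

end ReverseHolder

/-! ### The constants of the weights -/

section Weights

variable {n : ℕ}

namespace IsWeight

variable {w : (Fin n → ℝ) → ℝ}

theorem aemeasurable (hw : IsWeight w) : AEMeasurable w volume :=
  hw.1.aestronglyMeasurable.aemeasurable

theorem aemeasurable_ofReal (hw : IsWeight w) :
    AEMeasurable (fun x => ENNReal.ofReal (w x)) volume :=
  hw.aemeasurable.ennreal_ofReal

theorem lintegral_ne_top (hw : IsWeight w) (Q : Cube n) :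
    ∫⁻ x in Q.set, ENNReal.ofReal (w x) ≠ ∞ :=
  (Q.lintegral_lt_top_of_locallyIntegrable hw.1).ne

theorem lintegral_ne_zero (hw : IsWeight w) (Q : Cube n) :
    ∫⁻ x in Q.set, ENNReal.ofReal (w x) ≠ 0 :=
  lintegral_weight_ne_zero hw Q

theorem lavg_ne_top (hw : IsWeight w) (Q : Cube n) :
    lavg Q (fun x => ENNReal.ofReal (w x)) ≠ ∞ :=
  ENNReal.div_ne_top (hw.lintegral_ne_top Q) Q.volume_ne_zero

theorem lavg_ne_zero (hw : IsWeight w) (Q : Cube n) :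
    lavg Q (fun x => ENNReal.ofReal (w x)) ≠ 0 :=
  ENNReal.div_ne_zero.2 ⟨hw.lintegral_ne_zero Q, Q.volume_ne_top⟩

theorem one_le_AinftyConst (hw : IsWeight w) : 1 ≤ AinftyConst w := by
  let Q : Cube n := ⟨0, 1, one_pos⟩
  have h := lintegral_maxL_le hw Q
  have h2 : ∫⁻ x in Q.set, ENNReal.ofReal (w x) ≤
      ∫⁻ x in Q.set, maxL (Q.set.indicator fun x => ENNReal.ofReal (w x)) x := by
    rw [← lavg_mul_volume, ← setLIntegral_const]
    refine setLIntegral_mono' Q.measurableSet_set fun x hx => ?_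
    rw [← lavg_indicator_of_subset Subset.rfl]
    exact lavg_le_maxL hx _
  have h3 := h2.trans h
  rw [← ENNReal.mul_le_mul_iff_left (hw.lintegral_ne_zero Q) (hw.lintegral_ne_top Q), one_mul]
  exact h3

theorem one_le_AinftyConst_toReal (hw : IsWeight w) (h : AinftyConst w ≠ ∞) :
    1 ≤ (AinftyConst w).toReal := by
  have := ENNReal.toReal_mono h hw.one_le_AinftyConst
  simpa using this

end IsWeight

theorem AinftyConst_le {w : (Fin n → ℝ) → ℝ} {C : ℝ≥0∞}
    (h : ∀ Q : Cube n, ∫⁻ x in Q.set, maxL (Q.set.indicator fun x => ENNReal.ofReal (w x)) x ≤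
      C * ∫⁻ x in Q.set, ENNReal.ofReal (w x)) : AinftyConst w ≤ C := by
  refine iSup_le fun Q => ENNReal.div_le_of_le_mul ?_
  simpa only [maxFn_one, ofReal_indicator] using h Q

/-- The sharp reverse Hölder inequality for weights in terms of the Fujii-Wilson constant. -/
theorem IsWeight.lavg_rpow_le {w : (Fin n → ℝ) → ℝ} (hw : IsWeight w) (h : AinftyConst w ≠ ∞)
    {δ : ℝ} (hδ : 0 < δ) (hδW : δ ≤ 1 / (rhDim n * (AinftyConst w).toReal)) (Q : Cube n) :
    lavg Q (fun x => ENNReal.ofReal (w x) ^ (1 + δ)) ≤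
      7 * lavg Q (fun x => ENNReal.ofReal (w x)) ^ (1 + δ) := by
  refine lavg_rpow_le_of_maxL hw.aemeasurable_ofReal (hw.one_le_AinftyConst_toReal h)
    (fun P => ?_) (hw.lavg_ne_zero Q) (hw.lavg_ne_top Q) hδ hδW
  rw [ENNReal.ofReal_toReal h]
  exact lintegral_maxL_le hw P

theorem locallyIntegrable_of_cubes {w : (Fin n → ℝ) → ℝ} (hw : AEMeasurable w volume)
    (h0 : ∀ᵐ x, 0 < w x) (h : ∀ Q : Cube n, ∫⁻ x in Q.set, ENNReal.ofReal (w x) ≠ ∞) :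
    LocallyIntegrable w volume := by
  intro x
  let Q : Cube n := ⟨fun i => x i - 1, 2, two_pos⟩
  refine ⟨Q.set, ?_, hw.aestronglyMeasurable.restrict, ?_⟩
  · rw [Q.set_eq_pi]
    refine set_pi_mem_nhds finite_univ fun i _ => Ico_mem_nhds ?_ ?_ <;> simp only [Q] <;> linarith
  · refine lt_of_le_of_lt (le_of_eq ?_) (lt_top_iff_ne_top.2 (h Q))
    refine lintegral_congr_ae ?_
    filter_upwards [ae_restrict_of_ae h0] with y hy
    exact Real.enorm_of_nonneg hy.le

/-! #### The class `A_1` -/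

/-- The supremum over cubes sits inside the essential supremum, so one null set serves all cubes at
once. -/
theorem ae_lavg_le_of_A1 {u : (Fin n → ℝ) → ℝ} (hu : MemAp (fun _ => 1) 1 u) :
    ∀ᵐ x, ∀ Q : Cube n, x ∈ Q.set → lavg Q (fun x => ENNReal.ofReal (u x)) ≤
      ApConst (fun _ => 1) 1 u * ENNReal.ofReal (u x) := by
  have h := ENNReal.ae_le_essSup (μ := volume)
    (fun x => maxFn (fun _ => 1) u x / ENNReal.ofReal (u x))
  filter_upwards [h, hu.1.2] with x hx hx0 Q hxQ
  have hx' : maxFn (fun _ => 1) u x / ENNReal.ofReal (u x) ≤ ApConst (fun _ => 1) 1 u := by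
    simpa [ApConst] using hx
  rw [ENNReal.div_le_iff (by simpa using hx0) (by simp), maxFn_one] at hx'
  exact (lavg_le_maxL hxQ _).trans hx'

theorem lintegral_mul_volume_le_of_A1 {u : (Fin n → ℝ) → ℝ} (hu : MemAp (fun _ => 1) 1 u)
    (Q : Cube n) {E : Set (Fin n → ℝ)} (hE : MeasurableSet E) (hEQ : E ⊆ Q.set) :
    (∫⁻ x in Q.set, ENNReal.ofReal (u x)) * volume E ≤
      ApConst (fun _ => 1) 1 u * (∫⁻ x in E, ENNReal.ofReal (u x)) * volume Q.set := by
  rw [← lavg_mul_volume, mul_right_comm]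
  refine mul_le_mul_left ?_ _
  rw [← setLIntegral_const, ← lintegral_const_mul'' _ hu.1.aemeasurable_ofReal.restrict]
  refine setLIntegral_mono_ae' hE ?_
  filter_upwards [ae_lavg_le_of_A1 hu] with x hx hxE
  exact hx Q (hEQ hxE)

theorem one_le_A1Const {u : (Fin n → ℝ) → ℝ} (hu : MemAp (fun _ => 1) 1 u) :
    1 ≤ ApConst (fun _ => 1) 1 u := by
  let Q : Cube n := ⟨0, 1, one_pos⟩
  have h := lintegral_mul_volume_le_of_A1 hu Q Q.measurableSet_set Subset.rfl
  have h0 : (∫⁻ x in Q.set, ENNReal.ofReal (u x)) * volume Q.set ≠ 0 :=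
    mul_ne_zero (hu.1.lintegral_ne_zero Q) Q.volume_ne_zero
  have ht : (∫⁻ x in Q.set, ENNReal.ofReal (u x)) * volume Q.set ≠ ∞ :=
    ENNReal.mul_ne_top (hu.1.lintegral_ne_top Q) Q.volume_ne_top
  rw [← ENNReal.mul_le_mul_iff_left h0 ht, one_mul, ← mul_assoc]
  exact h

/-! #### Reverse Hölder classes -/

theorem ofReal_rpow_ae_eq {u : (Fin n → ℝ) → ℝ} (hu : ∀ᵐ x, 0 < u x) (q : ℝ) :
    (fun x => ENNReal.ofReal (u x ^ q)) =ᵐ[volume] fun x => ENNReal.ofReal (u x) ^ q := by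
  filter_upwards [hu] with x hx
  exact (ENNReal.ofReal_rpow_of_pos hx).symm

theorem lavg_congr_ae {f g : (Fin n → ℝ) → ℝ≥0∞} (h : f =ᵐ[volume] g) (Q : Cube n) :
    lavg Q f = lavg Q g := by
  rw [lavg, lavg, lintegral_congr_ae (ae_restrict_of_ae h)]

theorem lavg_rpow_le_RH {u : (Fin n → ℝ) → ℝ} (hu : IsWeight u) {q : ℝ} (hq : 0 < q)
    (Q : Cube n) : lavg Q (fun x => ENNReal.ofReal (u x) ^ q) ≤
      (RHConst q u * lavg Q fun x => ENNReal.ofReal (u x)) ^ q := by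
  have h : lavg Q (fun x => ENNReal.ofReal (u x) ^ q) ^ (1 / q) /
      lavg Q (fun x => ENNReal.ofReal (u x)) ≤ RHConst q u := by
    refine le_iSup_of_le Q (le_of_eq ?_)
    rw [setLAverage_eq_lavg, setLAverage_eq_lavg, lavg_congr_ae (ofReal_rpow_ae_eq hu.2 q)]
  rw [ENNReal.div_le_iff (hu.lavg_ne_zero Q) (hu.lavg_ne_top Q)] at h
  calc _ = (lavg Q (fun x => ENNReal.ofReal (u x) ^ q) ^ (1 / q)) ^ q := by
        rw [← ENNReal.rpow_mul, one_div_mul_cancel hq.ne', ENNReal.rpow_one]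
    _ ≤ _ := ENNReal.rpow_le_rpow h hq.le

theorem one_le_RHConst {u : (Fin n → ℝ) → ℝ} (hu : IsWeight u) {q : ℝ} (hq : 1 ≤ q) :
    1 ≤ RHConst q u := by
  let Q : Cube n := ⟨0, 1, one_pos⟩
  have h := (lavg_rpow_le hq Q hu.aemeasurable_ofReal.restrict).trans
    (lavg_rpow_le_RH hu (by linarith) Q)
  rw [ENNReal.rpow_le_rpow_iff (by linarith)] at h
  rw [← ENNReal.mul_le_mul_iff_left (hu.lavg_ne_zero Q) (hu.lavg_ne_top Q), one_mul]
  exact h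

/-- Powers below a reverse Hölder exponent are weights. -/
theorem IsWeight.rpow_of_RH {u : (Fin n → ℝ) → ℝ} (hu : IsWeight u) {s q : ℝ} (hs : 0 < s)
    (hsq : s ≤ q) (hR : RHConst q u ≠ ∞) : IsWeight fun x => u x ^ s := by
  have h0 : ∀ᵐ x, 0 < u x ^ s := by
    filter_upwards [hu.2] with x hx
    exact Real.rpow_pos_of_pos hx s
  refine ⟨locallyIntegrable_of_cubes (hu.aemeasurable.pow_const s) h0 fun Q => ?_, h0⟩
  have hq : 0 < q := hs.trans_le hsq
  have h1 : lavg Q (fun x => ENNReal.ofReal (u x) ^ q) ≠ ∞ :=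
    ne_top_of_le_ne_top (ENNReal.rpow_ne_top_of_nonneg hq.le
      (ENNReal.mul_ne_top hR (hu.lavg_ne_top Q))) (lavg_rpow_le_RH hu hq Q)
  have h2 := MixedWeak.lavg_rpow_le ((one_le_div hs).2 hsq) Q
    (hu.aemeasurable_ofReal.pow_const s).restrict
  simp only [← ENNReal.rpow_mul, mul_div_cancel₀ q hs.ne'] at h2
  have h3 : lavg Q (fun x => ENNReal.ofReal (u x) ^ s) ≠ ∞ := by
    intro h
    rw [h, ENNReal.top_rpow_of_pos (div_pos hq hs)] at h2
    exact h1 (top_le_iff.1 h2)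
  rw [← lavg_mul_volume, lavg_congr_ae (ofReal_rpow_ae_eq hu.2 s)]
  exact ENNReal.mul_ne_top h3 Q.volume_ne_top

/-- The bound for the Fujii-Wilson constant of `u ^ s`. -/
theorem exists_AinftyConst_rpow_le (hn : 0 < n) {s : ℝ} (hs : 1 ≤ s) :
    ∃ C : ℝ≥0∞, C ≠ ∞ ∧ ∀ u : (Fin n → ℝ) → ℝ, MemAp (fun _ => 1) 1 u →
      RHConst (2 * s - 1) u < ∞ →
        AinftyConst (fun x => u x ^ s) ≤
          C * (RHConst (2 * s - 1) u * ApConst (fun _ => 1) 1 u) := by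
  -- For `s = 1` the exponent `2 * s - 1` is 1 and the interpolation below degenerates; there the
  -- pointwise `A_1` bound suffices.
  rcases hs.eq_or_lt with rfl | hs1
  · refine ⟨1, by simp, fun u hu hR => ?_⟩
    have hR1 := one_le_RHConst hu.1 (q := 2 * 1 - 1) (by norm_num)
    rw [one_mul]
    refine le_trans ?_ (le_mul_of_one_le_left' hR1)
    simp only [Real.rpow_one]
    refine AinftyConst_le fun Q => ?_
    rw [← lintegral_const_mul'' _ hu.1.aemeasurable_ofReal.restrict]
    refine lintegral_mono_ae (ae_restrict_of_ae ?_)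
    filter_upwards [ae_lavg_le_of_A1 hu] with x hx
    refine iSup₂_le fun P hP => le_trans (lavg_mono fun y => ?_) (hx P hP)
    exact indicator_le_self _ _ y
  · set q := 2 * s - 1 with hq
    have hsq : s < q := by linarith
    have hs0 : 0 < s := by linarith
    have hq0 : 0 < q := by linarith
    -- The exponent for which Hölder's inequality splits `u ^ (s * t) = u ^ (t * (s - 1)) * u ^ t`
    -- into powers of the averages of `u ^ s` and `u ^ q`; `t > 1` because `s < q`.
    set t := (1 - 1 / s + 1 / q)⁻¹ with ht
    have htinv : 0 < 1 - 1 / s + 1 / q := by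
      have : 1 / s < 1 := (div_lt_one hs0).2 hs1
      have : 0 < 1 / q := by positivity
      linarith
    have ht1 : 1 < t := by
      rw [ht, one_lt_inv₀ htinv]
      have := one_div_lt_one_div_of_lt hs0 hsq
      linarith
    have ht0 : 0 < t := by linarith
    have htq : t * (s - 1) / s + t / q = 1 := by
      have : t * (1 - 1 / s + 1 / q) = 1 := inv_mul_cancel₀ htinv.ne'
      have h2 : t * (s - 1) / s + t / q = t * (1 - 1 / s + 1 / q) := by
        field_simp
      rw [h2, this]
    have hpos1 : 0 < t * (s - 1) / s := by
      have : 0 < s - 1 := by linarith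
      positivity
    have hpos2 : 0 < t / q := by positivity
    have hconj : (t * (s - 1) / s)⁻¹.HolderConjugate (t / q)⁻¹ := by
      rw [Real.holderConjugate_iff]
      refine ⟨(one_lt_inv₀ hpos1).2 (by linarith), ?_⟩
      rw [inv_inv, inv_inv, htq]
    refine ⟨kolmogorovConst n t, kolmogorovConst_ne_top n ht1, fun u hu hR => ?_⟩
    -- For `s > 1` the reverse Hölder constant alone is enough; the `A_1` constant is at least 1 and
    -- is only inserted.
    refine le_trans ?_ (mul_le_mul_right (le_mul_of_one_le_right' (one_le_A1Const hu)) _)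
    have hus := hu.1.rpow_of_RH hs0 hsq.le hR.ne
    have hum := hu.1.aemeasurable_ofReal
    set R := RHConst q u
    refine AinftyConst_le fun Q => ?_
    have hLs : lavg Q (fun x => ENNReal.ofReal (u x ^ s)) =
        lavg Q (fun x => ENNReal.ofReal (u x) ^ s) := lavg_congr_ae (ofReal_rpow_ae_eq hu.1.2 s) Q
    have hL0 := hus.lavg_ne_zero Q
    have hLt := hus.lavg_ne_top Q
    have hR1 : 1 ≤ R := one_le_RHConst hu.1 (by linarith)
    -- A reverse Hölder inequality of exponent `t` for `u ^ s` with constant exactly `R`, so that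
    -- Kolmogorov's inequality gives a bound linear in `R`.
    have hmain : lavg Q (fun x => ENNReal.ofReal (u x ^ s) ^ t) ≤
        (R * lavg Q (fun x => ENNReal.ofReal (u x ^ s))) ^ t := by
      have e1 : lavg Q (fun x => ENNReal.ofReal (u x ^ s) ^ t) =
          lavg Q (fun x => ENNReal.ofReal (u x) ^ (t * (s - 1)) * ENNReal.ofReal (u x) ^ t) := by
        refine lavg_congr_ae ?_ Q
        filter_upwards [hu.1.2] with x hx
        rw [← ENNReal.ofReal_rpow_of_pos hx, ← ENNReal.rpow_mul, ← ENNReal.rpow_add_of_nonneg]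
        · congr 1; ring
        · exact mul_nonneg ht0.le (by linarith)
        · exact ht0.le
      rw [e1, hLs]
      have h1 := lavg_mul_le hconj Q (f := fun x => ENNReal.ofReal (u x) ^ (t * (s - 1)))
        (g := fun x => ENNReal.ofReal (u x) ^ t) (hum.pow_const _).restrict
        (hum.pow_const _).restrict
      simp only [← ENNReal.rpow_mul] at h1
      have e2 : t * (s - 1) * (t * (s - 1) / s)⁻¹ = s := by
        have : s - 1 ≠ 0 := by linarith
        field_simp
      have e3 : t * (t / q)⁻¹ = q := by field_simp
      rw [e2, e3, one_div, inv_inv, one_div, inv_inv] at h1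
      have h2 : lavg Q (fun x => ENNReal.ofReal (u x) ^ q) ^ (t / q) ≤
          (R * lavg Q fun x => ENNReal.ofReal (u x)) ^ t := by
        refine (ENNReal.rpow_le_rpow (lavg_rpow_le_RH hu.1 hq0 Q) hpos2.le).trans (le_of_eq ?_)
        rw [← ENNReal.rpow_mul, mul_div_cancel₀ t hq0.ne']
      have h3 : (lavg Q fun x => ENNReal.ofReal (u x)) ^ t ≤
          lavg Q (fun x => ENNReal.ofReal (u x) ^ s) ^ (t / s) := by
        have := ENNReal.rpow_le_rpow (lavg_rpow_le hs1.le Q hum.restrict) (div_pos ht0 hs0).le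
        rwa [← ENNReal.rpow_mul, mul_div_cancel₀ t hs0.ne'] at this
      refine h1.trans ((mul_le_mul_right h2 _).trans ?_)
      rw [ENNReal.mul_rpow_of_nonneg _ _ ht0.le, ENNReal.mul_rpow_of_nonneg _ _ ht0.le]
      calc _ ≤ lavg Q (fun x => ENNReal.ofReal (u x) ^ s) ^ (t * (s - 1) / s) *
            (R ^ t * lavg Q (fun x => ENNReal.ofReal (u x) ^ s) ^ (t / s)) := by gcongr
        _ = R ^ t * (lavg Q (fun x => ENNReal.ofReal (u x) ^ s) ^ (t * (s - 1) / s) *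
            lavg Q (fun x => ENNReal.ofReal (u x) ^ s) ^ (t / s)) := by ring
        _ = _ := by
            rw [← ENNReal.rpow_add_of_nonneg _ _ hpos1.le (div_pos ht0 hs0).le]
            congr 2
            field_simp
            ring
    refine (lintegral_maxL_indicator_le hn ht1 Q hus.aemeasurable_ofReal
      (mul_ne_zero (by positivity) hL0) (ENNReal.mul_ne_top hR.ne hLt) hmain).trans (le_of_eq ?_)
    rw [mul_assoc, lavg_mul_volume, mul_assoc]

/-! #### The class `A_p(u)` -/

/-- For `p > 1` put `σ = v ^ (-1/(p-1)) * u`. Hölder's inequality for `u = (u v) ^ (1/p) * σ ^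
(1/p')` on `E`, together with `σ(E) ≤ σ(Q)` and the `A_p(u)` condition on `Q`, gives the claim; for
`p = 1` the pointwise condition is integrated over `E`. The result turns a lower bound for the
relative u-mass of `E` into one for its relative uv-mass. -/
theorem lintegral_mul_rpow_le_of_Ap {u v : (Fin n → ℝ) → ℝ} {p : ℝ} (hp : 1 ≤ p)
    (hu : IsWeight u) (hv : MemAp u p v) (Q : Cube n) {E : Set (Fin n → ℝ)}
    (hE : MeasurableSet E) (hEQ : E ⊆ Q.set) :
    (∫⁻ x in Q.set, ENNReal.ofReal (u x * v x)) * (∫⁻ x in E, ENNReal.ofReal (u x)) ^ p ≤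
      ApConst u p v * (∫⁻ x in Q.set, ENNReal.ofReal (u x)) ^ p *
        ∫⁻ x in E, ENNReal.ofReal (u x * v x) := by
  have hum := hu.aemeasurable_ofReal
  have hvm := hv.1.aemeasurable_ofReal
  have hwm : AEMeasurable (fun x => ENNReal.ofReal (u x * v x)) volume :=
    (hu.aemeasurable.mul hv.1.aemeasurable).ennreal_ofReal
  have hu0 := hu.lintegral_ne_zero Q
  have hut := hu.lintegral_ne_top Q
  rcases hp.eq_or_lt with rfl | hp1
  · simp only [ENNReal.rpow_one]
    have h := ENNReal.ae_le_essSup (μ := volume) (fun x => maxFn u v x / ENNReal.ofReal (v x))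
    rw [← lintegral_const_mul'' _ hum.restrict, ← lintegral_const_mul'' _ hwm.restrict]
    refine setLIntegral_mono_ae' hE ?_
    filter_upwards [h, hv.1.2, hu.2] with x hx hx0 hux hxE
    have hx' : maxFn u v x / ENNReal.ofReal (v x) ≤ ApConst u 1 v := by
      simpa [ApConst] using hx
    rw [ENNReal.div_le_iff (by simpa using hx0) (by simp)] at hx'
    have h2 : wAvg u Q v ≤ ApConst u 1 v * ENNReal.ofReal (v x) :=
      (le_iSup₂_of_le (f := fun (Q : Cube n) (_ : x ∈ Q.set) => wAvg u Q v) Q (hEQ hxE)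
        le_rfl).trans hx'
    rw [wAvg, ENNReal.div_le_iff hu0 hut] at h2
    simp only [mul_comm (v _) (u _)] at h2
    calc _ ≤ ApConst u 1 v * ENNReal.ofReal (v x) * (∫⁻ x in Q.set, ENNReal.ofReal (u x)) *
          ENNReal.ofReal (u x) := mul_le_mul_left h2 _
      _ = _ := by rw [ENNReal.ofReal_mul hux.le]; ring
  · have hp0 : 0 < p := by linarith
    have hp10 : 0 < p - 1 := by linarith
    set UQ := ∫⁻ x in Q.set, ENNReal.ofReal (u x) with hUQ
    set WQ := ∫⁻ x in Q.set, ENNReal.ofReal (u x * v x) with hWQ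
    set σ : (Fin n → ℝ) → ℝ≥0∞ := fun x => ENNReal.ofReal (v x ^ (-(1 / (p - 1))) * u x) with hσ
    have hσm : AEMeasurable σ volume :=
      ((hv.1.aemeasurable.pow_const _).mul hu.aemeasurable).ennreal_ofReal
    have hK : WQ * (∫⁻ x in Q.set, σ x) ^ (p - 1) ≤ ApConst u p v * UQ ^ p := by
      have h : wAvg u Q v * wAvg u Q (fun x => v x ^ (-(1 / (p - 1)))) ^ (p - 1) ≤
          ApConst u p v := by
        rw [ApConst, if_neg hp1.ne']
        exact le_iSup (fun Q : Cube n => wAvg u Q v *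
          wAvg u Q (fun x => v x ^ (-(1 / (p - 1)))) ^ (p - 1)) Q
      simp only [wAvg, mul_comm (v _) (u _)] at h
      rw [ENNReal.div_rpow_of_nonneg _ _ hp10.le] at h
      have e : UQ ^ p = UQ * UQ ^ (p - 1) := by
        conv_lhs => rw [show p = 1 + (p - 1) by ring,
          ENNReal.rpow_add_of_nonneg _ _ zero_le_one hp10.le, ENNReal.rpow_one]
      have hU1 : UQ ^ (p - 1) ≠ 0 := (ENNReal.rpow_pos (pos_iff_ne_zero.2 hu0) hut).ne'
      have hU2 : UQ ^ (p - 1) ≠ ∞ := ENNReal.rpow_ne_top_of_nonneg hp10.le hut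
      refine le_trans (le_of_eq ?_) (mul_le_mul_left h (UQ ^ p))
      rw [e]
      calc WQ * (∫⁻ x in Q.set, σ x) ^ (p - 1)
          = WQ / UQ * UQ * ((∫⁻ x in Q.set, σ x) ^ (p - 1) / UQ ^ (p - 1) * UQ ^ (p - 1)) := by
            rw [ENNReal.div_mul_cancel hu0 hut, ENNReal.div_mul_cancel hU1 hU2]
        _ = _ := by
            simp only [hσ]
            ring
    have hol : (∫⁻ x in E, ENNReal.ofReal (u x)) ^ p ≤
        (∫⁻ x in E, ENNReal.ofReal (u x * v x)) * (∫⁻ x in E, σ x) ^ (p - 1) := by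
      have hc := Real.HolderConjugate.conjExponent hp1
      have hq : p.conjExponent = p / (p - 1) := rfl
      have h1 := ENNReal.lintegral_mul_le_Lp_mul_Lq (volume.restrict E) hc
        (f := fun x => ENNReal.ofReal (u x * v x) ^ (1 / p))
        (g := fun x => σ x ^ (1 / p.conjExponent)) (hwm.pow_const _).restrict
        (hσm.pow_const _).restrict
      simp only [← ENNReal.rpow_mul, one_div_mul_cancel hp0.ne',
        one_div_mul_cancel hc.symm.pos.ne', ENNReal.rpow_one] at h1
      have h2 : ∫⁻ x in E, ENNReal.ofReal (u x) = ∫⁻ x in E, ((fun x =>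
          ENNReal.ofReal (u x * v x) ^ (1 / p)) * fun x => σ x ^ (1 / p.conjExponent)) x := by
        refine lintegral_congr_ae (ae_restrict_of_ae ?_)
        filter_upwards [hu.2, hv.1.2] with x hx hvx
        have hq0 := hc.symm.pos
        rw [Pi.mul_apply, hσ, ENNReal.ofReal_rpow_of_pos (by positivity),
          ENNReal.ofReal_rpow_of_pos (by positivity), ← ENNReal.ofReal_mul (by positivity)]
        congr 1
        rw [Real.mul_rpow hx.le hvx.le, Real.mul_rpow (by positivity) hx.le, ← Real.rpow_mul hvx.le,
          hq]
        have e1 : -(1 / (p - 1)) * (1 / (p / (p - 1))) = -(1 / p) := by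
          field_simp
        have e2 : 1 / p + 1 / (p / (p - 1)) = 1 := by field_simp; ring
        rw [e1]
        calc u x = u x ^ (1 / p + 1 / (p / (p - 1))) := by rw [e2, Real.rpow_one]
          _ = u x ^ (1 / p) * u x ^ (1 / (p / (p - 1))) := Real.rpow_add hx _ _
          _ = u x ^ (1 / p) * u x ^ (1 / (p / (p - 1))) * v x ^ (1 / p + -(1 / p)) := by simp
          _ = _ := by rw [Real.rpow_add hvx]; ring
      rw [h2]
      refine (ENNReal.rpow_le_rpow h1 hp0.le).trans (le_of_eq ?_)
      rw [ENNReal.mul_rpow_of_nonneg _ _ hp0.le, ← ENNReal.rpow_mul, ← ENNReal.rpow_mul,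
        one_div_mul_cancel hp0.ne', ENNReal.rpow_one, hq]
      congr 2
      field_simp
    calc WQ * (∫⁻ x in E, ENNReal.ofReal (u x)) ^ p
        ≤ WQ * ((∫⁻ x in E, ENNReal.ofReal (u x * v x)) * (∫⁻ x in Q.set, σ x) ^ (p - 1)) := by
          refine mul_le_mul_right (hol.trans (mul_le_mul_right ?_ _)) _
          exact ENNReal.rpow_le_rpow (lintegral_mono_set hEQ) hp10.le
      _ = WQ * (∫⁻ x in Q.set, σ x) ^ (p - 1) * ∫⁻ x in E, ENNReal.ofReal (u x * v x) := by ring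
      _ ≤ _ := mul_le_mul_left hK _

/-- The product of a weight and an `A_p` weight with respect to it is a weight. -/
theorem IsWeight.mul_of_Ap {u v : (Fin n → ℝ) → ℝ} {p : ℝ} (hp : 1 ≤ p)
    (hu : IsWeight u) (hv : MemAp u p v) : IsWeight fun x => u x * v x := by
  have h0 : ∀ᵐ x, 0 < u x * v x := by
    filter_upwards [hu.2, hv.1.2] with x hx hx' using mul_pos hx hx'
  have hvm : AEMeasurable v volume := hv.1.aemeasurable
  refine ⟨locallyIntegrable_of_cubes (hu.aemeasurable.mul hvm) h0 fun Q htop => ?_, h0⟩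
  -- On `E N` the weight `v` is bounded, so `uv` has finite mass there. If `uv(Q)` were infinite,
  -- the `A_p(u)` comparison would give `u(E N) = 0` for all `N`, hence `u(Q) = 0`.
  let E : ℕ → Set (Fin n → ℝ) := fun N => Q.set ∩ {x | hvm.mk v x ≤ N}
  have hEm : ∀ N, MeasurableSet (E N) := fun N =>
    Q.measurableSet_set.inter (measurableSet_le hvm.measurable_mk measurable_const)
  have hEw : ∀ N, ∫⁻ x in E N, ENNReal.ofReal (u x * v x) ≠ ∞ := by
    intro N
    refine ne_top_of_le_ne_top (ENNReal.mul_ne_top (ENNReal.natCast_ne_top N)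
      (hu.lintegral_ne_top Q)) ?_
    calc ∫⁻ x in E N, ENNReal.ofReal (u x * v x)
        ≤ ∫⁻ x in E N, N * ENNReal.ofReal (u x) := by
          refine setLIntegral_mono_ae' (hEm N) ?_
          filter_upwards [hvm.ae_eq_mk, hu.2] with x hx hux hxE
          rw [ENNReal.ofReal_mul hux.le, mul_comm]
          refine mul_le_mul_left ?_ _
          rw [hx]
          exact (ENNReal.ofReal_le_ofReal hxE.2).trans (by simp)
      _ ≤ ∫⁻ x in Q.set, N * ENNReal.ofReal (u x) := lintegral_mono_set inter_subset_left
      _ = _ := lintegral_const_mul'' _ hu.aemeasurable_ofReal.restrict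
  have hE0 : ∀ N, ∫⁻ x in E N, ENNReal.ofReal (u x) = 0 := by
    intro N
    by_contra hne
    have h := lintegral_mul_rpow_le_of_Ap hp hu hv Q (hEm N) inter_subset_left
    have hEt : ∫⁻ x in E N, ENNReal.ofReal (u x) ≠ ∞ :=
      ne_top_of_le_ne_top (hu.lintegral_ne_top Q) (lintegral_mono_set inter_subset_left)
    rw [htop, ENNReal.top_mul (ENNReal.rpow_pos (pos_iff_ne_zero.2 hne) hEt).ne'] at h
    exact ENNReal.mul_ne_top (ENNReal.mul_ne_top hv.2.ne (ENNReal.rpow_ne_top_of_nonneg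
      (by linarith) (hu.lintegral_ne_top Q))) (hEw N) (top_le_iff.1 h)
  refine hu.lintegral_ne_zero Q ?_
  have hU : Q.set = ⋃ N, E N := by
    ext x
    simp only [E, mem_iUnion, mem_inter_iff, mem_ofPred_eq, exists_and_left]
    exact ⟨fun h => ⟨h, exists_nat_ge _⟩, fun h => h.1⟩
  rw [← nonpos_iff_eq_zero]
  calc ∫⁻ x in Q.set, ENNReal.ofReal (u x) = ∫⁻ x in ⋃ N, E N, ENNReal.ofReal (u x) := by rw [← hU]
    _ ≤ ∑' N, ∫⁻ x in E N, ENNReal.ofReal (u x) := lintegral_iUnion_le _ _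
    _ = 0 := by simp [hE0]

/-- A weight whose mass is comparable, in the `A_p` fashion, on large parts of cubes has a finite
Fujii-Wilson constant. -/
theorem AinftyConst_lt_top (hn : 0 < n) {w : (Fin n → ℝ) → ℝ} (hw : IsWeight w) {D : ℝ≥0∞}
    (hD : D ≠ ∞) (h : ∀ (Q : Cube n) (E : Set (Fin n → ℝ)), MeasurableSet E → E ⊆ Q.set →
      volume Q.set ≤ 2 * volume E →
        ∫⁻ x in Q.set, ENNReal.ofReal (w x) ≤ D * ∫⁻ x in E, ENNReal.ofReal (w x)) :
    AinftyConst w < ∞ := by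
  set W : (Fin n → ℝ) → ℝ≥0∞ := fun x => ENNReal.ofReal (w x) with hW
  -- The decay ratio of one generation: at least half of each stopping cube lies outside the next
  -- level set, and by `h` this part carries at least `D⁻¹` of the mass.
  set θ : ℝ≥0∞ := 1 - D⁻¹ with hθ
  have hD0 : D ≠ 0 := by
    rintro rfl
    let Q : Cube n := ⟨0, 1, one_pos⟩
    have := h Q Q.set Q.measurableSet_set Subset.rfl (le_mul_of_one_le_left' (by norm_num))
    rw [zero_mul, nonpos_iff_eq_zero] at this
    exact hw.lintegral_ne_zero Q this
  have hθ1 : θ < 1 := ENNReal.sub_lt_self (by simp) (by simp) (ENNReal.inv_ne_zero.2 hD)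
  have hdec : ∀ (Q : Cube n) (m : ℕ),
      volume.withDensity W (levelSet W Q ((2 ^ (n + 1)) ^ m * lavg Q W)) ≤
        θ ^ m * ∫⁻ x in Q.set, W x := by
    intro Q m
    induction m with
    | zero =>
      rw [pow_zero, pow_zero, one_mul, one_mul, ← withDensity_set]
      exact measure_mono fun x hx => hx.1
    | succ m ih =>
      set c := (2 ^ (n + 1)) ^ m * lavg Q W with hc
      have ha1 : (1 : ℝ≥0∞) ≤ (2 ^ (n + 1)) ^ m := one_le_pow₀ (one_le_pow₀ (by norm_num))
      have hLc : lavg Q W ≤ c := le_mul_of_one_le_left' ha1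
      have hc0 : c ≠ 0 := mul_ne_zero (by simp) (hw.lavg_ne_zero Q)
      have hct : c ≠ ∞ := ENNReal.mul_ne_top (ENNReal.pow_ne_top (ENNReal.pow_ne_top (by simp)))
        (hw.lavg_ne_top Q)
      set Ω := levelSet W Q c with hΩ
      have hcc : (2 ^ (n + 1)) ^ (m + 1) * lavg Q W = 2 ^ (n + 1) * c := by
        rw [hc, pow_succ']; ring
      rw [hcc]
      set Ω' := levelSet W Q (2 ^ (n + 1) * c) with hΩ'
      have hsub : Ω' ⊆ Ω := levelSet_anti (le_mul_of_one_le_left' (one_le_pow₀ (by norm_num)))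
      have h1 := (levelSet_inter_measure (w := W) (Q := Q) (c := c) (S := univ)
        fun _ _ => subset_univ _).2 (volume.withDensity W)
          (D • (volume.withDensity W).restrict Ω'ᶜ) (fun x hx => by
            rw [withDensity_set, Measure.smul_apply,
              Measure.restrict_apply (Cube.measurableSet_set _), smul_eq_mul, ← Set.sdiff_eq,
              withDensity_apply _ ((Cube.measurableSet_set _).diff measurableSet_levelSet)]
            exact h _ _ ((Cube.measurableSet_set _).diff measurableSet_levelSet) sdiff_subset
              (volume_stopCube_le hLc hc0 hct hx.1))
      rw [inter_univ, Measure.smul_apply, Measure.restrict_apply measurableSet_levelSet,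
        smul_eq_mul, ← Set.sdiff_eq] at h1
      set μ := volume.withDensity W with hμ
      have hΩt : μ Ω ≠ ∞ := by
        refine ne_top_of_le_ne_top (hw.lintegral_ne_top Q) ?_
        rw [← withDensity_set]
        exact measure_mono fun x hx => hx.1
      have h2 : D⁻¹ * μ Ω ≤ μ (Ω \ Ω') := by
        rw [mul_comm, ← ENNReal.div_eq_inv_mul.trans (mul_comm _ _)]
        exact ENNReal.div_le_of_le_mul (h1.trans_eq (mul_comm _ _))
      have h3 : μ (Ω \ Ω') = μ Ω - μ Ω' := measure_sdiff hsub
        measurableSet_levelSet.nullMeasurableSet (ne_top_of_le_ne_top hΩt (measure_mono hsub))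
      have h4 : μ Ω' ≤ θ * μ Ω := by
        rw [hθ, ENNReal.sub_mul (fun _ _ => hΩt), one_mul]
        refine ENNReal.le_sub_of_add_le_right
          (ENNReal.mul_ne_top (ENNReal.inv_ne_top.2 hD0) hΩt) ?_
        calc μ Ω' + D⁻¹ * μ Ω ≤ μ Ω' + (μ Ω - μ Ω') := by rw [← h3]; gcongr
          _ = μ Ω := add_tsub_cancel_of_le (measure_mono hsub)
      calc μ Ω' ≤ θ * μ Ω := h4
        _ ≤ θ * (θ ^ m * ∫⁻ x in Q.set, W x) := mul_le_mul_right ih _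
        _ = _ := by rw [pow_succ]; ring
  -- Any decay ratio below 1 is enough once `δ` is small, by continuity at `δ = 0`. The reverse
  -- Hölder inequality then feeds Kolmogorov's inequality with `t = 1 + δ`.
  obtain ⟨δ, hδ, hδθ⟩ : ∃ δ : ℝ, 0 < δ ∧ ((2 : ℝ≥0∞) ^ (n + 1)) ^ δ * θ < 1 := by
    have hlim : Tendsto (fun δ : ℝ => ((2 : ℝ) ^ (n + 1)) ^ δ * θ.toReal) (nhdsWithin 0 (Ioi 0))
        (nhds (((2 : ℝ) ^ (n + 1)) ^ (0 : ℝ) * θ.toReal)) := by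
      refine tendsto_nhdsWithin_of_tendsto_nhds ?_
      exact ((Real.continuous_const_rpow (by positivity)).tendsto 0).mul_const _
    have hθr : θ.toReal < 1 := by
      have := (ENNReal.toReal_lt_toReal hθ1.ne_top (by simp)).2 hθ1
      simpa using this
    rw [Real.rpow_zero, one_mul] at hlim
    obtain ⟨δ, h1, h2⟩ := ((hlim.eventually_lt_const hθr).and self_mem_nhdsWithin).exists
    refine ⟨δ, h2, ?_⟩
    have e : (2 : ℝ≥0∞) ^ (n + 1) = ENNReal.ofReal (2 ^ (n + 1)) := by
      rw [ENNReal.ofReal_pow (by norm_num)]; simp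
    rw [e, ENNReal.ofReal_rpow_of_pos (by positivity), ← ENNReal.ofReal_toReal hθ1.ne_top,
      ← ENNReal.ofReal_mul (by positivity)]
    exact ENNReal.ofReal_lt_one.2 h1
  set b : ℝ≥0∞ := 2 ^ (n + 1) with hb
  set C : ℝ≥0∞ := 1 + b ^ δ * (1 - b ^ δ * θ)⁻¹ with hC
  have hCt : C ≠ ∞ := by
    refine ENNReal.add_ne_top.2 ⟨by simp, ENNReal.mul_ne_top ?_ ?_⟩
    · exact ENNReal.rpow_ne_top_of_nonneg hδ.le (ENNReal.pow_ne_top (by simp))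
    · exact ENNReal.inv_ne_top.2 (tsub_pos_of_lt hδθ).ne'
  have hC0 : C ≠ 0 := by rw [hC]; simp
  have hδ1 : 0 < 1 + δ := by linarith
  set A : ℝ≥0∞ := C ^ (1 / (1 + δ)) with hA
  have hAt : A ≠ ∞ := ENNReal.rpow_ne_top_of_nonneg (by positivity) hCt
  have hA0 : A ≠ 0 := (ENNReal.rpow_pos (pos_iff_ne_zero.2 hC0) hCt).ne'
  refine lt_of_le_of_lt (AinftyConst_le (C := kolmogorovConst n (1 + δ) * A) fun Q => ?_)
    (lt_top_iff_ne_top.2 (ENNReal.mul_ne_top (kolmogorovConst_ne_top n (by linarith)) hAt))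
  have hrh := lavg_rpow_le_of_decay hw.aemeasurable_ofReal (hw.lavg_ne_zero Q)
    (hw.lavg_ne_top Q) (b := b) (θ := θ) (one_le_pow₀ (by norm_num)) hδ (hdec Q)
  have hrh' : lavg Q (fun x => W x ^ (1 + δ)) ≤ (A * lavg Q W) ^ (1 + δ) := by
    rw [ENNReal.mul_rpow_of_nonneg _ _ hδ1.le, hA, ← ENNReal.rpow_mul,
      one_div_mul_cancel hδ1.ne', ENNReal.rpow_one]
    exact hrh
  refine (lintegral_maxL_indicator_le hn (by linarith) Q hw.aemeasurable_ofReal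
    (mul_ne_zero hA0 (hw.lavg_ne_zero Q)) (ENNReal.mul_ne_top hAt (hw.lavg_ne_top Q))
    hrh').trans (le_of_eq ?_)
  rw [mul_assoc A, lavg_mul_volume, mul_assoc]

/-- The product of an `A_1` weight `u` and an `A_p(u)` weight has a finite Fujii-Wilson
constant. -/
theorem AinftyConst_mul_lt_top (hn : 0 < n) {u v : (Fin n → ℝ) → ℝ} {p : ℝ} (hp : 1 ≤ p)
    (hu : MemAp (fun _ => 1) 1 u) (hv : MemAp u p v) :
    AinftyConst (fun x => u x * v x) < ∞ := by
  have hp0 : 0 ≤ p := by linarith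
  have hw := hu.1.mul_of_Ap hp hv
  set a := ApConst (fun _ => 1) 1 u
  set K := ApConst u p v
  refine AinftyConst_lt_top hn hw (D := (2 * a) ^ p * K) (ENNReal.mul_ne_top
    (ENNReal.rpow_ne_top_of_nonneg hp0 (ENNReal.mul_ne_top (by simp) hu.2.ne)) hv.2.ne) ?_
  intro Q E hE hEQ hvol
  have hu0 := hu.1.lintegral_ne_zero Q
  have hut := hu.1.lintegral_ne_top Q
  set UQ := ∫⁻ x in Q.set, ENNReal.ofReal (u x)
  -- The `A_1` condition passes from volume to u-mass; the `A_p(u)` condition then passes from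
  -- u-mass to uv-mass.
  have h1 : UQ ≤ 2 * a * ∫⁻ x in E, ENNReal.ofReal (u x) := by
    rw [← ENNReal.mul_le_mul_iff_left Q.volume_ne_zero Q.volume_ne_top]
    calc UQ * volume Q.set ≤ UQ * (2 * volume E) := mul_le_mul_right hvol _
      _ = 2 * (UQ * volume E) := by ring
      _ ≤ 2 * (a * (∫⁻ x in E, ENNReal.ofReal (u x)) * volume Q.set) :=
          mul_le_mul_right (lintegral_mul_volume_le_of_A1 hu Q hE hEQ) _
      _ = _ := by ring
  have h2 := ENNReal.rpow_le_rpow h1 hp0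
  rw [ENNReal.mul_rpow_of_nonneg _ _ hp0] at h2
  have hU0 : UQ ^ p ≠ 0 := (ENNReal.rpow_pos (pos_iff_ne_zero.2 hu0) hut).ne'
  have hUt : UQ ^ p ≠ ∞ := ENNReal.rpow_ne_top_of_nonneg hp0 hut
  rw [← ENNReal.mul_le_mul_iff_left hU0 hUt]
  calc (∫⁻ x in Q.set, ENNReal.ofReal (u x * v x)) * UQ ^ p
      ≤ (∫⁻ x in Q.set, ENNReal.ofReal (u x * v x)) *
        ((2 * a) ^ p * (∫⁻ x in E, ENNReal.ofReal (u x)) ^ p) := mul_le_mul_right h2 _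
    _ = (2 * a) ^ p * ((∫⁻ x in Q.set, ENNReal.ofReal (u x * v x)) *
        (∫⁻ x in E, ENNReal.ofReal (u x)) ^ p) := by ring
    _ ≤ (2 * a) ^ p * (K * UQ ^ p * ∫⁻ x in E, ENNReal.ofReal (u x * v x)) :=
        mul_le_mul_right (lintegral_mul_rpow_le_of_Ap hp hu.1 hv Q hE hEQ) _
    _ = _ := by ring

end Weights

/-! ### Orlicz estimates -/

section Pointwise

variable {m : ℕ} {r y : Fin m → ℝ}

theorem recipSum_nonneg (hr : ∀ i, 1 ≤ r i) : 0 ≤ recipSum r :=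
  Finset.sum_nonneg fun i _ => one_div_nonneg.2 (by linarith [hr i])

theorem recipSum_le (hr : ∀ i, 1 ≤ r i) : recipSum r ≤ m := by
  calc recipSum r ≤ ∑ _i : Fin m, (1 : ℝ) :=
        Finset.sum_le_sum fun i _ => (div_le_one (by linarith [hr i])).2 (hr i)
    _ = m := by simp

/-- Enlarging the exponent from the sum over `σ` to the full sum is allowed because `z ≥ 1`; all
subsets of symbols are thus treated with the same power. -/
theorem prod_rpow_le_rpow_recipSum (hr : ∀ i, 1 ≤ r i) (σ : Finset (Fin m)) {z : ℝ}
    (hz : 1 ≤ z) : ∏ i ∈ σ, z ^ (1 / r i) ≤ z ^ recipSum r := by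
  rw [← Real.rpow_sum_of_pos (by linarith)]
  refine Real.rpow_le_rpow_of_exponent_le hz ?_
  exact Finset.sum_le_sum_of_subset_of_nonneg (Finset.subset_univ σ)
    fun i _ _ => one_div_nonneg.2 (by linarith [hr i])

theorem prod_le_rpow_recipSum (hr : ∀ i, 1 ≤ r i) (hy : ∀ i, 0 ≤ y i) (σ : Finset (Fin m)) {z : ℝ}
    (hz : 1 ≤ z) (h : ∀ i ∈ σ, y i ^ r i ≤ z) : ∏ i ∈ σ, y i ≤ z ^ recipSum r := by
  refine le_trans (Finset.prod_le_prod (fun i _ => hy i) fun i hi => ?_)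
    (prod_rpow_le_rpow_recipSum hr σ hz)
  have hri : 0 < r i := by linarith [hr i]
  calc y i = (y i ^ r i) ^ (1 / r i) := by
        rw [← Real.rpow_mul (hy i), mul_one_div_cancel hri.ne', Real.rpow_one]
    _ ≤ _ := Real.rpow_le_rpow (Real.rpow_nonneg (hy i) _) (h i hi) (by positivity)

/-- The constant in the generalized Young inequality. -/
noncomputable def orliczConst (m : ℕ) : ℝ := 2 ^ m + m.factorial * 2 ^ m

theorem orliczConst_pos (m : ℕ) : 0 < orliczConst m := by unfold orliczConst; positivity

theorem phi_nonneg {α x : ℝ} (hx : 0 ≤ x) : 0 ≤ phi α x :=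
  mul_nonneg hx (Real.rpow_nonneg (by linarith [Real.posLog_nonneg (x := x)]) _)

theorem le_phi {α x : ℝ} (hα : 0 ≤ α) (hx : 0 ≤ x) : x ≤ phi α x :=
  le_mul_of_one_le_right hx
    (Real.one_le_rpow (by linarith [Real.posLog_nonneg (x := x)]) hα)

/-- The generalized Young inequality between `L (log L) ^ α` and exponential functions. -/
theorem mul_prod_le (hr : ∀ i, 1 ≤ r i) (hy : ∀ i, 0 ≤ y i) (σ : Finset (Fin m)) {x : ℝ}
    (hx : 0 ≤ x) :
    x * ∏ i ∈ σ, y i ≤ orliczConst m * (phi (recipSum r) x + ∑ i, Real.exp (y i ^ r i)) := by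
  have hα := recipSum_nonneg hr
  have hαm := recipSum_le hr
  have hlog := Real.posLog_nonneg (x := x)
  have hL : 1 ≤ 1 + Real.posLog x := by linarith
  have hphi := phi_nonneg (α := recipSum r) hx
  have hexp : ∀ i, Real.exp (y i ^ r i) ≤ ∑ i, Real.exp (y i ^ r i) := fun i =>
    Finset.single_le_sum (f := fun i => Real.exp (y i ^ r i)) (fun i _ => (Real.exp_pos _).le)
      (Finset.mem_univ i)
  have hexp0 : 0 ≤ ∑ i, Real.exp (y i ^ r i) := Finset.sum_nonneg fun i _ => (Real.exp_pos _).le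
  have hf : (0 : ℝ) ≤ m.factorial * 2 ^ m := by positivity
  -- Either all factors are dominated by the logarithm of `x`, or the largest `z = y i ^ r i`
  -- exceeds twice that. Then `x ≤ exp (z / 2)`, and the factor 2 leaves another `exp (z / 2)` to
  -- absorb the power `z ^ m`.
  by_cases h : ∀ i ∈ σ, y i ^ r i ≤ 2 * (1 + Real.posLog x)
  · have h1 := prod_le_rpow_recipSum hr hy σ (by linarith) h
    rw [Real.mul_rpow (by norm_num) (by linarith)] at h1
    have h2 : (2 : ℝ) ^ recipSum r ≤ 2 ^ m := by
      rw [← Real.rpow_natCast]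
      exact Real.rpow_le_rpow_of_exponent_le (by norm_num) hαm
    calc x * ∏ i ∈ σ, y i ≤ x * (2 ^ m * (1 + Real.posLog x) ^ recipSum r) := by
          refine mul_le_mul_of_nonneg_left (h1.trans ?_) hx
          exact mul_le_mul_of_nonneg_right h2 (Real.rpow_nonneg (by linarith) _)
      _ = 2 ^ m * phi (recipSum r) x := by rw [phi]; ring
      _ ≤ _ := by
          unfold orliczConst
          have : (0 : ℝ) ≤ 2 ^ m := by positivity
          nlinarith
  · simp only [not_forall, not_le] at h
    obtain ⟨j, hj, hjz⟩ := h
    obtain ⟨i, hi, hmax⟩ := σ.exists_max_image (fun i => y i ^ r i) ⟨j, hj⟩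
    set z := y i ^ r i with hz
    have hzL : 2 * (1 + Real.posLog x) < z := hjz.trans_le (hmax j hj)
    have hz1 : 1 ≤ z := by linarith
    have h1 := prod_le_rpow_recipSum hr hy σ hz1 hmax
    have h2 : z ^ recipSum r ≤ z ^ m := by
      rw [← Real.rpow_natCast]
      exact Real.rpow_le_rpow_of_exponent_le hz1 hαm
    have h3 : z ^ m ≤ m.factorial * 2 ^ m * Real.exp (z / 2) := by
      have h4 := Real.pow_div_factorial_le_exp (z / 2) (by linarith) m
      rw [div_le_iff₀ (by positivity), div_pow, div_le_iff₀ (by positivity)] at h4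
      linarith
    have h5 : x ≤ Real.exp (z / 2) := by
      rcases hx.eq_or_lt with rfl | hx
      · exact (Real.exp_pos _).le
      · have : Real.log x ≤ Real.posLog x := le_max_right _ _
        rw [← Real.log_le_iff_le_exp hx]
        linarith
    calc x * ∏ i ∈ σ, y i
        ≤ Real.exp (z / 2) * (m.factorial * 2 ^ m * Real.exp (z / 2)) :=
          mul_le_mul h5 (h1.trans (h2.trans h3)) (Finset.prod_nonneg fun i _ => hy i)
            (Real.exp_pos _).le
      _ = m.factorial * 2 ^ m * Real.exp z := by
          rw [mul_left_comm, ← Real.exp_add, add_halves]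
      _ ≤ m.factorial * 2 ^ m * ∑ i, Real.exp (y i ^ r i) :=
          mul_le_mul_of_nonneg_left (hexp i) hf
      _ ≤ _ := by
          unfold orliczConst
          have : (0 : ℝ) ≤ 2 ^ m := by positivity
          nlinarith

theorem IsYoung.nonneg {A : ℝ → ℝ} (hA : IsYoung A) {x : ℝ} (hx : 0 ≤ x) : 0 ≤ A x := by
  rw [← hA.zero]
  exact hA.mono (mem_Ici.2 le_rfl) hx hx

theorem IsYoung.div_le {A : ℝ → ℝ} (hA : IsYoung A) {x M : ℝ} (hx : 0 ≤ x) (hM : 1 ≤ M) :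
    A (x / M) ≤ A x / M := by
  have hM0 : 0 < M := by linarith
  have h1 : 0 ≤ 1 - 1 / M := by
    rw [sub_nonneg, div_le_one hM0]; exact hM
  have h := hA.convex.2 (mem_Ici.2 hx) (mem_Ici.2 le_rfl) (one_div_pos.2 hM0).le h1 (by ring)
  simp only [smul_eq_mul, hA.zero, mul_zero, add_zero] at h
  rw [div_eq_inv_mul, div_eq_inv_mul, ← one_div]
  exact h

/-- The generalized Young inequality between `A`, `B` and exponential functions. -/
theorem IsYoung.mul_prod_le {A B : ℝ → ℝ} (hA : IsYoung A) (hB : IsYoung B) {c : ℝ}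
    (hc0 : 0 < c) (hc : ∀ t : ℝ, Real.exp 1 ≤ t →
      youngInv B t * Real.log t ^ recipSum r ≤ c * youngInv A t)
    (hr : ∀ i, 1 ≤ r i) (hy : ∀ i, 0 ≤ y i) (σ : Finset (Fin m)) {x : ℝ} (hx : 0 ≤ x) :
    A (x * (∏ i ∈ σ, y i) / (2 * c)) ≤ B x + ∑ i, Real.exp (y i ^ r i) + Real.exp 1 := by
  -- Large enough for `x ≤ B⁻¹(t)` and `y i ^ r i ≤ log t`; the summand `exp 1` puts `t` in the
  -- range of `hc` and makes `log t ≥ 1`.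
  set t := B x + ∑ i, Real.exp (y i ^ r i) + Real.exp 1 with ht
  have hBx := hB.nonneg hx
  have he := Real.exp_pos 1
  have hexp : ∀ i, Real.exp (y i ^ r i) ≤ ∑ i, Real.exp (y i ^ r i) := fun i =>
    Finset.single_le_sum (f := fun i => Real.exp (y i ^ r i)) (fun i _ => (Real.exp_pos _).le)
      (Finset.mem_univ i)
  have hexp0 : 0 ≤ ∑ i, Real.exp (y i ^ r i) := Finset.sum_nonneg fun i _ => (Real.exp_pos _).le
  have hte : Real.exp 1 ≤ t := by linarith
  have ht0 : 0 < t := by linarith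
  have hlog : 1 ≤ Real.log t := (Real.le_log_iff_exp_le ht0).2 hte
  have hxB : x ≤ youngInv B t := by
    refine le_csInf ?_ ?_
    · obtain ⟨z, hz, hz0⟩ := ((hB.tendsto.eventually_ge_atTop t).and (eventually_ge_atTop 0)).exists
      exact ⟨z, hz0, hz⟩
    · rintro z ⟨hz0, hz⟩
      by_contra hlt
      have := hB.mono (mem_Ici.2 hz0) (mem_Ici.2 hx) (not_le.1 hlt).le
      linarith
  have hprod : ∏ i ∈ σ, y i ≤ Real.log t ^ recipSum r := by
    refine prod_le_rpow_recipSum hr hy σ hlog fun i _ => ?_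
    rw [Real.le_log_iff_exp_le ht0]
    linarith [hexp i]
  have hP0 : 0 ≤ ∏ i ∈ σ, y i := Finset.prod_nonneg fun i _ => hy i
  have hxy : x * ∏ i ∈ σ, y i ≤ c * youngInv A t :=
    (mul_le_mul hxB hprod hP0 (hx.trans hxB)).trans (hc t hte)
  set z := x * (∏ i ∈ σ, y i) / (2 * c) with hz
  have hz0 : 0 ≤ z := by positivity
  -- If `A z > t`, then `A⁻¹(t) ≤ z`, while `2 * c * z ≤ c * A⁻¹(t)`. The factor 2 in the
  -- denominator forces `z = 0`, against `A 0 = 0`.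
  by_contra hlt
  have h1 : youngInv A t ≤ z := csInf_le ⟨0, fun _ h => h.1⟩ ⟨hz0, (not_le.1 hlt).le⟩
  have h2 : x * ∏ i ∈ σ, y i = 2 * c * z := by rw [hz]; field_simp
  have h3 : z = 0 := by nlinarith
  rw [h3, hA.zero] at hlt
  linarith

end Pointwise

/-! ### Exponential integrability and generalized Hölder inequalities on cubes. -/

section Averages

variable {n m : ℕ}

theorem luxNorm_le {A : ℝ → ℝ} {Q : Cube n} {h : (Fin n → ℝ) → ℝ} {l : ℝ} (hl : 0 < l)
    (hA : lavg Q (fun x => ENNReal.ofReal (A (|h x| / l))) ≤ 1) :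
    luxNorm A Q h ≤ ENNReal.ofReal l := by
  refine iInf₂_le_of_le l hl (iInf_le_of_le ?_ le_rfl)
  rwa [setLAverage_eq_lavg]

/-- Exponential integrability of the oscillation. -/
theorem lavg_exp_le {b : (Fin n → ℝ) → ℝ} {r β : ℝ} (hr : 1 ≤ r)
    (h : oscNorm r b < ENNReal.ofReal β) (Q : Cube n) :
    lavg Q (fun x => ENNReal.ofReal (Real.exp ((|b x - cubeAvg Q b| / β) ^ r))) ≤ 2 := by
  have h1 : luxNorm (fun t => Real.exp (t ^ r) - 1) Q (fun x => b x - cubeAvg Q b) <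
      ENNReal.ofReal β :=
    (le_iSup (fun Q : Cube n => luxNorm (fun t => Real.exp (t ^ r) - 1) Q
      (fun x => b x - cubeAvg Q b)) Q).trans_lt h
  simp only [luxNorm, iInf_lt_iff] at h1
  obtain ⟨l, hl, hint, hlβ⟩ := h1
  rw [setLAverage_eq_lavg, lavg_le_iff, one_mul] at hint
  have hlβ' : l < β := (ENNReal.ofReal_lt_ofReal_iff_of_nonneg hl.le).1 hlβ
  have hβ : 0 < β := hl.trans hlβ'
  rw [lavg_le_iff]
  calc ∫⁻ x in Q.set, ENNReal.ofReal (Real.exp ((|b x - cubeAvg Q b| / β) ^ r))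
      ≤ ∫⁻ x in Q.set,
          (ENNReal.ofReal (Real.exp ((|b x - cubeAvg Q b| / l) ^ r) - 1) + 1) := by
        refine lintegral_mono fun x => ?_
        rw [← ENNReal.ofReal_one, ← ENNReal.ofReal_add _ zero_le_one]
        · refine ENNReal.ofReal_le_ofReal ?_
          rw [sub_add_cancel]
          gcongr
        · rw [sub_nonneg]
          exact Real.one_le_exp (by positivity)
    _ = (∫⁻ x in Q.set, ENNReal.ofReal (Real.exp ((|b x - cubeAvg Q b| / l) ^ r) - 1)) +
          volume Q.set := by
        rw [lintegral_add_right _ measurable_const, setLIntegral_const, one_mul]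
    _ ≤ volume Q.set + volume Q.set := by gcongr
    _ = 2 * volume Q.set := by ring

/-- A function of zero oscillation is almost everywhere constant on cubes. -/
theorem ae_eq_cubeAvg_of_oscNorm_eq_zero {b : (Fin n → ℝ) → ℝ} {r : ℝ} (hr : 1 ≤ r)
    (hb : LocallyIntegrable b volume) (h : oscNorm r b = 0) (Q : Cube n) :
    ∀ᵐ x ∂volume.restrict Q.set, b x - cubeAvg Q b = 0 := by
  have hbm : AEMeasurable (fun x => ENNReal.ofReal |b x - cubeAvg Q b|) (volume.restrict Q.set) :=
    ((hb.aestronglyMeasurable.aemeasurable.sub_const _).abs).ennreal_ofReal.restrict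
  -- Every positive `β` is admissible in `lavg_exp_le`; with `y ≤ exp (y ^ r)` the mean oscillation
  -- is at most `2 * β`, here for `β = 1 / (N + 1)`.
  have hle : ∀ N : ℕ, ∫⁻ x in Q.set, ENNReal.ofReal |b x - cubeAvg Q b| ≤
      ENNReal.ofReal (1 / (N + 1)) * (2 * volume Q.set) := by
    intro N
    have hN : (0 : ℝ) < 1 / (N + 1) := by positivity
    have h1 := lavg_exp_le hr (β := 1 / (N + 1)) (by rw [h]; simpa using hN) Q
    rw [lavg_le_iff] at h1
    refine le_trans ?_ (mul_le_mul_right h1 _)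
    rw [← lintegral_const_mul' _ _ ENNReal.ofReal_ne_top]
    refine lintegral_mono fun x => ?_
    rw [← ENNReal.ofReal_mul hN.le]
    refine ENNReal.ofReal_le_ofReal ?_
    set y := |b x - cubeAvg Q b| / (1 / (N + 1)) with hy
    have hy0 : 0 ≤ y := by positivity
    have h2 : |b x - cubeAvg Q b| = 1 / (N + 1) * y := by
      rw [hy, mul_div_cancel₀ _ hN.ne']
    rw [h2]
    refine mul_le_mul_of_nonneg_left ?_ hN.le
    have h3 : y ^ r + 1 ≤ Real.exp (y ^ r) := Real.add_one_le_exp _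
    rcases le_total y 1 with h4 | h4
    · linarith [Real.rpow_nonneg hy0 r]
    · linarith [Real.self_le_rpow_of_one_le h4 hr]
  have h0 : ∫⁻ x in Q.set, ENNReal.ofReal |b x - cubeAvg Q b| = 0 := by
    have hlim : Tendsto (fun N : ℕ => ENNReal.ofReal (1 / ((N : ℝ) + 1)) * (2 * volume Q.set)) atTop
        (nhds (ENNReal.ofReal 0 * (2 * volume Q.set))) :=
      ENNReal.Tendsto.mul_const (ENNReal.tendsto_ofReal tendsto_one_div_add_atTop_nhds_zero_nat)
        (Or.inr (ENNReal.mul_ne_top (by simp) Q.volume_ne_top))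
    rw [ENNReal.ofReal_zero, zero_mul] at hlim
    exact nonpos_iff_eq_zero.1 (ge_of_tendsto' hlim hle)
  rw [lintegral_eq_zero_iff' hbm] at h0
  filter_upwards [h0] with x hx
  simpa using hx

/-- Exponential integrability of the oscillation with respect to an `A_∞` weight. -/
theorem lintegral_exp_mul_le {b : (Fin n → ℝ) → ℝ} {r β : ℝ} (hr : 1 ≤ r) (hβ : 0 < β)
    (hb : MemOsc r b) (h : oscNorm r b < ENNReal.ofReal β) {w : (Fin n → ℝ) → ℝ}
    (hw : IsWeight w) (hA : AinftyConst w ≠ ∞) (Q : Cube n) :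
    ∫⁻ x in Q.set, ENNReal.ofReal (Real.exp ((|b x - cubeAvg Q b| /
        (β * (1 + rhDim n * (AinftyConst w).toReal) ^ (1 / r))) ^ r)) * ENNReal.ofReal (w x) ≤
      14 * ∫⁻ x in Q.set, ENNReal.ofReal (w x) := by
  set W := (AinftyConst w).toReal with hW
  have hW1 : 1 ≤ W := hw.one_le_AinftyConst_toReal hA
  have hτW : 0 < rhDim n * W := mul_pos (rhDim_pos n) (by linarith)
  set δ := 1 / (rhDim n * W) with hδ
  have hδ0 : 0 < δ := by positivity
  set θ := 1 + rhDim n * W with hθ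
  have hθ0 : 0 < θ := by linarith
  have hr0 : 0 < r := by linarith
  -- `1 + δ` is the sharp reverse Hölder exponent of `w`. Scaling the oscillation by `θ ^ (1 / r)`
  -- turns the power `θ` of the exponential into the unweighted one, so the constant is `14 = 2 *
  -- 7`.
  have hconj : θ.HolderConjugate (1 + δ) := by
    rw [Real.holderConjugate_iff]
    refine ⟨by linarith, ?_⟩
    rw [hθ, hδ]
    generalize rhDim n * W = T at hτW
    have h1 : 1 + T ≠ 0 := by linarith
    have h2 : 1 + 1 / T = (1 + T) / T := by field_simp; ring
    rw [h2]
    field_simp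
  have hbm : AEMeasurable b volume := hb.1.aestronglyMeasurable.aemeasurable
  set e : (Fin n → ℝ) → ℝ≥0∞ := fun x =>
    ENNReal.ofReal (Real.exp ((|b x - cubeAvg Q b| / (β * θ ^ (1 / r))) ^ r)) with he
  have hem : AEMeasurable e volume :=
    (Real.measurable_exp.comp_aemeasurable
      ((((hbm.sub_const _).abs).div_const _).pow_const _)).ennreal_ofReal
  have heθ : ∀ x, e x ^ θ = ENNReal.ofReal (Real.exp ((|b x - cubeAvg Q b| / β) ^ r)) := by
    intro x
    rw [he]
    simp only
    rw [ENNReal.ofReal_rpow_of_pos (Real.exp_pos _), ← Real.exp_mul, ← div_div,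
      Real.div_rpow (by positivity) (by positivity), ← Real.rpow_mul hθ0.le,
      one_div_mul_cancel hr0.ne', Real.rpow_one, div_mul_cancel₀ _ hθ0.ne']
  have h1 := lavg_mul_le hconj Q hem.restrict hw.aemeasurable_ofReal.restrict
  simp only [heθ] at h1
  have h2 : lavg Q (fun x => ENNReal.ofReal (Real.exp ((|b x - cubeAvg Q b| / β) ^ r))) ^ (1 / θ) ≤
      2 := by
    calc _ ≤ (2 : ℝ≥0∞) ^ (1 / θ) := ENNReal.rpow_le_rpow (lavg_exp_le hr h Q) (by positivity)
      _ ≤ 2 ^ (1 : ℝ) := ENNReal.rpow_le_rpow_of_exponent_le (by norm_num)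
          ((div_le_one hθ0).2 (by linarith))
      _ = 2 := ENNReal.rpow_one _
  have h3 : lavg Q (fun x => ENNReal.ofReal (w x) ^ (1 + δ)) ^ (1 / (1 + δ)) ≤
      7 * lavg Q (fun x => ENNReal.ofReal (w x)) := by
    have h4 := ENNReal.rpow_le_rpow (hw.lavg_rpow_le hA hδ0 le_rfl Q)
      (show 0 ≤ 1 / (1 + δ) by positivity)
    rw [ENNReal.mul_rpow_of_nonneg _ _ (by positivity), ← ENNReal.rpow_mul,
      mul_one_div_cancel (by linarith), ENNReal.rpow_one] at h4
    refine h4.trans (mul_le_mul_left ?_ _)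
    calc (7 : ℝ≥0∞) ^ (1 / (1 + δ)) ≤ 7 ^ (1 : ℝ) :=
          ENNReal.rpow_le_rpow_of_exponent_le (by norm_num)
            ((div_le_one (by linarith)).2 (by linarith))
      _ = 7 := ENNReal.rpow_one _
  have h5 : lavg Q (fun x => e x * ENNReal.ofReal (w x)) ≤
      14 * lavg Q (fun x => ENNReal.ofReal (w x)) := by
    refine (h1.trans (mul_le_mul' h2 h3)).trans (le_of_eq ?_)
    rw [← mul_assoc]; norm_num
  rw [lavg_le_iff, mul_assoc, lavg_mul_volume] at h5
  exact h5

theorem oscProd_nonneg (b : Fin m → (Fin n → ℝ) → ℝ) (Q : Cube n) (σ : Finset (Fin m))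
    (x : Fin n → ℝ) : 0 ≤ oscProd b Q σ x :=
  Finset.prod_nonneg fun _ _ => abs_nonneg _

/-- Generalized Hölder inequality for the weighted averages of `f |b - b_Q|_σ`. -/
theorem lintegral_mul_oscProd_le {r β : Fin m → ℝ} {b : Fin m → (Fin n → ℝ) → ℝ}
    (hr : ∀ i, 1 ≤ r i) (hβ : ∀ i, 0 < β i) (hb : ∀ i, MemOsc (r i) (b i))
    (hbβ : ∀ i, oscNorm (r i) (b i) < ENNReal.ofReal (β i)) {w : (Fin n → ℝ) → ℝ}
    (hw : IsWeight w) (hA : AinftyConst w ≠ ∞) (Q : Cube n) (σ : Finset (Fin m))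
    {f : (Fin n → ℝ) → ℝ} {M : ℝ} (hM : 0 < M)
    (hf : ∫⁻ x in Q.set, ENNReal.ofReal (phi (recipSum r) (M * |f x|)) * ENNReal.ofReal (w x) ≤
      ∫⁻ x in Q.set, ENNReal.ofReal (w x)) :
    ∫⁻ x in Q.set, ENNReal.ofReal (|f x| * oscProd b Q σ x) * ENNReal.ofReal (w x) ≤
      ENNReal.ofReal (orliczConst m * (1 + 14 * m) * (∏ i ∈ σ, β i) *
        (1 + rhDim n * (AinftyConst w).toReal) ^ recipSum r / M) *
        ∫⁻ x in Q.set, ENNReal.ofReal (w x) := by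
  set θ := 1 + rhDim n * (AinftyConst w).toReal with hθ
  have hθ1 : 1 ≤ θ := by
    have := mul_nonneg (rhDim_pos n).le (ENNReal.toReal_nonneg (a := AinftyConst w))
    linarith
  have hθ0 : 0 < θ := by linarith
  -- The scale at which the `i`-th oscillation is exponentially integrable with respect to `w`; the
  -- product of the scales produces the loss `θ ^ recipSum r`.
  set c : Fin m → ℝ := fun i => β i * θ ^ (1 / r i) with hc
  have hc0 : ∀ i, 0 < c i := fun i => mul_pos (hβ i) (Real.rpow_pos_of_pos hθ0 _)
  have hcprod : ∏ i ∈ σ, c i ≤ (∏ i ∈ σ, β i) * θ ^ recipSum r := by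
    rw [hc, Finset.prod_mul_distrib]
    exact mul_le_mul_of_nonneg_left (prod_rpow_le_rpow_recipSum hr σ hθ1)
      (Finset.prod_nonneg fun i _ => (hβ i).le)
  have hcp0 : 0 < ∏ i ∈ σ, c i := Finset.prod_pos fun i _ => hc0 i
  set WQ := ∫⁻ x in Q.set, ENNReal.ofReal (w x) with hWQ
  have hbm : ∀ i, AEMeasurable (b i) volume := fun i => (hb i).1.aestronglyMeasurable.aemeasurable
  set e : Fin m → (Fin n → ℝ) → ℝ≥0∞ := fun i x =>
    ENNReal.ofReal (Real.exp ((|b i x - cubeAvg Q (b i)| / c i) ^ r i)) * ENNReal.ofReal (w x)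
    with he
  have hem : ∀ i, AEMeasurable (e i) (volume.restrict Q.set) := fun i =>
    ((Real.measurable_exp.comp_aemeasurable
      (((((hbm i).sub_const _).abs).div_const _).pow_const _)).ennreal_ofReal.mul
        hw.aemeasurable_ofReal).restrict
  have hpt : ∀ x, ENNReal.ofReal (|f x| * oscProd b Q σ x) * ENNReal.ofReal (w x) ≤
      ENNReal.ofReal ((∏ i ∈ σ, c i) / M * orliczConst m) *
        (ENNReal.ofReal (phi (recipSum r) (M * |f x|)) * ENNReal.ofReal (w x) + ∑ i, e i x) := by
    intro x
    have hx0 : 0 ≤ M * |f x| := by positivity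
    have h1 := mul_prod_le hr (y := fun i => |b i x - cubeAvg Q (b i)| / c i)
      (fun i => div_nonneg (abs_nonneg _) (hc0 i).le) σ hx0
    rw [Finset.prod_div_distrib] at h1
    have h2 : |f x| * oscProd b Q σ x ≤ (∏ i ∈ σ, c i) / M * orliczConst m *
        (phi (recipSum r) (M * |f x|) +
          ∑ i, Real.exp ((|b i x - cubeAvg Q (b i)| / c i) ^ r i)) := by
      calc |f x| * oscProd b Q σ x = (∏ i ∈ σ, c i) / M *
            (M * |f x| * ((∏ i ∈ σ, |b i x - cubeAvg Q (b i)|) / ∏ i ∈ σ, c i)) := by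
            rw [oscProd]; field_simp
        _ ≤ (∏ i ∈ σ, c i) / M * _ := mul_le_mul_of_nonneg_left h1 (by positivity)
        _ = _ := by ring
    calc _ ≤ ENNReal.ofReal ((∏ i ∈ σ, c i) / M * orliczConst m * (phi (recipSum r) (M * |f x|) +
          ∑ i, Real.exp ((|b i x - cubeAvg Q (b i)| / c i) ^ r i))) * ENNReal.ofReal (w x) :=
          mul_le_mul_left (ENNReal.ofReal_le_ofReal h2) _
      _ = _ := by
          rw [ENNReal.ofReal_mul (mul_nonneg (by positivity) (orliczConst_pos m).le),
            ENNReal.ofReal_add (phi_nonneg hx0)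
              (Finset.sum_nonneg fun i _ => (Real.exp_pos _).le),
            ENNReal.ofReal_sum_of_nonneg fun i _ => (Real.exp_pos _).le, mul_assoc, add_mul,
            Finset.sum_mul]
  calc ∫⁻ x in Q.set, ENNReal.ofReal (|f x| * oscProd b Q σ x) * ENNReal.ofReal (w x)
      ≤ ∫⁻ x in Q.set, ENNReal.ofReal ((∏ i ∈ σ, c i) / M * orliczConst m) *
        (ENNReal.ofReal (phi (recipSum r) (M * |f x|)) * ENNReal.ofReal (w x) + ∑ i, e i x) :=
        lintegral_mono hpt
    _ = ENNReal.ofReal ((∏ i ∈ σ, c i) / M * orliczConst m) *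
        ((∫⁻ x in Q.set, ENNReal.ofReal (phi (recipSum r) (M * |f x|)) * ENNReal.ofReal (w x)) +
          ∑ i, ∫⁻ x in Q.set, e i x) := by
        rw [lintegral_const_mul' _ _ ENNReal.ofReal_ne_top, lintegral_add_right',
          lintegral_finsetSum' _ fun i _ => hem i]
        exact Finset.aemeasurable_fun_sum _ fun i _ => hem i
    _ ≤ ENNReal.ofReal ((∏ i ∈ σ, c i) / M * orliczConst m) * (WQ + ∑ _i : Fin m, 14 * WQ) := by
        gcongr with i
        exact lintegral_exp_mul_le (hr i) (hβ i) (hb i) (hbβ i) hw hA Q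
    _ = ENNReal.ofReal ((∏ i ∈ σ, c i) / M * orliczConst m * (1 + 14 * m)) * WQ := by
        rw [ENNReal.ofReal_mul (mul_nonneg (by positivity) (orliczConst_pos m).le),
          ENNReal.ofReal_add (by norm_num) (by positivity),
          ENNReal.ofReal_mul (p := 14) (by norm_num)]
        simp only [Finset.sum_const, Finset.card_univ, Fintype.card_fin, nsmul_eq_mul,
          ENNReal.ofReal_one, ENNReal.ofReal_natCast, ENNReal.ofReal_ofNat]
        ring
    _ ≤ _ := by
        refine mul_le_mul_left (ENNReal.ofReal_le_ofReal ?_) _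
        have hO := orliczConst_pos m
        calc (∏ i ∈ σ, c i) / M * orliczConst m * (1 + 14 * m)
            ≤ ((∏ i ∈ σ, β i) * θ ^ recipSum r) / M * orliczConst m * (1 + 14 * m) := by gcongr
          _ = _ := by ring

/-- Generalized Hölder inequality for the Luxemburg averages of `g |b - b_Q|_σ`. -/
theorem luxNorm_mul_oscProd_le {r β : Fin m → ℝ} {b : Fin m → (Fin n → ℝ) → ℝ}
    (hr : ∀ i, 1 ≤ r i) (hβ : ∀ i, 0 < β i) (hb : ∀ i, MemOsc (r i) (b i))
    (hbβ : ∀ i, oscNorm (r i) (b i) < ENNReal.ofReal (β i)) {A B : ℝ → ℝ} (hA : IsYoung A)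
    (hB : IsYoung B) {c : ℝ} (hc0 : 0 < c) (hc : ∀ t : ℝ, Real.exp 1 ≤ t →
      youngInv B t * Real.log t ^ recipSum r ≤ c * youngInv A t) (Q : Cube n)
    (σ : Finset (Fin m)) {g : (Fin n → ℝ) → ℝ} {l K : ℝ} (hl : 0 < l) (hK : 0 ≤ K)
    (hg : lavg Q (fun x => ENNReal.ofReal (B (|g x| / l))) ≤ ENNReal.ofReal K) :
    luxNorm A Q (fun x => g x * oscProd b Q σ x) ≤
      ENNReal.ofReal (2 * c * (K + 2 * m + 3) * l * ∏ i ∈ σ, β i) := by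
  -- Total mean after Young's inequality: `K` from `B`, 2 from each of the `m` exponentials, and `3
  -- ≥ exp 1`. By convexity, dividing the argument of `A` by `N` makes the mean at most 1.
  set N := K + 2 * m + 3 with hN
  have hm : (0 : ℝ) ≤ m := Nat.cast_nonneg m
  have hN1 : 1 ≤ N := by linarith
  have hN0 : 0 < N := by linarith
  have hβp : 0 < ∏ i ∈ σ, β i := Finset.prod_pos fun i _ => hβ i
  have hbm : ∀ i, AEMeasurable (b i) volume := fun i => (hb i).1.aestronglyMeasurable.aemeasurable
  refine luxNorm_le (by positivity) ?_
  set e : Fin m → (Fin n → ℝ) → ℝ≥0∞ := fun i x =>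
    ENNReal.ofReal (Real.exp ((|b i x - cubeAvg Q (b i)| / β i) ^ r i)) with he
  have hem : ∀ i, AEMeasurable (e i) (volume.restrict Q.set) := fun i =>
    (Real.measurable_exp.comp_aemeasurable
      (((((hbm i).sub_const _).abs).div_const _).pow_const _)).ennreal_ofReal.restrict
  have hpt : ∀ x, ENNReal.ofReal (A (|g x * oscProd b Q σ x| /
      (2 * c * N * l * ∏ i ∈ σ, β i))) ≤ ENNReal.ofReal N⁻¹ *
        (ENNReal.ofReal (B (|g x| / l)) + ((∑ i, e i x) + 3)) := by
    intro x
    have hx0 : 0 ≤ |g x| / l := by positivity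
    have hy0 : ∀ i, 0 ≤ |b i x - cubeAvg Q (b i)| / β i := fun i =>
      div_nonneg (abs_nonneg _) (hβ i).le
    have h1 := hA.mul_prod_le hB hc0 hc hr hy0 σ hx0
    have h2 := hA.div_le (x := |g x| / l * (∏ i ∈ σ, |b i x - cubeAvg Q (b i)| / β i) / (2 * c))
      (div_nonneg (mul_nonneg hx0 (Finset.prod_nonneg fun i _ => hy0 i)) (by positivity)) hN1
    have h3 : |g x * oscProd b Q σ x| / (2 * c * N * l * ∏ i ∈ σ, β i) =
        |g x| / l * (∏ i ∈ σ, |b i x - cubeAvg Q (b i)| / β i) / (2 * c) / N := by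
      rw [abs_mul, abs_of_nonneg (oscProd_nonneg b Q σ x), Finset.prod_div_distrib, oscProd]
      field_simp
    rw [h3]
    have he3 : Real.exp 1 ≤ 3 := by linarith [Real.exp_one_lt_d9]
    have hBx := hB.nonneg hx0
    have hs0 : 0 ≤ ∑ i, Real.exp ((|b i x - cubeAvg Q (b i)| / β i) ^ r i) :=
      Finset.sum_nonneg fun i _ => (Real.exp_pos _).le
    have h4 : ENNReal.ofReal (B (|g x| / l)) + ((∑ i, e i x) + 3) =
        ENNReal.ofReal (B (|g x| / l) +
          (∑ i, Real.exp ((|b i x - cubeAvg Q (b i)| / β i) ^ r i) + 3)) := by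
      rw [ENNReal.ofReal_add hBx (by positivity), ENNReal.ofReal_add hs0 (by norm_num),
        ENNReal.ofReal_sum_of_nonneg fun i _ => (Real.exp_pos _).le]
      simp [he]
    rw [h4, ← ENNReal.ofReal_mul (by positivity)]
    refine ENNReal.ofReal_le_ofReal (h2.trans ?_)
    rw [div_eq_inv_mul]
    refine mul_le_mul_of_nonneg_left ?_ (by positivity)
    linarith
  rw [lavg_le_iff] at hg ⊢
  calc ∫⁻ x in Q.set, ENNReal.ofReal (A (|g x * oscProd b Q σ x| / (2 * c * N * l * ∏ i ∈ σ, β i)))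
      ≤ ∫⁻ x in Q.set, ENNReal.ofReal N⁻¹ *
        (ENNReal.ofReal (B (|g x| / l)) + ((∑ i, e i x) + 3)) := lintegral_mono hpt
    _ = ENNReal.ofReal N⁻¹ * ((∫⁻ x in Q.set, ENNReal.ofReal (B (|g x| / l))) +
          ((∑ i, ∫⁻ x in Q.set, e i x) + 3 * volume Q.set)) := by
        have hsm : AEMeasurable (fun x => ∑ i, e i x) (volume.restrict Q.set) :=
          Finset.aemeasurable_fun_sum _ fun i _ => hem i
        rw [lintegral_const_mul' _ _ ENNReal.ofReal_ne_top,
          lintegral_add_right' _ (hsm.add_const _), lintegral_add_right _ measurable_const,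
          lintegral_finsetSum' _ fun i _ => hem i, setLIntegral_const]
    _ ≤ ENNReal.ofReal N⁻¹ * (ENNReal.ofReal K * volume Q.set +
          ((∑ _i : Fin m, 2 * volume Q.set) + 3 * volume Q.set)) := by
        gcongr with i
        exact lavg_le_iff.1 (lavg_exp_le (hr i) (hbβ i) Q)
    _ = ENNReal.ofReal (N⁻¹ * N) * volume Q.set := by
        rw [ENNReal.ofReal_mul (by positivity), hN, ENNReal.ofReal_add (by positivity) (by norm_num),
          ENNReal.ofReal_add hK (by positivity), ENNReal.ofReal_mul (by norm_num)]
        simp only [Finset.sum_const, Finset.card_univ, Fintype.card_fin, nsmul_eq_mul,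
          ENNReal.ofReal_natCast, ENNReal.ofReal_ofNat]
        ring
    _ = 1 * volume Q.set := by rw [inv_mul_cancel₀ hN0.ne', ENNReal.ofReal_one]

end Averages

/-! ### The estimate on a single cube -/

section SingleCube

variable {n m : ℕ}

/-- Two applications of Cauchy-Schwarz. Since `s = 1/2 + q/2`, the mean of `u ^ s` over `E` keeps `d
^ (1/2)`, the rest being the reverse Hölder inequality of exponent `q = 2 * s - 1`. Since `s (1 + ε)
= s/2 + s (1 + 2ε)/2`, the mean of `u ^ (s (1 + ε))` keeps `d ^ (1/4)`, the rest being the sharp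
reverse Hölder inequality of `u ^ s`. -/
theorem lavg_indicator_rpow_le {u : (Fin n → ℝ) → ℝ} (hu : IsWeight u) {s : ℝ} (hs : 1 ≤ s)
    (hR : RHConst (2 * s - 1) u ≠ ∞) {ε : ℝ} (hε0 : 0 < ε) (hε1 : ε ≤ 1)
    (hA : AinftyConst (fun x => u x ^ s) ≠ ∞)
    (hε : 2 * ε ≤ 1 / (rhDim n * (AinftyConst fun x => u x ^ s).toReal)) (Q : Cube n)
    {E : Set (Fin n → ℝ)} (hE : MeasurableSet E) {d : ℝ≥0∞} (hd : d ≤ 1)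
    (hEd : lavg Q (E.indicator fun x => ENNReal.ofReal (u x)) ≤
      d * lavg Q fun x => ENNReal.ofReal (u x)) :
    lavg Q (E.indicator fun x => ENNReal.ofReal (u x) ^ (s * (1 + ε))) ≤
      (7 * d ^ (1 / (8 * s)) * RHConst (2 * s - 1) u ^ (1 + (2 * s - 1) / (4 * s)) *
        lavg Q fun x => ENNReal.ofReal (u x)) ^ (s * (1 + ε)) := by
  have hs0 : 0 < s := by linarith
  set q := 2 * s - 1 with hq
  have hq0 : 0 < q := by linarith
  have hsq : s ≤ q := by linarith
  set R := RHConst q u with hRdef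
  have hR1 : 1 ≤ R := one_le_RHConst hu (by linarith)
  set L := lavg Q fun x => ENNReal.ofReal (u x) with hL
  have hum := hu.aemeasurable_ofReal
  have hus := hu.rpow_of_RH hs0 hsq hR
  have hconj : (2 : ℝ).HolderConjugate 2 := Real.HolderConjugate.two_two
  have hindm : ∀ t : ℝ, AEMeasurable (E.indicator fun x => ENNReal.ofReal (u x) ^ t)
      (volume.restrict Q.set) := fun t => ((hum.pow_const t).indicator hE).restrict
  have hholder : ∀ t t' : ℝ, 0 ≤ t → 0 ≤ t' →
      lavg Q (E.indicator fun x => ENNReal.ofReal (u x) ^ (t / 2 + t' / 2)) ≤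
        lavg Q (E.indicator fun x => ENNReal.ofReal (u x) ^ t) ^ (1 / 2 : ℝ) *
          lavg Q (fun x => ENNReal.ofReal (u x) ^ t') ^ (1 / 2 : ℝ) := by
    intro t t' ht ht'
    have h := lavg_mul_le hconj Q (hindm (t / 2)) (hum.pow_const (t' / 2)).restrict
    refine le_trans (le_of_eq ?_) (h.trans (le_of_eq ?_))
    · congr 1; ext x
      by_cases hx : x ∈ E
      · simp only [indicator_of_mem hx]
        rw [ENNReal.rpow_add_of_nonneg _ _ (by positivity) (by positivity)]
      · simp only [indicator_of_notMem hx, zero_mul]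
    · congr 2
      · congr 1; ext x
        by_cases hx : x ∈ E
        · simp only [indicator_of_mem hx]
          rw [← ENNReal.rpow_mul]; congr 1; ring
        · simp [indicator_of_notMem hx]
      · simp only [← ENNReal.rpow_mul]
        congr 1; ext x; congr 1; ring
  have hRHq : lavg Q (fun x => ENNReal.ofReal (u x) ^ q) ≤ (R * L) ^ q := lavg_rpow_le_RH hu hq0 Q
  have h1 : lavg Q (E.indicator fun x => ENNReal.ofReal (u x) ^ s) ≤
      d ^ (1 / 2 : ℝ) * R ^ (q / 2) * L ^ s := by
    have h := hholder 1 q zero_le_one hq0.le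
    rw [show (1 : ℝ) / 2 + q / 2 = s by rw [hq]; ring] at h
    simp only [ENNReal.rpow_one] at h
    refine h.trans ?_
    calc _ ≤ (d * L) ^ (1 / 2 : ℝ) * ((R * L) ^ q) ^ (1 / 2 : ℝ) := by gcongr
      _ = d ^ (1 / 2 : ℝ) * R ^ (q / 2) * (L ^ (1 / 2 : ℝ) * L ^ (q / 2)) := by
          rw [← ENNReal.rpow_mul, mul_one_div, ENNReal.mul_rpow_of_nonneg _ _ (by positivity),
            ENNReal.mul_rpow_of_nonneg _ _ (by positivity)]
          ring
      _ = _ := by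
          rw [← ENNReal.rpow_add_of_nonneg _ _ (by positivity) (by positivity)]
          congr 2; rw [hq]; ring
  have h2 : lavg Q (fun x => ENNReal.ofReal (u x) ^ (s * (1 + 2 * ε))) ≤
      7 * (R * L) ^ (s * (1 + 2 * ε)) := by
    have h := hus.lavg_rpow_le hA (δ := 2 * ε) (by linarith) hε Q
    have e1 : lavg Q (fun x => ENNReal.ofReal (u x ^ s) ^ (1 + 2 * ε)) =
        lavg Q (fun x => ENNReal.ofReal (u x) ^ (s * (1 + 2 * ε))) := by
      refine lavg_congr_ae ?_ Q
      filter_upwards [ofReal_rpow_ae_eq hu.2 s] with x hx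
      rw [hx, ENNReal.rpow_mul]
    rw [e1, lavg_congr_ae (ofReal_rpow_ae_eq hu.2 s)] at h
    have h3 : lavg Q (fun x => ENNReal.ofReal (u x) ^ s) ≤ (R * L) ^ s := by
      have hj := lavg_rpow_le ((one_le_div hs0).2 hsq) Q (hum.pow_const s).restrict
      simp only [← ENNReal.rpow_mul, mul_div_cancel₀ q hs0.ne'] at hj
      have h4 := ENNReal.rpow_le_rpow (hj.trans hRHq) (div_pos hs0 hq0).le
      rwa [← ENNReal.rpow_mul, ← ENNReal.rpow_mul, mul_div_cancel₀ s hq0.ne',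
        div_mul_div_cancel₀ hs0.ne', div_self hq0.ne', ENNReal.rpow_one] at h4
    refine h.trans (mul_le_mul_right ?_ _)
    rw [ENNReal.rpow_mul]
    exact ENNReal.rpow_le_rpow h3 (by linarith)
  have h3 := hholder s (s * (1 + 2 * ε)) hs0.le (by positivity)
  rw [show s / 2 + s * (1 + 2 * ε) / 2 = s * (1 + ε) by ring] at h3
  refine h3.trans ?_
  have hρ : 0 ≤ s * (1 + ε) := by positivity
  calc _ ≤ (d ^ (1 / 2 : ℝ) * R ^ (q / 2) * L ^ s) ^ (1 / 2 : ℝ) *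
        (7 * (R * L) ^ (s * (1 + 2 * ε))) ^ (1 / 2 : ℝ) := by gcongr
    _ = 7 ^ (1 / 2 : ℝ) * d ^ (1 / 4 : ℝ) * R ^ (q / 4 + s * (1 + 2 * ε) / 2) *
        L ^ (s * (1 + ε)) := by
        rw [ENNReal.mul_rpow_of_nonneg _ _ (by norm_num),
          ENNReal.mul_rpow_of_nonneg _ _ (by norm_num),
          ENNReal.mul_rpow_of_nonneg _ _ (by norm_num), ← ENNReal.rpow_mul, ← ENNReal.rpow_mul,
          ← ENNReal.rpow_mul, ← ENNReal.rpow_mul,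
          ENNReal.mul_rpow_of_nonneg _ _ (by positivity),
          show s * (1 + ε) = s * (1 / 2) + s * (1 + 2 * ε) * (1 / 2) by ring,
          ENNReal.rpow_add_of_nonneg (x := L) _ _ (by positivity) (by positivity),
          ENNReal.rpow_add_of_nonneg (x := R) _ _ (by positivity) (by positivity),
          show (1 / 2 : ℝ) * (1 / 2) = 1 / 4 by norm_num, show q / 2 * (1 / 2) = q / 4 by ring,
          show s * (1 + 2 * ε) / 2 = s * (1 + 2 * ε) * (1 / 2) by ring]
        ring
    -- Exponents are rounded so that a root of order `s * (1 + ε)` can be taken with powers free of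
    -- `ε`. For `d ≤ 1` this uses `(1 + ε) / 8 ≤ 1 / 4`; for `R ≥ 1` the exponent may grow.
    _ ≤ 7 ^ (s * (1 + ε)) * d ^ (1 / (8 * s) * (s * (1 + ε))) *
        R ^ ((1 + q / (4 * s)) * (s * (1 + ε))) * L ^ (s * (1 + ε)) := by
        gcongr ?_ * ?_ * ?_ * _
        · exact ENNReal.rpow_le_rpow_of_exponent_le (by norm_num) (by nlinarith)
        · refine ENNReal.rpow_le_rpow_of_exponent_ge hd ?_
          have : 1 / (8 * s) * (s * (1 + ε)) = (1 + ε) / 8 := by field_simp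
          rw [this]; linarith
        · refine ENNReal.rpow_le_rpow_of_exponent_le hR1 ?_
          have : (1 + q / (4 * s)) * (s * (1 + ε)) = s * (1 + ε) + q / 4 * (1 + ε) := by field_simp
          rw [this]; nlinarith
    _ = _ := by
        rw [ENNReal.mul_rpow_of_nonneg _ _ hρ, ENNReal.mul_rpow_of_nonneg _ _ hρ,
          ENNReal.mul_rpow_of_nonneg _ _ hρ, ← ENNReal.rpow_mul, ← ENNReal.rpow_mul]

/-- From a power bump to the bump given by a Young function below a power. -/
theorem lavg_young_le {B : ℝ → ℝ} (hB : IsYoung B) {κ ρ S : ℝ} (hκ : 0 < κ) (hρ : 1 ≤ ρ)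
    (hS : 0 < S) (hBκ : ∀ t : ℝ, 1 ≤ t → B t ≤ (κ * t) ^ ρ) (Q : Cube n) {g : (Fin n → ℝ) → ℝ}
    (hg : AEMeasurable g volume)
    (h : lavg Q (fun x => ENNReal.ofReal |g x| ^ ρ) ≤ ENNReal.ofReal S ^ ρ) :
    lavg Q (fun x => ENNReal.ofReal (B (|g x| / (κ * S)))) ≤ ENNReal.ofReal (B 1 / κ + 1) := by
  have hρ0 : 0 < ρ := by linarith
  have hB1 := hB.nonneg zero_le_one
  set Y : (Fin n → ℝ) → ℝ≥0∞ := fun x => ENNReal.ofReal (|g x| / S) with hY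
  have hYm : AEMeasurable Y volume := (hg.abs.div_const S).ennreal_ofReal
  have hYρ : lavg Q (fun x => Y x ^ ρ) ≤ 1 := by
    have hS0 : ENNReal.ofReal S ≠ 0 := by simpa using hS
    have e : ∀ x, Y x ^ ρ = (ENNReal.ofReal S ^ ρ)⁻¹ * ENNReal.ofReal |g x| ^ ρ := by
      intro x
      rw [hY]
      simp only
      rw [ENNReal.ofReal_div_of_pos hS, ENNReal.div_rpow_of_nonneg _ _ hρ0.le,
        ENNReal.div_eq_inv_mul]
    have hne : ENNReal.ofReal S ^ ρ ≠ 0 :=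
      (ENNReal.rpow_pos (pos_iff_ne_zero.2 hS0) ENNReal.ofReal_ne_top).ne'
    have hnt : ENNReal.ofReal S ^ ρ ≠ ∞ :=
      ENNReal.rpow_ne_top_of_nonneg hρ0.le ENNReal.ofReal_ne_top
    rw [lavg_le_iff] at h ⊢
    simp only [e]
    rw [lintegral_const_mul' _ _ (ENNReal.inv_ne_top.2 hne)]
    refine (mul_le_mul_right h _).trans (le_of_eq ?_)
    rw [← mul_assoc, ENNReal.inv_mul_cancel hne hnt]
  have hY1 : lavg Q Y ≤ 1 := by
    have := (lavg_rpow_le hρ Q hYm.restrict).trans (hYρ.trans_eq (ENNReal.one_rpow ρ).symm)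
    exact (ENNReal.rpow_le_rpow_iff hρ0).1 this
  have hpt : ∀ x, ENNReal.ofReal (B (|g x| / (κ * S))) ≤
      ENNReal.ofReal (B 1 / κ) * Y x + Y x ^ ρ := by
    intro x
    set y := |g x| / S with hy
    have hy0 : 0 ≤ y := by positivity
    have e : |g x| / (κ * S) = y / κ := by rw [hy, div_div, mul_comm]
    have hYx : Y x = ENNReal.ofReal y := rfl
    rw [e, hYx, ENNReal.ofReal_rpow_of_nonneg hy0 hρ0.le,
      ← ENNReal.ofReal_mul (by positivity), ← ENNReal.ofReal_add (by positivity) (by positivity)]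
    refine ENNReal.ofReal_le_ofReal ?_
    -- The power bound on `B` holds only from 1 on; below 1 convexity gives `B t ≤ t * B 1`, and the
    -- resulting linear term is controlled by the mean of `Y`.
    rcases le_total (y / κ) 1 with h1 | h1
    · have h2 : B (y / κ) ≤ y / κ * B 1 := by
        have hc := hB.convex.2 (mem_Ici.2 zero_le_one) (mem_Ici.2 le_rfl)
          (show 0 ≤ y / κ by positivity) (sub_nonneg.2 h1) (by ring)
        simpa [hB.zero] using hc
      have h3 : 0 ≤ y ^ ρ := by positivity
      calc B (y / κ) ≤ y / κ * B 1 := h2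
        _ = B 1 / κ * y := by ring
        _ ≤ _ := by linarith
    · have h2 := hBκ _ h1
      rw [mul_div_cancel₀ _ hκ.ne'] at h2
      have h3 : 0 ≤ B 1 / κ * y := by positivity
      linarith
  rw [lavg_le_iff]
  calc ∫⁻ x in Q.set, ENNReal.ofReal (B (|g x| / (κ * S)))
      ≤ ∫⁻ x in Q.set, (ENNReal.ofReal (B 1 / κ) * Y x + Y x ^ ρ) := lintegral_mono hpt
    _ = ENNReal.ofReal (B 1 / κ) * (∫⁻ x in Q.set, Y x) + ∫⁻ x in Q.set, Y x ^ ρ := by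
        rw [lintegral_add_right' _ (hYm.pow_const ρ).restrict,
          lintegral_const_mul' _ _ ENNReal.ofReal_ne_top]
    _ ≤ ENNReal.ofReal (B 1 / κ) * (1 * volume Q.set) + 1 * volume Q.set :=
        add_le_add (mul_le_mul_right (lavg_le_iff.1 hY1) _) (lavg_le_iff.1 hYρ)
    _ = _ := by
        rw [ENNReal.ofReal_add (by positivity) zero_le_one, ENNReal.ofReal_one]; ring

/-- The contribution of a single cube to the sparse form. -/
theorem sparseTerm_le {r β : Fin m → ℝ} {b : Fin m → (Fin n → ℝ) → ℝ}
    (hr : ∀ i, 1 ≤ r i) (hβ : ∀ i, 0 < β i) (hb : ∀ i, MemOsc (r i) (b i))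
    (hbβ : ∀ i, oscNorm (r i) (b i) < ENNReal.ofReal (β i)) {A B : ℝ → ℝ} (hA : IsYoung A)
    (hB : IsYoung B) {c : ℝ} (hc0 : 0 < c) (hc : ∀ t : ℝ, Real.exp 1 ≤ t →
      youngInv B t * Real.log t ^ recipSum r ≤ c * youngInv A t)
    {u v : (Fin n → ℝ) → ℝ} (hu : MemAp (fun _ => 1) 1 u) (hv : ∀ᵐ x, 0 < v x)
    (hw : IsWeight fun x => u x * v x) (hwA : AinftyConst (fun x => u x * v x) ≠ ∞)
    {s : ℝ} (hs : 1 ≤ s) (hR : RHConst (2 * s - 1) u ≠ ∞)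
    (hsA : AinftyConst (fun x => u x ^ s) ≠ ∞) {κ K ε : ℝ} (hκ : 0 < κ) (hε0 : 0 < ε) (hε1 : ε ≤ 1)
    (hε : 2 * ε ≤ 1 / (rhDim n * (AinftyConst fun x => u x ^ s).toReal))
    (hBκ : ∀ t : ℝ, 1 ≤ t → B t ≤ (κ * t) ^ (s * (1 + ε))) (hK : B 1 / κ + 1 ≤ K)
    (Q : Cube n) (σ : Finset (Fin m)) {f : (Fin n → ℝ) → ℝ} {M : ℝ} (hM : 0 < M)
    {k l : ℕ} (hf : ∫⁻ x in Q.set, ENNReal.ofReal (phi (recipSum r) (2 ^ k * M * |f x|)) *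
      ENNReal.ofReal (u x * v x) ≤ ∫⁻ x in Q.set, ENNReal.ofReal (u x * v x))
    {u' : (Fin n → ℝ) → ℝ} (hu' : Measurable u') (huu' : u =ᵐ[volume] u') {E : Set (Fin n → ℝ)}
    (hE : MeasurableSet E)
    (hEl : lavg Q (E.indicator fun x => ENNReal.ofReal (u x)) ≤
      ENNReal.ofReal ((1 / 2) ^ l) * lavg Q fun x => ENNReal.ofReal (u x)) :
    lavg Q (fun x => ENNReal.ofReal |f x * v x * oscProd b Q σ x|) *
        luxNorm A Q (fun x => E.indicator u' x * oscProd b Q σᶜ x) * volume Q.set ≤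
      ENNReal.ofReal (14 * c * (K + 2 * m + 3) * (orliczConst m * (1 + 14 * m)) * κ *
        (RHConst (2 * s - 1) u).toReal ^ (1 + (2 * s - 1) / (4 * s)) *
        (ApConst (fun _ => 1) 1 u).toReal *
        (1 + rhDim n * (AinftyConst fun x => u x * v x).toReal) ^ recipSum r *
        ((∏ i, β i) / M) * ((1 / 2) ^ k * ((1 / 2) ^ (1 / (8 * s))) ^ l)) *
        ∫⁻ x in Q.set, ENNReal.ofReal (u x * v x) := by
  have hs0 : 0 < s := by linarith
  set R := RHConst (2 * s - 1) u with hRdef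
  set L := lavg Q fun x => ENNReal.ofReal (u x) with hL
  have hL0 : L ≠ 0 := hu.1.lavg_ne_zero Q
  have hLt : L ≠ ∞ := hu.1.lavg_ne_top Q
  set e := 1 / (8 * s) with he
  have he0 : 0 < e := by positivity
  set Rp := R.toReal ^ (1 + (2 * s - 1) / (4 * s)) with hRp
  have hR1 : 1 ≤ R.toReal := by
    have := ENNReal.toReal_mono hR (one_le_RHConst hu.1 (q := 2 * s - 1) (by linarith))
    simpa using this
  have hRp0 : 0 < Rp := Real.rpow_pos_of_pos (by linarith) _
  set h2 : ℝ := ((1 / 2 : ℝ) ^ e) ^ l with hh2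
  have hh20 : 0 < h2 := by positivity
  -- The bound of `lavg_indicator_rpow_le` for `d = (1 / 2) ^ l`; `κ * S` will be the Luxemburg
  -- scale of `g` for `B`.
  set S := 7 * h2 * Rp * L.toReal with hS
  have hLr : 0 < L.toReal := ENNReal.toReal_pos hL0 hLt
  have hS0 : 0 < S := by positivity
  have hexp0 : 0 ≤ 1 + (2 * s - 1) / (4 * s) := by
    have : 0 ≤ (2 * s - 1) / (4 * s) := div_nonneg (by linarith) (by linarith)
    linarith
  have hSe : ENNReal.ofReal S = 7 * ENNReal.ofReal ((1 / 2) ^ l) ^ e *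
      R ^ (1 + (2 * s - 1) / (4 * s)) * L := by
    rw [hS, ENNReal.ofReal_mul (by positivity), ENNReal.ofReal_mul (by positivity),
      ENNReal.ofReal_mul (by positivity), ENNReal.ofReal_toReal hLt, hRp,
      ← ENNReal.ofReal_rpow_of_nonneg ENNReal.toReal_nonneg hexp0, ENNReal.ofReal_toReal hR,
      ENNReal.ofReal_rpow_of_nonneg (by positivity) he0.le, hh2, ← Real.rpow_natCast,
      ← Real.rpow_natCast, ← Real.rpow_mul (by norm_num), ← Real.rpow_mul (by norm_num),
      mul_comm e]
    simp
  have hB1 := hB.nonneg zero_le_one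
  have hK0 : 0 ≤ K := le_trans (by positivity) hK
  set g := E.indicator u' with hg
  have hgm : Measurable g := hu'.indicator hE
  have hgu : (fun x => ENNReal.ofReal |g x| ^ (s * (1 + ε))) =ᵐ[volume]
      E.indicator fun x => ENNReal.ofReal (u x) ^ (s * (1 + ε)) := by
    filter_upwards [huu', hu.1.2] with x hx hx0
    by_cases hxE : x ∈ E
    · rw [hg, indicator_of_mem hxE, indicator_of_mem hxE, ← hx, abs_of_pos hx0]
    · rw [hg, indicator_of_notMem hxE, indicator_of_notMem hxE, abs_zero, ENNReal.ofReal_zero,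
        ENNReal.zero_rpow_of_pos (by positivity)]
  have hgS : lavg Q (fun x => ENNReal.ofReal |g x| ^ (s * (1 + ε))) ≤
      ENNReal.ofReal S ^ (s * (1 + ε)) := by
    rw [lavg_congr_ae hgu, hSe]
    exact lavg_indicator_rpow_le hu.1 hs hR hε0 hε1 hsA hε Q hE
      (ENNReal.ofReal_le_one.2 (pow_le_one₀ (by norm_num) (by norm_num))) hEl
  have hy := (lavg_young_le hB hκ (by nlinarith) hS0 hBκ Q hgm.aemeasurable hgS).trans
    (ENNReal.ofReal_le_ofReal hK)
  have hlux := luxNorm_mul_oscProd_le hr hβ hb hbβ hA hB hc0 hc Q σᶜ (mul_pos hκ hS0) hK0 hy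
  have hk0 : (0 : ℝ) < 2 ^ k * M := by positivity
  have hosc := lintegral_mul_oscProd_le hr hβ hb hbβ hw hwA Q σ hk0 hf
  set WQ := ∫⁻ x in Q.set, ENNReal.ofReal (u x * v x) with hWQ
  set a := ApConst (fun _ => 1) 1 u with ha
  have hat : a ≠ ∞ := hu.2.ne
  set θ := 1 + rhDim n * (AinftyConst fun x => u x * v x).toReal with hθ
  have hθ0 : 0 < θ := by
    have := mul_nonneg (rhDim_pos n).le
      (ENNReal.toReal_nonneg (a := AinftyConst fun x => u x * v x))
    linarith
  -- The average `L` of `u` left over from the factor with `g` is moved into the integral by the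
  -- `A_1` condition, which changes `v dx` into `uv dx`.
  have hA1 : L * ∫⁻ x in Q.set, ENNReal.ofReal |f x * v x * oscProd b Q σ x| ≤
      a * ∫⁻ x in Q.set, ENNReal.ofReal (|f x| * oscProd b Q σ x) *
        ENNReal.ofReal (u x * v x) := by
    rw [← lintegral_const_mul' _ _ hLt, ← lintegral_const_mul' _ _ hat]
    refine setLIntegral_mono_ae' Q.measurableSet_set ?_
    filter_upwards [ae_lavg_le_of_A1 hu, hv, hu.1.2] with x hx hvx hux hxQ
    have hosc0 := oscProd_nonneg b Q σ x
    rw [abs_mul, abs_mul, abs_of_pos hvx, abs_of_nonneg hosc0, ENNReal.ofReal_mul hux.le]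
    calc L * ENNReal.ofReal (|f x| * v x * oscProd b Q σ x)
        ≤ a * ENNReal.ofReal (u x) * ENNReal.ofReal (|f x| * v x * oscProd b Q σ x) :=
          mul_le_mul_left (hx Q hxQ) _
      _ = a * (ENNReal.ofReal (u x) * ENNReal.ofReal (|f x| * oscProd b Q σ x * v x)) := by
          rw [mul_right_comm |f x|, mul_assoc]
      _ = _ := by rw [ENNReal.ofReal_mul (mul_nonneg (abs_nonneg _) hosc0)]; ring
  have hlux' : luxNorm A Q (fun x => g x * oscProd b Q σᶜ x) ≤
      ENNReal.ofReal (14 * c * (K + 2 * m + 3) * κ * h2 * Rp * ∏ i ∈ σᶜ, β i) * L := by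
    refine hlux.trans (le_of_eq ?_)
    rw [← ENNReal.ofReal_toReal hLt, ← ENNReal.ofReal_mul]
    · congr 1
      rw [hS]; ring
    · have : 0 ≤ ∏ i ∈ σᶜ, β i := Finset.prod_nonneg fun i _ => (hβ i).le
      positivity
  have hσ0 : 0 ≤ ∏ i ∈ σ, β i := Finset.prod_nonneg fun i _ => (hβ i).le
  have hσc0 : 0 ≤ ∏ i ∈ σᶜ, β i := Finset.prod_nonneg fun i _ => (hβ i).le
  have hO := orliczConst_pos m
  have hθα : 0 ≤ θ ^ recipSum r := by positivity
  calc lavg Q (fun x => ENNReal.ofReal |f x * v x * oscProd b Q σ x|) *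
        luxNorm A Q (fun x => g x * oscProd b Q σᶜ x) * volume Q.set
      = (∫⁻ x in Q.set, ENNReal.ofReal |f x * v x * oscProd b Q σ x|) *
        luxNorm A Q (fun x => g x * oscProd b Q σᶜ x) := by
        rw [mul_right_comm, lavg_mul_volume]
    _ ≤ (∫⁻ x in Q.set, ENNReal.ofReal |f x * v x * oscProd b Q σ x|) *
        (ENNReal.ofReal (14 * c * (K + 2 * m + 3) * κ * h2 * Rp * ∏ i ∈ σᶜ, β i) * L) :=
        mul_le_mul_right hlux' _
    _ = ENNReal.ofReal (14 * c * (K + 2 * m + 3) * κ * h2 * Rp * ∏ i ∈ σᶜ, β i) *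
        (L * ∫⁻ x in Q.set, ENNReal.ofReal |f x * v x * oscProd b Q σ x|) := by ring
    _ ≤ ENNReal.ofReal (14 * c * (K + 2 * m + 3) * κ * h2 * Rp * ∏ i ∈ σᶜ, β i) *
        (ENNReal.ofReal a.toReal * (ENNReal.ofReal (orliczConst m * (1 + 14 * m) *
          (∏ i ∈ σ, β i) * θ ^ recipSum r / (2 ^ k * M)) * WQ)) := by
        rw [ENNReal.ofReal_toReal hat]
        exact mul_le_mul_right (hA1.trans (mul_le_mul_right hosc _)) _
    _ = _ := by
        rw [← mul_assoc, ← mul_assoc, ← ENNReal.ofReal_mul (by positivity),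
          ← ENNReal.ofReal_mul (by positivity)]
        congr 2
        rw [← Finset.prod_mul_prod_compl σ β, one_div, inv_pow]
        field_simp

end SingleCube

/-! ### Sparse families -/

section Sparse

variable {n : ℕ}

/-- The cubes of a finite nested family are covered by its maximal members. -/
theorem exists_pairwiseDisjoint_maximal (hn : 0 < n) (F : Finset (Cube n))
    (hF : ∀ P ∈ F, ∀ Q ∈ F, P.set ⊆ Q.set ∨ Q.set ⊆ P.set ∨ Disjoint P.set Q.set) :
    ∃ G ⊆ F, (G : Set (Cube n)).PairwiseDisjoint Cube.set ∧
      ∀ P ∈ F, ∃ Q ∈ G, P.set ⊆ Q.set := by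
  classical
  refine ⟨F.filter fun Q => ∀ P ∈ F, Q.set ⊆ P.set → P = Q, Finset.filter_subset _ _, ?_, ?_⟩
  · intro P hP Q hQ hPQ
    simp only [Finset.coe_filter, mem_ofPred_eq] at hP hQ
    rcases hF P hP.1 Q hQ.1 with h | h | h
    · exact absurd (hP.2 Q hQ.1 h).symm hPQ
    · exact absurd (hQ.2 P hP.1 h) hPQ
    · exact h
  · intro P hP
    -- A member of largest side above `P` is maximal for inclusion: inclusion bounds the sides as
    -- soon as there is a coordinate, and equal sides force equality.
    obtain ⟨Q, hQ, hmax⟩ := (F.filter fun R => P.set ⊆ R.set).exists_max_image Cube.side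
      ⟨P, Finset.mem_filter.2 ⟨hP, Subset.rfl⟩⟩
    obtain ⟨hQF, hPQ⟩ := Finset.mem_filter.1 hQ
    refine ⟨Q, Finset.mem_filter.2 ⟨hQF, fun R hR hQR => ?_⟩, hPQ⟩
    have h1 := hmax R (Finset.mem_filter.2 ⟨hR, hPQ.trans hQR⟩)
    have h2 := Cube.corner_le_of_subset hQR ⟨0, hn⟩
    exact (Cube.eq_of_subset_of_side_eq hQR (by linarith)).symm

/-- A measure comparison on the union of a nested family of cubes. -/
theorem measure_biUnion_le_of_nested (hn : 0 < n) {F : Finset (Cube n)}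
    (hF : ∀ P ∈ F, ∀ Q ∈ F, P.set ⊆ Q.set ∨ Q.set ⊆ P.set ∨ Disjoint P.set Q.set)
    {μ ν : Measure (Fin n → ℝ)} (h : ∀ Q ∈ F, μ Q.set ≤ ν Q.set) :
    μ (⋃ Q ∈ F, Q.set) ≤ ν univ := by
  obtain ⟨G, hGF, hd, hcov⟩ := exists_pairwiseDisjoint_maximal hn F hF
  calc μ (⋃ Q ∈ F, Q.set) ≤ μ (⋃ Q ∈ G, Q.set) := by
        refine measure_mono (iUnion₂_subset fun P hP => ?_)
        obtain ⟨Q, hQ, hPQ⟩ := hcov P hP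
        exact hPQ.trans (subset_biUnion_of_mem (u := fun Q : Cube n => Q.set) hQ)
    _ ≤ ∑ Q ∈ G, μ Q.set := measure_biUnion_finset_le _ _
    _ ≤ ∑ Q ∈ G, ν Q.set := Finset.sum_le_sum fun Q hQ => h Q (hGF hQ)
    _ = ν (⋃ Q ∈ G, Q.set) := (measure_biUnion_finset hd fun Q _ => Q.measurableSet_set).symm
    _ ≤ ν univ := measure_mono (subset_univ _)

/-- The Carleson packing condition for sparse families with respect to an `A_∞` weight. -/
theorem mul_sum_subset_le {η : ℝ} {S : Set (Cube n)} (hS : IsSparse η S) {F : Finset (Cube n)}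
    (hFS : ∀ Q ∈ F, Q ∈ S) {w : (Fin n → ℝ) → ℝ} (hw : IsWeight w) (Q : Cube n)
    (hFQ : ∀ P ∈ F, P.set ⊆ Q.set) :
    ENNReal.ofReal η * ∑ P ∈ F, ∫⁻ x in P.set, ENNReal.ofReal (w x) ≤
      AinftyConst w * ∫⁻ x in Q.set, ENNReal.ofReal (w x) := by
  obtain ⟨E, hE, hd⟩ := hS
  set M := maxL (Q.set.indicator fun x => ENNReal.ofReal (w x)) with hM
  calc ENNReal.ofReal η * ∑ P ∈ F, ∫⁻ x in P.set, ENNReal.ofReal (w x)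
      ≤ ∑ P ∈ F, ∫⁻ x in E P, M x := by
        rw [Finset.mul_sum]
        refine Finset.sum_le_sum fun P hP => ?_
        obtain ⟨hm, hsub, hvol⟩ := hE P (hFS P hP)
        calc ENNReal.ofReal η * ∫⁻ x in P.set, ENNReal.ofReal (w x)
            = lavg P (fun x => ENNReal.ofReal (w x)) * (ENNReal.ofReal η * volume P.set) := by
              rw [← lavg_mul_volume]; ring
          _ ≤ lavg P (fun x => ENNReal.ofReal (w x)) * volume (E P) := mul_le_mul_right hvol _
          _ = ∫⁻ _ in E P, lavg P (fun x => ENNReal.ofReal (w x)) := (setLIntegral_const _ _).symm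
          -- The average over `P` is at most the maximal function on `E P`; as the sets `E P` are
          -- disjoint, the Fujii-Wilson constant bounds the total.
          _ ≤ ∫⁻ x in E P, M x := by
              refine setLIntegral_mono' hm fun x hx => ?_
              rw [← lavg_indicator_of_subset (hFQ P hP)]
              exact lavg_le_maxL (hsub hx) _
    _ = ∫⁻ x in ⋃ P ∈ F, E P, M x := by
        refine (lintegral_biUnion_finset ?_ (fun P hP => (hE P (hFS P hP)).1) _).symm
        exact hd.subset fun P hP => hFS P hP
    _ ≤ ∫⁻ x in Q.set, M x := by
        refine lintegral_mono_set (iUnion₂_subset fun P hP => ?_)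
        exact (hE P (hFS P hP)).2.1.trans (hFQ P hP)
    _ ≤ _ := lintegral_maxL_le hw Q

/-- A sparse nested family all of whose members satisfy a mass bound. -/
theorem mul_sum_le_of_nested (hn : 0 < n) {η : ℝ} {S : Set (Cube n)} (hS : IsSparse η S)
    {F : Finset (Cube n)} (hFS : ∀ Q ∈ F, Q ∈ S)
    (hF : ∀ P ∈ F, ∀ Q ∈ F, P.set ⊆ Q.set ∨ Q.set ⊆ P.set ∨ Disjoint P.set Q.set)
    {w : (Fin n → ℝ) → ℝ} (hw : IsWeight w) {ν : Measure (Fin n → ℝ)}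
    (h : ∀ Q ∈ F, ∫⁻ x in Q.set, ENNReal.ofReal (w x) ≤ ν Q.set) :
    ENNReal.ofReal η * ∑ P ∈ F, ∫⁻ x in P.set, ENNReal.ofReal (w x) ≤ AinftyConst w * ν univ := by
  classical
  obtain ⟨G, hGF, hd, hcov⟩ := exists_pairwiseDisjoint_maximal hn F hF
  calc ENNReal.ofReal η * ∑ P ∈ F, ∫⁻ x in P.set, ENNReal.ofReal (w x)
      ≤ ENNReal.ofReal η * ∑ P ∈ F, ∑ Q ∈ G,
          if P.set ⊆ Q.set then ∫⁻ x in P.set, ENNReal.ofReal (w x) else 0 := by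
        refine mul_le_mul_right (Finset.sum_le_sum fun P hP => ?_) _
        obtain ⟨Q, hQ, hPQ⟩ := hcov P hP
        refine le_trans (le_of_eq ?_) (Finset.single_le_sum (fun _ _ => zero_le) hQ)
        rw [if_pos hPQ]
    _ = ENNReal.ofReal η * ∑ Q ∈ G, ∑ P ∈ F.filter (fun P => P.set ⊆ Q.set),
          ∫⁻ x in P.set, ENNReal.ofReal (w x) := by
        rw [Finset.sum_comm]
        simp only [Finset.sum_filter]
    _ = ∑ Q ∈ G, ENNReal.ofReal η * ∑ P ∈ F.filter (fun P => P.set ⊆ Q.set),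
          ∫⁻ x in P.set, ENNReal.ofReal (w x) := Finset.mul_sum _ _ _
    _ ≤ ∑ Q ∈ G, AinftyConst w * ν Q.set := by
        refine Finset.sum_le_sum fun Q hQ => ?_
        refine (mul_sum_subset_le hS (fun P hP => hFS P (Finset.mem_filter.1 hP).1) hw Q
          fun P hP => (Finset.mem_filter.1 hP).2).trans ?_
        exact mul_le_mul_right (h Q (hGF hQ)) _
    _ = AinftyConst w * ν (⋃ Q ∈ G, Q.set) := by
        rw [← Finset.mul_sum, measure_biUnion_finset hd fun Q _ => Q.measurableSet_set]
    _ ≤ _ := mul_le_mul_right (measure_mono (subset_univ _)) _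

/-- Dyadic grids are countable. -/
theorem IsDyadicGrid.countable {D : Set (Cube n)} (hD : IsDyadicGrid D) : D.Countable := by
  obtain ⟨l, hl, hside, -⟩ := hD.sides
  have hU : D ⊆ ⋃ k : ℤ, {Q ∈ D | Q.side = l * 2 ^ k} := fun Q hQ => by
    obtain ⟨k, hk⟩ := hside Q hQ
    exact mem_iUnion.2 ⟨k, hQ, hk⟩
  refine (countable_iUnion fun k => ?_).mono hU
  have hd : {Q ∈ D | Q.side = l * 2 ^ k}.PairwiseDisjoint Cube.set := by
    rintro P ⟨hP, hPs⟩ Q ⟨hQ, hQs⟩ hPQ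
    rcases hD.nested P hP Q hQ with h | h | h
    · exact absurd (Cube.eq_of_subset_of_side_eq h (hPs.trans hQs.symm)) hPQ
    · exact absurd (Cube.eq_of_subset_of_side_eq h (hQs.trans hPs.symm)).symm hPQ
    · exact h
  exact hd.countable_of_nonempty_interior fun Q _ => Q.interior_nonempty

/-- The weak type estimate for the cubes of a dyadic grid on which one measure dominates
another one. -/
theorem measure_biUnion_le_of_grid (hn : 0 < n) {D : Set (Cube n)} (hD : IsDyadicGrid D)
    {μ ν : Measure (Fin n → ℝ)} :
    μ (⋃ Q ∈ {Q ∈ D | μ Q.set < ν Q.set}, Q.set) ≤ ν univ := by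
  have hc : {Q ∈ D | μ Q.set < ν Q.set}.Countable := hD.countable.mono fun Q hQ => hQ.1
  rcases eq_empty_or_nonempty {Q ∈ D | μ Q.set < ν Q.set} with he | hne
  · simp [he]
  obtain ⟨g, hg⟩ := hc.exists_eq_range hne
  have hgm : ∀ k, g k ∈ {Q ∈ D | μ Q.set < ν Q.set} := fun k => hg ▸ mem_range_self k
  -- Maximal cubes may fail to exist in an infinite family, so the union is exhausted by finite
  -- ones, for which the bound is uniform.
  rw [hg, biUnion_range, measure_iUnion_eq_iSup_accumulate]
  refine iSup_le fun k => ?_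
  classical
  refine le_trans (measure_mono ?_) (measure_biUnion_le_of_nested hn
    (F := (Finset.range (k + 1)).image g) (μ := μ) (ν := ν) ?_ ?_)
  · refine iUnion₂_subset fun j hj => ?_
    exact subset_biUnion_of_mem (u := fun Q : Cube n => Q.set)
      (Finset.mem_image_of_mem g (Finset.mem_range.2 (Nat.lt_succ_of_le hj)))
  · intro P hP Q hQ
    obtain ⟨i, -, rfl⟩ := Finset.mem_image.1 hP
    obtain ⟨j, -, rfl⟩ := Finset.mem_image.1 hQ
    exact hD.nested _ (hgm i).1 _ (hgm j).1
  · intro P hP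
    obtain ⟨i, -, rfl⟩ := Finset.mem_image.1 hP
    exact (hgm i).2.le

end Sparse

/-! ### Summation of the levels -/

section Summation

theorem summable_rpow_mul_geometric {a γ N : ℝ} (ha0 : 0 < a) (ha1 : a < 1) (hγ : 0 ≤ γ)
    (hN : 0 ≤ N) : Summable fun l : ℕ => a ^ l * (1 + l * N) ^ γ := by
  obtain ⟨M, hM⟩ := exists_nat_ge γ
  have h1 : Summable fun l : ℕ => ((l + 1 : ℕ) : ℝ) ^ M * a ^ (l + 1) :=
    (summable_pow_mul_geometric_of_norm_lt_one M (r := a)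
      (by rwa [Real.norm_of_nonneg ha0.le])).comp_injective (add_left_injective 1)
  refine Summable.of_nonneg_of_le (fun l => by positivity) (fun l => ?_)
    (h1.mul_left ((1 + N) ^ γ * a⁻¹))
  have hl : (0 : ℝ) ≤ l := Nat.cast_nonneg l
  have hx1 : (1 : ℝ) ≤ ((l + 1 : ℕ) : ℝ) := by push_cast; linarith
  have h2 : 1 + l * N ≤ (1 + N) * ((l + 1 : ℕ) : ℝ) := by
    push_cast
    nlinarith
  generalize ((l + 1 : ℕ) : ℝ) = x at hx1 h2
  have hx0 : 0 ≤ x := by linarith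
  have h3 : (1 + l * N) ^ γ ≤ (1 + N) ^ γ * x ^ M := by
    calc (1 + l * N) ^ γ ≤ ((1 + N) * x) ^ γ := Real.rpow_le_rpow (by positivity) h2 hγ
      _ = (1 + N) ^ γ * x ^ γ := Real.mul_rpow (by positivity) hx0
      _ ≤ (1 + N) ^ γ * x ^ (M : ℝ) :=
          mul_le_mul_of_nonneg_left (Real.rpow_le_rpow_of_exponent_le hx1 hM) (by positivity)
      _ = _ := by rw [Real.rpow_natCast]
  have h4 := inv_mul_cancel₀ ha0.ne'
  calc a ^ l * (1 + l * N) ^ γ ≤ a ^ l * ((1 + N) ^ γ * x ^ M) :=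
        mul_le_mul_of_nonneg_left h3 (by positivity)
    _ = _ := by
        rw [pow_succ]
        linear_combination (-((1 + N) ^ γ * x ^ M * a ^ l)) * h4

theorem sum_range_ite_half_pow_le (N K : ℕ) :
    ∑ k ∈ Finset.range N, (if K ≤ k then (1 / 2 : ℝ) ^ k else 0) ≤ 2 * (1 / 2) ^ K := by
  rw [← Finset.sum_filter]
  have h : (Finset.range N).filter (fun k => K ≤ k) = Finset.Ico K N := by
    ext k; simp [and_comm]
  rw [h, Finset.sum_Ico_eq_sum_range]
  simp only [pow_add]
  rw [← Finset.mul_sum, mul_comm]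
  gcongr
  exact sum_geometric_two_le _

/-- Splitting of a double sum according to the size of its levels. -/
theorem exists_sum_levels_le {e p α : ℝ} (he : 0 < e) (hp : 1 ≤ p) (hα : 0 ≤ α) :
    ∃ C : ℝ, 0 < C ∧ ∀ (Λ Γ K Φ Y : ℝ), 0 ≤ Λ → 0 ≤ Γ → 0 ≤ K → 0 ≤ Φ → 0 ≤ Y →
      ∀ {ι : Type} (F : Finset ι) (k l : ι → ℕ) (T : ι → ℝ),
      (∀ i j : ℕ, ∑ Q ∈ F with k Q = i ∧ l Q = j, T Q ≤ Γ * (2 ^ (i + 1) * (i + 2) ^ α) * Φ) →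
      (∀ i j : ℕ, ∑ Q ∈ F with k Q = i ∧ l Q = j, T Q ≤ Γ * (K * 2 ^ ((j + 1) * p)) * Y) →
      Λ * ∑ Q ∈ F, (1 / 2) ^ k Q * ((1 / 2) ^ e) ^ l Q * T Q ≤
        C * (Λ * Γ) * Real.log (Real.exp 1 + Λ * Γ * K) ^ (1 + α) * Φ + Y / 2 := by
  classical
  set a : ℝ := (1 / 2) ^ e with ha
  have ha0 : 0 < a := by positivity
  have ha1 : a < 1 := Real.rpow_lt_one (by norm_num) (by norm_num) he
  -- The slope of the threshold in `j`: `2 ^ (-j * N)` beats the growth `2 ^ (j * p)` of the second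
  -- bound and leaves `2 ^ (-j)`.
  obtain ⟨N, hN⟩ := exists_nat_ge (p + 1)
  have hsum := summable_rpow_mul_geometric (γ := 1 + α) (N := N) ha0 ha1 (by linarith)
    (Nat.cast_nonneg N)
  set C1 := ∑' l : ℕ, a ^ l * (1 + l * (N : ℝ)) ^ (1 + α) with hC1
  have hC10 : 0 ≤ C1 := tsum_nonneg fun l => by positivity
  refine ⟨2 * (C1 + 1) * (p + 7) ^ (1 + α), by positivity, ?_⟩
  intro Λ Γ K Φ Y hΛ hΓ hK hΦ hY ι F k l T h1 h2
  set X := Real.exp 1 + Λ * Γ * K with hX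
  have hΛΓK : 0 ≤ Λ * Γ * K := by positivity
  have heX : Real.exp 1 ≤ X := by linarith
  have hX0 : 0 < X := (Real.exp_pos 1).trans_le heX
  have hlogX : 1 ≤ Real.log X := (Real.le_log_iff_exp_le hX0).2 heX
  -- Chosen so that `2 ^ (-A)` beats `Λ * Γ * K`, with `2 ^ (p + 3)` covering the numerical factors
  -- and the final `1 / 2`; still `A + 1` is at most `(p + 7) * log X`.
  set A := ⌈Real.logb 2 (2 ^ (p + 3) * X)⌉₊ with hA
  have hlogb : Real.logb 2 (2 ^ (p + 3) * X) = p + 3 + Real.logb 2 X := by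
    rw [Real.logb_mul (by positivity) hX0.ne', Real.logb_rpow (by norm_num) (by norm_num)]
  have hlogb2 : Real.logb 2 X ≤ 2 * Real.log X := by
    rw [Real.logb, div_le_iff₀ (Real.log_pos one_lt_two)]
    nlinarith [Real.log_two_gt_d9]
  have hlogb0 : 0 ≤ Real.logb 2 X := div_nonneg (by linarith) (Real.log_pos one_lt_two).le
  have hAle : (A : ℝ) + 1 ≤ (p + 7) * Real.log X := by
    have : (A : ℝ) < Real.logb 2 (2 ^ (p + 3) * X) + 1 := Nat.ceil_lt_add_one (by
      rw [hlogb]; linarith)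
    rw [hlogb] at this
    nlinarith
  have hApow : 2 ^ (p + 3) * X ≤ 2 ^ A := by
    have h3 := Nat.le_ceil (Real.logb 2 (2 ^ (p + 3) * X))
    rw [Real.logb_le_iff_le_rpow one_lt_two (by positivity), Real.rpow_natCast] at h3
    exact h3
  set kk : ℕ → ℕ := fun j => A + j * N with hkk
  set n0 := F.sup k + F.sup l + 1 with hn0
  have hmaps : ∀ Q ∈ F, (k Q, l Q) ∈ Finset.range n0 ×ˢ Finset.range n0 := by
    intro Q hQ
    have := Finset.le_sup (f := k) hQ
    have := Finset.le_sup (f := l) hQ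
    simp only [Finset.mem_product, Finset.mem_range]
    omega
  set S : ℕ → ℕ → ℝ := fun i j => ∑ Q ∈ F with k Q = i ∧ l Q = j, T Q with hS
  have hfiber : ∑ Q ∈ F, (1 / 2) ^ k Q * a ^ l Q * T Q =
      ∑ j ∈ Finset.range n0, ∑ i ∈ Finset.range n0, a ^ j * ((1 / 2) ^ i * S i j) := by
    rw [← Finset.sum_fiberwise_of_maps_to hmaps, Finset.sum_product_right]
    refine Finset.sum_congr rfl fun j _ => Finset.sum_congr rfl fun i _ => ?_
    rw [hS, Finset.mul_sum, Finset.mul_sum]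
    refine Finset.sum_congr (by simp only [Prod.mk.injEq]) fun Q hQ => ?_
    obtain ⟨-, hi, hj⟩ := Finset.mem_filter.1 hQ
    rw [hi, hj]; ring
  have hinner : ∀ j, ∑ i ∈ Finset.range n0, (1 / 2) ^ i * S i j ≤
      2 * Γ * ((A : ℝ) + 1) ^ (1 + α) * (1 + j * (N : ℝ)) ^ (1 + α) * Φ +
        2 * Γ * K * (2 ^ p * (1 / 2) ^ A) * (1 / 2) ^ j * Y := by
    intro j
    -- Below the threshold the first bound cancels `(1 / 2) ^ i` up to `(i + 2) ^ α`, so the number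
    -- of terms raises the power to `1 + α`; from the threshold on, the second bound gives a
    -- geometric tail.
    have hterm : ∀ i, (1 / 2) ^ i * S i j ≤
        (if i < kk j then 2 * Γ * ((kk j : ℝ) + 1) ^ α * Φ else 0) +
          (if kk j ≤ i then (1 / 2) ^ i else 0) * (Γ * (K * 2 ^ ((j + 1) * p)) * Y) := by
      intro i
      rcases lt_or_ge i (kk j) with hi | hi
      · rw [if_pos hi, if_neg (not_le.2 hi), zero_mul, add_zero]
        have hik : (i : ℝ) + 2 ≤ kk j + 1 := by exact_mod_cast (by omega : i + 2 ≤ kk j + 1)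
        calc (1 / 2) ^ i * S i j ≤ (1 / 2) ^ i * (Γ * (2 ^ (i + 1) * (i + 2) ^ α) * Φ) := by
              gcongr; exact h1 i j
          _ = 2 * Γ * ((i : ℝ) + 2) ^ α * Φ * ((1 / 2) ^ i * 2 ^ i) := by rw [pow_succ]; ring
          _ = 2 * Γ * ((i : ℝ) + 2) ^ α * Φ := by
              rw [← mul_pow]; norm_num
          _ ≤ _ := by gcongr
      · rw [if_neg (not_lt.2 hi), if_pos hi, zero_add]
        gcongr
        exact h2 i j
    refine (Finset.sum_le_sum fun i _ => hterm i).trans ?_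
    rw [Finset.sum_add_distrib, ← Finset.sum_mul]
    refine add_le_add ?_ ?_
    · rw [← Finset.sum_filter, Finset.sum_const, nsmul_eq_mul]
      have hcard : (((Finset.range n0).filter fun i => i < kk j).card : ℝ) ≤ kk j := by
        have : ((Finset.range n0).filter fun i => i < kk j).card ≤ (Finset.range (kk j)).card :=
          Finset.card_le_card fun i hi => Finset.mem_range.2 (Finset.mem_filter.1 hi).2
        rw [Finset.card_range] at this
        exact_mod_cast this
      have hkk1 : (kk j : ℝ) + 1 ≤ (A + 1) * (1 + j * (N : ℝ)) := by
        simp only [hkk]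
        push_cast
        have : (0 : ℝ) ≤ A * (j * N) := by positivity
        nlinarith
      calc _ ≤ (kk j + 1 : ℝ) * (2 * Γ * ((kk j : ℝ) + 1) ^ α * Φ) := by
            gcongr; linarith
        _ = 2 * Γ * ((kk j : ℝ) + 1) ^ (1 + α) * Φ := by
            rw [Real.rpow_add (by positivity), Real.rpow_one]; ring
        _ ≤ 2 * Γ * ((A + 1) * (1 + j * (N : ℝ))) ^ (1 + α) * Φ := by gcongr
        _ = _ := by rw [Real.mul_rpow (by positivity) (by positivity)]; ring
    · have hpow : (1 / 2 : ℝ) ^ kk j * 2 ^ ((j + 1) * p) ≤ 2 ^ p * (1 / 2) ^ A * (1 / 2) ^ j := by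
        have e1 : ∀ i : ℕ, (1 / 2 : ℝ) ^ i = 2 ^ (-(i : ℝ)) := by
          intro i
          rw [Real.rpow_neg (by norm_num), Real.rpow_natCast, one_div, inv_pow]
        rw [e1, e1, e1, ← Real.rpow_add (by norm_num), ← Real.rpow_add (by norm_num),
          ← Real.rpow_add (by norm_num)]
        refine Real.rpow_le_rpow_of_exponent_le (by norm_num) ?_
        simp only [hkk]
        push_cast
        nlinarith [Nat.cast_nonneg (α := ℝ) j]
      calc _ ≤ 2 * (1 / 2) ^ kk j * (Γ * (K * 2 ^ ((j + 1) * p)) * Y) := by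
            gcongr; exact sum_range_ite_half_pow_le _ _
        _ = 2 * Γ * K * ((1 / 2 : ℝ) ^ kk j * 2 ^ ((j + 1) * p)) * Y := by ring
        _ ≤ 2 * Γ * K * (2 ^ p * (1 / 2) ^ A * (1 / 2) ^ j) * Y := by gcongr
        _ = _ := by ring
  have hmain : ∑ Q ∈ F, (1 / 2) ^ k Q * a ^ l Q * T Q ≤
      2 * Γ * ((A : ℝ) + 1) ^ (1 + α) * Φ * C1 + 4 * Γ * K * (2 ^ p * (1 / 2) ^ A) * Y := by
    rw [hfiber]
    calc _ ≤ ∑ j ∈ Finset.range n0,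
          (2 * Γ * ((A : ℝ) + 1) ^ (1 + α) * Φ * (a ^ j * (1 + j * (N : ℝ)) ^ (1 + α)) +
            2 * Γ * K * (2 ^ p * (1 / 2) ^ A) * Y * (1 / 2) ^ j) := by
          refine Finset.sum_le_sum fun j _ => ?_
          rw [← Finset.mul_sum]
          calc _ ≤ a ^ j * (2 * Γ * ((A : ℝ) + 1) ^ (1 + α) * (1 + j * (N : ℝ)) ^ (1 + α) * Φ +
                2 * Γ * K * (2 ^ p * (1 / 2) ^ A) * (1 / 2) ^ j * Y) := by
                gcongr; exact hinner j
            _ = 2 * Γ * ((A : ℝ) + 1) ^ (1 + α) * Φ * (a ^ j * (1 + j * (N : ℝ)) ^ (1 + α)) +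
                a ^ j * (2 * Γ * K * (2 ^ p * (1 / 2) ^ A) * Y * (1 / 2) ^ j) := by ring
            _ ≤ _ := by
                exact add_le_add le_rfl
                  (mul_le_of_le_one_left (by positivity) (pow_le_one₀ ha0.le ha1.le))
      _ = 2 * Γ * ((A : ℝ) + 1) ^ (1 + α) * Φ *
            (∑ j ∈ Finset.range n0, a ^ j * (1 + j * (N : ℝ)) ^ (1 + α)) +
          2 * Γ * K * (2 ^ p * (1 / 2) ^ A) * Y * ∑ j ∈ Finset.range n0, (1 / 2 : ℝ) ^ j := by
          rw [Finset.sum_add_distrib, Finset.mul_sum, Finset.mul_sum]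
      _ ≤ 2 * Γ * ((A : ℝ) + 1) ^ (1 + α) * Φ * C1 +
          2 * Γ * K * (2 ^ p * (1 / 2) ^ A) * Y * 2 := by
          gcongr
          · exact hsum.sum_le_tsum _ fun j _ => by positivity
          · exact sum_geometric_two_le _
      _ = _ := by ring
  have hsmall : Λ * (4 * Γ * K * (2 ^ p * (1 / 2) ^ A)) ≤ 1 / 2 := by
    have h3 : (2 : ℝ) ^ (p + 3) = 8 * 2 ^ p := by
      rw [Real.rpow_add (by norm_num)]; norm_num; ring
    have h4 : 8 * 2 ^ p * (Λ * Γ * K) ≤ 2 ^ A := by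
      rw [← h3]
      refine le_trans ?_ hApow
      gcongr
      linarith [Real.exp_pos 1]
    have h5 : (2 : ℝ) ^ A * (1 / 2) ^ A = 1 := by rw [← mul_pow]; norm_num
    have h6 : (0 : ℝ) < (1 / 2) ^ A := by positivity
    nlinarith [mul_le_mul_of_nonneg_right h4 h6.le]
  have hA1 : ((A : ℝ) + 1) ^ (1 + α) ≤ (p + 7) ^ (1 + α) * Real.log X ^ (1 + α) := by
    rw [← Real.mul_rpow (by linarith) (by linarith)]
    exact Real.rpow_le_rpow (by positivity) hAle (by linarith)
  calc Λ * ∑ Q ∈ F, (1 / 2) ^ k Q * a ^ l Q * T Q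
      ≤ Λ * (2 * Γ * ((A : ℝ) + 1) ^ (1 + α) * Φ * C1 + 4 * Γ * K * (2 ^ p * (1 / 2) ^ A) * Y) := by
        gcongr
    _ = 2 * C1 * (Λ * Γ) * ((A : ℝ) + 1) ^ (1 + α) * Φ +
        Λ * (4 * Γ * K * (2 ^ p * (1 / 2) ^ A)) * Y := by ring
    _ ≤ 2 * (C1 + 1) * (Λ * Γ) * ((p + 7) ^ (1 + α) * Real.log X ^ (1 + α)) * Φ + 1 / 2 * Y := by
        gcongr
        linarith
    _ = _ := by ring

end Summation

/-! ### The sparse form -/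

section SparseForm

variable {n m : ℕ}

/-- The logarithm of a product is subadditive, so the factor `2 ^ (k + 1)` adds at most `k + 1` to
it. -/
theorem phi_two_pow_mul_le {α x : ℝ} (hα : 0 ≤ α) (hx : 0 ≤ x) (k : ℕ) :
    phi α (2 ^ (k + 1) * x) ≤ 2 ^ (k + 1) * (k + 2) ^ α * phi α x := by
  have hlog := Real.posLog_nonneg (x := x)
  have h2 : Real.posLog ((2 : ℝ) ^ (k + 1)) ≤ k + 1 := by
    have h3 : 0 ≤ Real.log ((2 : ℝ) ^ (k + 1)) := Real.log_nonneg (one_le_pow₀ (by norm_num))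
    rw [Real.posLog, max_eq_right h3, Real.log_pow]
    push_cast
    nlinarith [Real.log_two_lt_d9, Nat.cast_nonneg (α := ℝ) k]
  have h1 : 1 + Real.posLog (2 ^ (k + 1) * x) ≤ (k + 2) * (1 + Real.posLog x) := by
    have := Real.posLog_mul (x := (2 : ℝ) ^ (k + 1)) (y := x)
    nlinarith [Nat.cast_nonneg (α := ℝ) k]
  have h0 := Real.posLog_nonneg (x := (2 : ℝ) ^ (k + 1) * x)
  rw [phi, phi]
  calc 2 ^ (k + 1) * x * (1 + Real.posLog (2 ^ (k + 1) * x)) ^ α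
      ≤ 2 ^ (k + 1) * x * ((k + 2) * (1 + Real.posLog x)) ^ α := by gcongr
    _ = _ := by rw [Real.mul_rpow (by positivity) (by linarith)]; ring

theorem luxNorm_eq_zero {A : ℝ → ℝ} (hA : A 0 = 0) {Q : Cube n} {h : (Fin n → ℝ) → ℝ}
    (h0 : ∀ᵐ x ∂volume.restrict Q.set, h x = 0) : luxNorm A Q h = 0 := by
  have hint : ∀ l : ℝ, lavg Q (fun x => ENNReal.ofReal (A (|h x| / l))) ≤ 1 := by
    intro l
    rw [lavg_le_iff, lintegral_congr_ae (g := fun _ => 0) ?_]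
    · simp
    · filter_upwards [h0] with x hx
      simp [hx, hA]
  refine nonpos_iff_eq_zero.1 (ENNReal.le_of_forall_pos_le_add fun ε hε _ => ?_)
  rw [zero_add, ← ENNReal.ofReal_coe_nnreal]
  exact luxNorm_le (by exact_mod_cast hε) (hint _)

/-- The dyadic level of `f` on a cube. -/
theorem exists_phi_level {α : ℝ} (hα : 0 ≤ α) {f : (Fin n → ℝ) → ℝ} {w : (Fin n → ℝ) → ℝ≥0∞}
    {Q : Cube n} (hw : ∫⁻ x in Q.set, w x ≠ ∞) {M : ℝ} (hM : 0 < M)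
    (h0 : ∫⁻ x in Q.set, ENNReal.ofReal |f x| * w x ≠ 0)
    (h1 : ∫⁻ x in Q.set, ENNReal.ofReal (phi α (M * |f x|)) * w x ≤ ∫⁻ x in Q.set, w x) :
    ∃ k : ℕ, ∫⁻ x in Q.set, ENNReal.ofReal (phi α (2 ^ k * M * |f x|)) * w x ≤
        ∫⁻ x in Q.set, w x ∧
      ∫⁻ x in Q.set, w x ≤ ENNReal.ofReal (2 ^ (k + 1) * (k + 2) ^ α) *
        ∫⁻ x in Q.set, ENNReal.ofReal (phi α (M * |f x|)) * w x := by
  classical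
  -- Since `phi` dominates the identity, the integral grows without bound in `k` unless `f` vanishes
  -- on `Q`. The level is the last `k` before the first failure; `h1` excludes a failure at 0.
  have hex : ∃ k : ℕ, ∫⁻ x in Q.set, w x <
      ∫⁻ x in Q.set, ENNReal.ofReal (phi α (2 ^ k * M * |f x|)) * w x := by
    obtain ⟨k, hk⟩ := ENNReal.exists_nat_mul_gt
      (a := ENNReal.ofReal M * ∫⁻ x in Q.set, ENNReal.ofReal |f x| * w x)
      (mul_ne_zero (by simpa using hM) h0) hw
    refine ⟨k, hk.trans_le ?_⟩
    rw [← lintegral_const_mul' _ _ ENNReal.ofReal_ne_top,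
      ← lintegral_const_mul' _ _ (ENNReal.natCast_ne_top k)]
    refine lintegral_mono fun x => ?_
    rw [← mul_assoc, ← mul_assoc, ← ENNReal.ofReal_natCast, ← ENNReal.ofReal_mul (by positivity),
      ← ENNReal.ofReal_mul (by positivity)]
    refine mul_le_mul_left (ENNReal.ofReal_le_ofReal ?_) _
    refine le_trans ?_ (le_phi hα (by positivity))
    gcongr
    exact_mod_cast (Nat.lt_two_pow_self (n := k)).le
  have hspec := Nat.find_spec hex
  rcases hk : Nat.find hex with _ | k
  · rw [hk] at hspec
    simp only [pow_zero, one_mul] at hspec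
    exact absurd h1 (not_le.2 hspec)
  · refine ⟨k, not_lt.1 (Nat.find_min hex (by omega)), ?_⟩
    rw [hk] at hspec
    refine hspec.le.trans ?_
    rw [← lintegral_const_mul' _ _ ENNReal.ofReal_ne_top]
    refine lintegral_mono fun x => ?_
    rw [← mul_assoc, ← ENNReal.ofReal_mul (by positivity), mul_assoc (2 ^ (k + 1))]
    exact mul_le_mul_left (ENNReal.ofReal_le_ofReal (phi_two_pow_mul_le hα (by positivity) k)) _

/-- The dyadic level of the relative size of a set. -/
theorem exists_ratio_level {x y : ℝ≥0∞} (hx : x ≠ 0) (hxy : x ≤ y) (hy : y ≠ ∞) :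
    ∃ l : ℕ, x ≤ ENNReal.ofReal ((1 / 2) ^ l) * y ∧ y ≤ 2 ^ (l + 1) * x := by
  have hxt : x ≠ ∞ := ne_top_of_le_ne_top hy hxy
  have hx0 : 0 < x.toReal := ENNReal.toReal_pos hx hxt
  have hle : x.toReal ≤ y.toReal := ENNReal.toReal_mono hy hxy
  have hy0 : 0 < y.toReal := hx0.trans_le hle
  obtain ⟨l, h1, h2⟩ := exists_nat_pow_near_of_lt_one (x := x.toReal / y.toReal) (y := 1 / 2)
    (div_pos hx0 hy0) ((div_le_one hy0).2 hle) (by norm_num) (by norm_num)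
  rw [lt_div_iff₀ hy0] at h1
  rw [div_le_iff₀ hy0] at h2
  refine ⟨l, ?_, ?_⟩
  · rw [← ENNReal.ofReal_toReal hxt, ← ENNReal.ofReal_toReal hy,
      ← ENNReal.ofReal_mul (by positivity)]
    exact ENNReal.ofReal_le_ofReal h2
  · rw [← ENNReal.ofReal_toReal hxt, ← ENNReal.ofReal_toReal hy,
      show (2 : ℝ≥0∞) ^ (l + 1) = ENNReal.ofReal (2 ^ (l + 1)) by
        rw [ENNReal.ofReal_pow (by norm_num)]; simp, ← ENNReal.ofReal_mul (by positivity)]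
    refine ENNReal.ofReal_le_ofReal ?_
    have h3 : (2 : ℝ) ^ (l + 1) * (1 / 2) ^ (l + 1) = 1 := by rw [← mul_pow]; norm_num
    have h4 : (0 : ℝ) < 2 ^ (l + 1) := by positivity
    nlinarith [mul_lt_mul_of_pos_left h1 h4]

/-- The sum over a sparse family, in terms of the levels of its cubes. -/
theorem tsum_le_of_levels (hn : 0 < n) {α p : ℝ} (hα : 0 ≤ α) (hp : 1 ≤ p) {e : ℝ} (he : 0 < e) :
    ∃ C : ℝ, 0 < C ∧ ∀ {η : ℝ} {D S : Set (Cube n)} {u v : (Fin n → ℝ) → ℝ}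
      {E : Set (Fin n → ℝ)} {f : (Fin n → ℝ) → ℝ} {M Λ Λ' : ℝ} {X : Cube n → ℝ≥0∞},
      0 < η → IsDyadicGrid D → S ⊆ D → IsSparse η S → IsWeight u → MemAp u p v →
      AinftyConst (fun x => u x * v x) ≠ ∞ → MeasurableSet E →
      ∫⁻ x in E, ENNReal.ofReal (u x * v x) ≠ ∞ → 0 < M → 0 ≤ Λ → 0 ≤ Λ' →
      ∫⁻ x, ENNReal.ofReal (phi α (M * |f x|)) * ENNReal.ofReal (u x * v x) ≠ ∞ →
      (∀ Q ∈ S, (E ∩ Q.set).Nonempty →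
        ∫⁻ x in Q.set, ENNReal.ofReal (phi α (M * |f x|)) * ENNReal.ofReal (u x * v x) ≤
          ∫⁻ x in Q.set, ENNReal.ofReal (u x * v x)) →
      (∀ Q ∈ S, X Q ≠ 0 → ∫⁻ x in E ∩ Q.set, ENNReal.ofReal (u x) ≠ 0 ∧
        ∫⁻ x in Q.set, ENNReal.ofReal |f x| * ENNReal.ofReal (u x * v x) ≠ 0) →
      (∀ Q ∈ S, ∀ k l : ℕ,
        ∫⁻ x in Q.set, ENNReal.ofReal (phi α (2 ^ k * M * |f x|)) * ENNReal.ofReal (u x * v x) ≤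
          ∫⁻ x in Q.set, ENNReal.ofReal (u x * v x) →
        ∫⁻ x in E ∩ Q.set, ENNReal.ofReal (u x) ≤
          ENNReal.ofReal ((1 / 2) ^ l) * ∫⁻ x in Q.set, ENNReal.ofReal (u x) →
        X Q ≤ ENNReal.ofReal (Λ' * ((1 / 2) ^ k * ((1 / 2) ^ e) ^ l)) *
          ∫⁻ x in Q.set, ENNReal.ofReal (u x * v x)) →
      ENNReal.ofReal Λ * ∑' Q : S, X Q ≤ ENNReal.ofReal
        (C * (Λ * Λ' * ((AinftyConst fun x => u x * v x).toReal / η)) *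
          Real.log (Real.exp 1 + Λ * Λ' * ((AinftyConst fun x => u x * v x).toReal / η) *
            (ApConst u p v).toReal) ^ (1 + α) *
          (∫⁻ x, ENNReal.ofReal (phi α (M * |f x|)) * ENNReal.ofReal (u x * v x)).toReal +
          (∫⁻ x in E, ENNReal.ofReal (u x * v x)).toReal / 2) := by
  classical
  obtain ⟨C, hC, hmain⟩ := exists_sum_levels_le he hp hα
  refine ⟨C, hC, ?_⟩
  intro η D S u v E f M Λ Λ' X hη hD hSD hS hu hv hWt hE hEt hM hΛ hΛ' hΦt hZ hX0 hX
  have hw := hu.mul_of_Ap hp hv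
  have hp0 : 0 ≤ p := by linarith
  set w : (Fin n → ℝ) → ℝ≥0∞ := fun x => ENNReal.ofReal (u x * v x) with hwdef
  set Wc := AinftyConst fun x => u x * v x with hWc
  set Kc := ApConst u p v with hKc
  have hKt : Kc ≠ ∞ := hv.2.ne
  set Φ := ∫⁻ x, ENNReal.ofReal (phi α (M * |f x|)) * w x with hΦ
  set Y := ∫⁻ x in E, w x with hY
  have hη0 : ENNReal.ofReal η ≠ 0 := by simpa using hη
  rw [ENNReal.tsum_eq_iSup_sum, ENNReal.mul_iSup]
  refine iSup_le fun F0 => ?_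
  -- Each contributing cube receives its two levels together with two upper bounds for its mass, one
  -- by `Φ` on the cube and one by the mass of `E` in it; the second comes from the `A_p(u)`
  -- comparison.
  have hlev : ∀ Q : S, X Q ≠ 0 → ∃ kl : ℕ × ℕ,
      X Q ≤ ENNReal.ofReal (Λ' * ((1 / 2) ^ kl.1 * ((1 / 2) ^ e) ^ kl.2)) * ∫⁻ x in (Q : Cube n).set, w x ∧
      ∫⁻ x in (Q : Cube n).set, w x ≤ ENNReal.ofReal (2 ^ (kl.1 + 1) * (kl.1 + 2) ^ α) *
        ∫⁻ x in (Q : Cube n).set, ENNReal.ofReal (phi α (M * |f x|)) * w x ∧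
      ∫⁻ x in (Q : Cube n).set, w x ≤ ENNReal.ofReal (Kc.toReal * 2 ^ (((kl.2 : ℝ) + 1) * p)) *
        ∫⁻ x in E ∩ (Q : Cube n).set, w x := by
    rintro ⟨Q, hQ⟩ hXQ
    obtain ⟨hu0, hf0⟩ := hX0 Q hQ hXQ
    have hne : (E ∩ Q.set).Nonempty := by
      by_contra hemp
      rw [not_nonempty_iff_eq_empty] at hemp
      rw [hemp] at hu0
      simp at hu0
    obtain ⟨k, hk1, hk2⟩ := exists_phi_level hα (hw.lintegral_ne_top Q) hM hf0 (hZ Q hQ hne)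
    have hsub : ∫⁻ x in E ∩ Q.set, ENNReal.ofReal (u x) ≤ ∫⁻ x in Q.set, ENNReal.ofReal (u x) :=
      lintegral_mono_set inter_subset_right
    obtain ⟨l, hl1, hl2⟩ := exists_ratio_level hu0 hsub (hu.lintegral_ne_top Q)
    refine ⟨(k, l), hX Q hQ k l hk1 hl1, hk2, ?_⟩
    set UE := ∫⁻ x in E ∩ Q.set, ENNReal.ofReal (u x) with hUE
    have hUEt : UE ≠ ∞ := ne_top_of_le_ne_top (hu.lintegral_ne_top Q) hsub
    have h1 : UE ^ p ≠ 0 := (ENNReal.rpow_pos (pos_iff_ne_zero.2 hu0) hUEt).ne'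
    have h2 : UE ^ p ≠ ∞ := ENNReal.rpow_ne_top_of_nonneg hp0 hUEt
    rw [← ENNReal.mul_le_mul_iff_left h1 h2]
    calc (∫⁻ x in Q.set, w x) * UE ^ p
        ≤ Kc * (∫⁻ x in Q.set, ENNReal.ofReal (u x)) ^ p * ∫⁻ x in E ∩ Q.set, w x :=
          lintegral_mul_rpow_le_of_Ap hp hu hv Q (hE.inter Q.measurableSet_set) inter_subset_right
      _ ≤ Kc * (2 ^ (l + 1) * UE) ^ p * ∫⁻ x in E ∩ Q.set, w x := by gcongr
      _ = Kc * ((2 : ℝ≥0∞) ^ (l + 1)) ^ p * (∫⁻ x in E ∩ Q.set, w x) * UE ^ p := by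
          rw [ENNReal.mul_rpow_of_nonneg _ _ hp0]; ring
      _ = _ := by
          rw [ENNReal.ofReal_mul ENNReal.toReal_nonneg, ENNReal.ofReal_toReal hKt,
            ← ENNReal.rpow_natCast, ← ENNReal.rpow_mul,
            ← ENNReal.ofReal_rpow_of_pos (by norm_num)]
          simp
  choose! kl hkl1 hkl2 hkl3 using hlev
  set F : Finset S := F0.filter fun Q : S => X (Q : Cube n) ≠ 0 with hF
  have hFX : ∀ Q : S, Q ∈ F → X Q ≠ 0 := fun Q hQ => (Finset.mem_filter.1 hQ).2
  have hsumF : ∑ Q ∈ F0, X (Q : Cube n) = ∑ Q ∈ F, X (Q : Cube n) := by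
    rw [hF, Finset.sum_filter_ne_zero]
  -- The packing estimate for an arbitrary dominating measure `ν`; it is used with `ν` a multiple of
  -- the density of `Φ`, and with `ν` a multiple of `uv` restricted to `E`.
  have hlevel : ∀ (F' : Finset S) (ν : Measure (Fin n → ℝ)), ν univ ≠ ∞ →
      (∀ Q : S, Q ∈ F' → ∫⁻ x in (Q : Cube n).set, w x ≤ ν (Q : Cube n).set) →
      ∑ Q ∈ F', (∫⁻ x in (Q : Cube n).set, w x).toReal ≤
        Wc.toReal / η * (ν univ).toReal := by
    intro F' ν hνt hν
    have h := mul_sum_le_of_nested hn hS (F := F'.map (Function.Embedding.subtype _))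
      (fun Q hQ => by
        obtain ⟨P, -, rfl⟩ := Finset.mem_map.1 hQ
        exact P.2)
      (fun P hP Q hQ => by
        obtain ⟨P, -, rfl⟩ := Finset.mem_map.1 hP
        obtain ⟨Q, -, rfl⟩ := Finset.mem_map.1 hQ
        exact hD.nested _ (hSD P.2) _ (hSD Q.2)) hw (ν := ν)
      (fun Q hQ => by
        obtain ⟨P, hP, rfl⟩ := Finset.mem_map.1 hQ
        exact hν P hP)
    rw [Finset.sum_map] at h
    have h2 := ENNReal.toReal_mono (ENNReal.mul_ne_top hWt hνt) h
    rw [ENNReal.toReal_mul, ENNReal.toReal_mul, ENNReal.toReal_ofReal hη.le,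
      ENNReal.toReal_sum fun Q _ => hw.lintegral_ne_top _] at h2
    rw [div_mul_eq_mul_div, le_div_iff₀ hη, mul_comm _ η]
    exact h2
  have hb1 : ∀ i j : ℕ, ∑ Q ∈ F with (kl Q).1 = i ∧ (kl Q).2 = j,
      (∫⁻ x in (Q : Cube n).set, w x).toReal ≤
        Wc.toReal / η * (2 ^ (i + 1) * (i + 2) ^ α) * Φ.toReal := by
    intro i j
    set ν : Measure (Fin n → ℝ) := ENNReal.ofReal (2 ^ (i + 1) * (i + 2) ^ α) •
      volume.withDensity fun x => ENNReal.ofReal (phi α (M * |f x|)) * w x with hν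
    have hνu : ν univ = ENNReal.ofReal (2 ^ (i + 1) * (i + 2) ^ α) * Φ := by
      rw [hν, Measure.smul_apply, withDensity_apply _ MeasurableSet.univ, Measure.restrict_univ,
        smul_eq_mul]
    refine (hlevel _ ν ?_ fun Q hQ => ?_).trans (le_of_eq ?_)
    · rw [hνu]; exact ENNReal.mul_ne_top ENNReal.ofReal_ne_top hΦt
    · obtain ⟨hQF, hi, -⟩ := Finset.mem_filter.1 hQ
      rw [hν, Measure.smul_apply, withDensity_set, smul_eq_mul, ← hi]
      exact hkl2 Q (hFX Q hQF)
    · rw [hνu, ENNReal.toReal_mul, ENNReal.toReal_ofReal (by positivity)]; ring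
  have hb2 : ∀ i j : ℕ, ∑ Q ∈ F with (kl Q).1 = i ∧ (kl Q).2 = j,
      (∫⁻ x in (Q : Cube n).set, w x).toReal ≤
        Wc.toReal / η * (Kc.toReal * 2 ^ ((j + 1) * p)) * Y.toReal := by
    intro i j
    set ν : Measure (Fin n → ℝ) := ENNReal.ofReal (Kc.toReal * 2 ^ (((j : ℝ) + 1) * p)) •
      (volume.withDensity w).restrict E with hν
    have hνu : ν univ = ENNReal.ofReal (Kc.toReal * 2 ^ (((j : ℝ) + 1) * p)) * Y := by
      rw [hν, Measure.smul_apply, Measure.restrict_apply_univ, withDensity_apply _ hE, smul_eq_mul]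
    refine (hlevel _ ν ?_ fun Q hQ => ?_).trans (le_of_eq ?_)
    · rw [hνu]; exact ENNReal.mul_ne_top ENNReal.ofReal_ne_top hEt
    · obtain ⟨hQF, -, hj⟩ := Finset.mem_filter.1 hQ
      rw [hν, Measure.smul_apply, Measure.restrict_apply (Q : Cube n).measurableSet_set,
        inter_comm, withDensity_apply _ (hE.inter (Q : Cube n).measurableSet_set), smul_eq_mul, ← hj]
      exact hkl3 Q (hFX Q hQF)
    · rw [hνu, ENNReal.toReal_mul, ENNReal.toReal_ofReal (by positivity)]; ring
  have hfin := hmain (Λ * Λ') (Wc.toReal / η) Kc.toReal Φ.toReal Y.toReal (by positivity)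
    (by positivity) ENNReal.toReal_nonneg ENNReal.toReal_nonneg ENNReal.toReal_nonneg F
    (fun Q => (kl Q).1) (fun Q => (kl Q).2) (fun Q => (∫⁻ x in (Q : Cube n).set, w x).toReal)
    hb1 hb2
  rw [hsumF]
  refine le_trans ?_ (ENNReal.ofReal_le_ofReal hfin)
  calc ENNReal.ofReal Λ * ∑ Q ∈ F, X (Q : Cube n)
      ≤ ENNReal.ofReal Λ * ∑ Q ∈ F, ENNReal.ofReal (Λ' * ((1 / 2) ^ (kl Q).1 *
          ((1 / 2) ^ e) ^ (kl Q).2) * (∫⁻ x in (Q : Cube n).set, w x).toReal) := by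
        gcongr with Q hQ
        refine (hkl1 Q (hFX Q hQ)).trans (le_of_eq ?_)
        rw [ENNReal.ofReal_mul (p := Λ' * _) (by positivity),
          ENNReal.ofReal_toReal (hw.lintegral_ne_top _)]
    _ = ENNReal.ofReal (Λ * ∑ Q ∈ F, Λ' * ((1 / 2) ^ (kl Q).1 *
          ((1 / 2) ^ e) ^ (kl Q).2) * (∫⁻ x in (Q : Cube n).set, w x).toReal) := by
        rw [ENNReal.ofReal_mul hΛ, ENNReal.ofReal_sum_of_nonneg fun Q _ => by positivity]
    _ = _ := by
        rw [mul_assoc Λ, Finset.mul_sum F _ Λ']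
        congr 2
        exact Finset.sum_congr rfl fun Q _ => by ring

end SparseForm

/-! ### The weak type estimate -/

section MixedEstimate

variable {n m : ℕ}

/-- A sparse bound controls the level sets, once it controls the bounded subsets of the level sets
on which the data are bounded. -/
theorem SparseBound.measure_le {A : ℝ → ℝ} {b : Fin m → (Fin n → ℝ) → ℝ} {η c₀ : ℝ}
    {D : Fin (3 ^ n) → Set (Cube n)} {F : Set ((Fin n → ℝ) → ℝ)}
    {G : ((Fin n → ℝ) → ℝ) → (Fin n → ℝ) → ℝ} (hG : SparseBound A b η c₀ D F G)
    {u v : (Fin n → ℝ) → ℝ} (hu : IsWeight u) (hv : IsWeight v)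
    (hw : IsWeight fun x => u x * v x) {f : (Fin n → ℝ) → ℝ} (hf : (fun x => f x * v x) ∈ F)
    {lam : ℝ} (hlam : 0 < lam) {Z : Set (Fin n → ℝ)} (hZ : MeasurableSet Z) {X : ℝ≥0∞}
    (h : ∀ (u' : (Fin n → ℝ) → ℝ) (E : Set (Fin n → ℝ)) (S : Fin (3 ^ n) → Set (Cube n)),
      Measurable u' → u =ᵐ[volume] u' → MeasurableSet E → Disjoint E Z →
      ∫⁻ x in E, ENNReal.ofReal (u x * v x) ≠ ∞ → (∀ j, S j ⊆ D j ∧ IsSparse η (S j)) →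
      ENNReal.ofReal lam * ∫⁻ x in E, ENNReal.ofReal (u x * v x) ≤
        ENNReal.ofReal c₀ * sparseForm A b S (fun x => f x * v x) (E.indicator u') →
      ∫⁻ x in E, ENNReal.ofReal (u x * v x) ≤ X) :
    (volume.withDensity fun x => ENNReal.ofReal (u x * v x))
        {x | lam < G (fun y => f y * v y) x / v x} ≤
      (volume.withDensity fun x => ENNReal.ofReal (u x * v x)) Z + X := by
  obtain ⟨-, hGm, hG⟩ := hG _ hf
  set μ := volume.withDensity fun x => ENNReal.ofReal (u x * v x) with hμ
  set g := G fun x => f x * v x with hg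
  set u' := hu.aemeasurable.mk u with hu'
  set v' := hv.aemeasurable.mk v with hv'
  set g' := hGm.mk g with hg'
  have hu'm : Measurable u' := hu.aemeasurable.measurable_mk
  have hv'm : Measurable v' := hv.aemeasurable.measurable_mk
  have hg'm : Measurable g' := hGm.measurable_mk
  have huu : u =ᵐ[volume] u' := hu.aemeasurable.ae_eq_mk
  have hvv : v =ᵐ[volume] v' := hv.aemeasurable.ae_eq_mk
  have hgg : g =ᵐ[volume] g' := hGm.ae_eq_mk
  -- The truncations make the test function `χ_E u'` bounded with compact support and its product
  -- with `G` integrable. They increase to the part of the level set outside `Z`, up to a null set.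
  let E : ℕ → Set (Fin n → ℝ) := fun k => (Metric.closedBall 0 k ∩ {x | u' x ≤ k} ∩
    {x | |g' x| ≤ k} ∩ {x | 0 < u' x} ∩ {x | 0 < v' x} ∩ {x | lam * v' x < g' x}) \ Z
  have hEm : ∀ k, MeasurableSet (E k) := fun k =>
    (((((Metric.isClosed_closedBall.measurableSet.inter
      (measurableSet_le hu'm measurable_const)).inter
      (measurableSet_le hg'm.abs measurable_const)).inter
      (measurableSet_lt measurable_const hu'm)).inter
      (measurableSet_lt measurable_const hv'm)).inter
      (measurableSet_lt (hv'm.const_mul lam) hg'm)).diff hZ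
  have hEmono : Monotone E := by
    intro i j hij x hx
    have hc : (i : ℝ) ≤ j := by exact_mod_cast hij
    obtain ⟨⟨⟨⟨⟨⟨h1, h2⟩, h3⟩, h4⟩, h5⟩, h6⟩, h7⟩ := hx
    exact ⟨⟨⟨⟨⟨⟨Metric.closedBall_subset_closedBall hc h1, le_trans h2 hc⟩, le_trans h3 hc⟩, h4⟩,
      h5⟩, h6⟩, h7⟩
  have hEX : ∀ k, ∫⁻ x in E k, ENNReal.ofReal (u x * v x) ≤ X := by
    intro k
    have hsub : E k ⊆ Metric.closedBall 0 k := fun x hx => hx.1.1.1.1.1.1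
    have hEvol : volume (E k) ≠ ∞ :=
      ne_top_of_le_ne_top measure_closedBall_lt_top.ne (measure_mono hsub)
    have hfin : ∫⁻ x in E k, ENNReal.ofReal (u x * v x) ≠ ∞ := by
      refine ne_top_of_le_ne_top ?_ (lintegral_mono_set hsub)
      have h1 := (hw.1.integrableOn_isCompact (isCompact_closedBall (0 : Fin n → ℝ) k)).2
      refine ne_top_of_le_ne_top h1.ne (lintegral_mono fun x => ?_)
      rw [← ofReal_norm]
      exact ENNReal.ofReal_le_ofReal (le_abs_self _)
    have hbd : ∀ x, |(E k).indicator u' x| ≤ k := by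
      intro x
      by_cases hx : x ∈ E k
      · rw [indicator_of_mem hx, abs_of_pos hx.1.1.1.2]
        exact hx.1.1.1.1.1.2
      · rw [indicator_of_notMem hx]
        simp
    have hind : ∀ᵐ x, g x * (E k).indicator u' x = (E k).indicator (fun x => g' x * u' x) x := by
      filter_upwards [hgg] with x hx
      by_cases hxE : x ∈ E k
      · rw [indicator_of_mem hxE, indicator_of_mem hxE, hx]
      · rw [indicator_of_notMem hxE, indicator_of_notMem hxE, mul_zero]
    have hint : Integrable ((E k).indicator fun x => g' x * u' x) volume := by
      rw [integrable_indicator_iff (hEm k)]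
      refine Measure.integrableOn_of_bounded (M := (k : ℝ) * k) hEvol
        (hg'm.mul hu'm).aestronglyMeasurable ?_
      filter_upwards [ae_restrict_mem (hEm k)] with x hx
      rw [norm_mul, Real.norm_eq_abs, Real.norm_eq_abs, abs_of_pos (a := u' x) hx.1.1.1.2]
      exact mul_le_mul hx.1.1.1.1.2 hx.1.1.1.1.1.2 hx.1.1.1.2.le (Nat.cast_nonneg k)
    obtain ⟨S, hS, hle⟩ := hG ((E k).indicator u') (hu'm.indicator (hEm k)) ⟨k, hbd⟩
      (HasCompactSupport.of_support_subset_isCompact (isCompact_closedBall (0 : Fin n → ℝ) k)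
        (support_indicator_subset.trans hsub)) (hint.congr (hind.mono fun x hx => hx.symm))
    refine h u' (E k) S hu'm huu (hEm k) disjoint_sdiff_left hfin hS (le_trans ?_ hle)
    rw [integral_congr_ae hind, integral_indicator (hEm k),
      ofReal_integral_eq_lintegral_ofReal ((integrable_indicator_iff (hEm k)).1 hint),
      ← lintegral_const_mul' _ _ ENNReal.ofReal_ne_top]
    · refine lintegral_mono_ae ?_
      filter_upwards [ae_restrict_mem (hEm k), ae_restrict_of_ae huu, ae_restrict_of_ae hvv]
        with x hx hux hvx
      rw [← ENNReal.ofReal_mul hlam.le, hux, hvx]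
      refine ENNReal.ofReal_le_ofReal ?_
      have h1 : 0 < u' x := hx.1.1.1.2
      have h2 : lam * v' x < g' x := hx.1.2
      nlinarith
    · filter_upwards [ae_restrict_mem (hEm k)] with x hx
      have h1 : 0 < u' x := hx.1.1.1.2
      have h2 : 0 < v' x := hx.1.1.2
      have h3 : lam * v' x < g' x := hx.1.2
      have h4 : 0 < g' x := lt_trans (by positivity) h3
      simp only [Pi.zero_apply]
      positivity
  have hEU : μ (⋃ k, E k) ≤ X := by
    rw [hEmono.measure_iUnion]
    refine iSup_le fun k => ?_
    rw [hμ, withDensity_apply _ (hEm k)]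
    exact hEX k
  refine le_trans (measure_mono_ae ?_) ((measure_union_le Z (⋃ k, E k)).trans (by gcongr))
  have hac : μ ≪ volume := withDensity_absolutelyContinuous _ _
  refine hac.ae_le ?_
  filter_upwards [huu, hvv, hgg, hu.2, hv.2] with x h1 h2 h3 h4 h5 hx
  by_cases hxZ : x ∈ Z
  · exact Or.inl hxZ
  · refine Or.inr (mem_iUnion.2 ?_)
    obtain ⟨k, hk⟩ := exists_nat_ge (max (dist x 0) (max (u' x) |g' x|))
    have hx' : lam < g x / v x := hx
    rw [lt_div_iff₀ h5] at hx'
    refine ⟨k, ⟨⟨⟨⟨⟨?_, ?_⟩, ?_⟩, ?_⟩, ?_⟩, ?_⟩, hxZ⟩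
    · exact (le_max_left _ _).trans hk
    · exact ((le_max_left _ _).trans (le_max_right _ _)).trans hk
    · exact ((le_max_right _ _).trans (le_max_right _ _)).trans hk
    · rw [mem_ofPred_eq, ← h1]; exact h4
    · rw [mem_ofPred_eq, ← h2]; exact h5
    · rw [mem_ofPred_eq, ← h2, ← h3]; exact hx'

end MixedEstimate

/-! ### The individual terms of the sparse form. -/

section SparseTerm

variable {n m : ℕ}

/-- One term of the sparse form. -/
noncomputable def sparseTerm (A : ℝ → ℝ) (b : Fin m → (Fin n → ℝ) → ℝ) (σ : Finset (Fin m))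
    (f g : (Fin n → ℝ) → ℝ) (Q : Cube n) : ℝ≥0∞ :=
  lavg Q (fun x => ENNReal.ofReal |f x * oscProd b Q σ x|) *
    luxNorm A Q (fun x => g x * oscProd b Q σᶜ x) * volume Q.set

theorem sparseForm_eq {N : ℕ} (A : ℝ → ℝ) (b : Fin m → (Fin n → ℝ) → ℝ)
    (S : Fin N → Set (Cube n)) (f g : (Fin n → ℝ) → ℝ) :
    sparseForm A b S f g = ∑ j, ∑ σ : Finset (Fin m), ∑' Q : S j, sparseTerm A b σ f g Q := by
  unfold sparseForm sparseTerm
  refine Finset.sum_congr rfl fun j _ => ?_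
  have h := Finset.sum_powerset (Finset.univ : Finset (Fin m)) fun σ =>
    ∑' Q : S j, lavg (Q : Cube n) (fun x => ENNReal.ofReal |f x * oscProd b Q σ x|) *
      luxNorm A (Q : Cube n) (fun x => g x * oscProd b Q σᶜ x) * volume (Q : Cube n).set
  rw [Finset.powerset_univ, Finset.card_univ, Fintype.card_fin] at h
  rw [h]
  simp only [setLAverage_eq_lavg]

variable {A : ℝ → ℝ} {b : Fin m → (Fin n → ℝ) → ℝ} {σ : Finset (Fin m)} {f g : (Fin n → ℝ) → ℝ}
  {Q : Cube n}

theorem sparseTerm_eq_zero_of_left (h : ∀ᵐ x ∂volume.restrict Q.set, f x * oscProd b Q σ x = 0) :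
    sparseTerm A b σ f g Q = 0 := by
  have : lavg Q (fun x => ENNReal.ofReal |f x * oscProd b Q σ x|) = 0 := by
    rw [lavg, lintegral_congr_ae (g := fun _ => 0) (h.mono fun x hx => by simp [hx])]
    simp
  rw [sparseTerm, this, zero_mul, zero_mul]

theorem sparseTerm_eq_zero_of_right (hA : A 0 = 0)
    (h : ∀ᵐ x ∂volume.restrict Q.set, g x * oscProd b Q σᶜ x = 0) :
    sparseTerm A b σ f g Q = 0 := by
  rw [sparseTerm, luxNorm_eq_zero hA h, mul_zero, zero_mul]

/-- The index `i` lies in `σ` or in its complement, and its factor vanishes almost everywhere. This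
settles the case `‖b‖ = 0`, in which the normalization by `‖b‖ / λ` breaks down. -/
theorem sparseTerm_eq_zero_of_oscNorm {r : ℝ} (hr : 1 ≤ r) (hA : A 0 = 0) {i : Fin m}
    (hb : LocallyIntegrable (b i)) (h : oscNorm r (b i) = 0) : sparseTerm A b σ f g Q = 0 := by
  have h0 := ae_eq_cubeAvg_of_oscNorm_eq_zero hr hb h Q
  by_cases hi : i ∈ σ
  · refine sparseTerm_eq_zero_of_left (h0.mono fun x hx => ?_)
    rw [oscProd, Finset.prod_eq_zero hi (by rw [hx, abs_zero]), mul_zero]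
  · refine sparseTerm_eq_zero_of_right hA (h0.mono fun x hx => ?_)
    rw [oscProd, Finset.prod_eq_zero (Finset.mem_compl.2 hi) (by rw [hx, abs_zero]), mul_zero]

/-- This nonvanishing makes the level `l` exist for every contributing cube; the next lemma plays
the same role for `k`. -/
theorem lintegral_inter_ne_zero_of_sparseTerm {u u' : (Fin n → ℝ) → ℝ} {E : Set (Fin n → ℝ)}
    (hA : A 0 = 0) (hu : IsWeight u)
    (h : sparseTerm A b σ f (E.indicator u') Q ≠ 0) :
    ∫⁻ x in E ∩ Q.set, ENNReal.ofReal (u x) ≠ 0 := by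
  refine fun h0 => h (sparseTerm_eq_zero_of_right hA ?_)
  rw [lintegral_eq_zero_iff' hu.aemeasurable_ofReal.restrict] at h0
  have h1 := ae_imp_of_ae_restrict h0
  rw [ae_restrict_iff' Q.measurableSet_set]
  filter_upwards [h1, hu.2] with x hx hux hxQ
  have hxE : x ∉ E := by
    intro hxE
    have := hx ⟨hxE, hxQ⟩
    simp only [Pi.zero_apply, ENNReal.ofReal_eq_zero] at this
    linarith
  rw [indicator_of_notMem hxE, zero_mul]

theorem lintegral_ne_zero_of_sparseTerm {v w : (Fin n → ℝ) → ℝ} (hw : IsWeight w)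
    (hf : AEMeasurable f) (h : sparseTerm A b σ (fun x => f x * v x) g Q ≠ 0) :
    ∫⁻ x in Q.set, ENNReal.ofReal |f x| * ENNReal.ofReal (w x) ≠ 0 := by
  refine fun h0 => h (sparseTerm_eq_zero_of_left ?_)
  have hm : AEMeasurable (fun x => ENNReal.ofReal |f x| * ENNReal.ofReal (w x)) :=
    (measurable_norm.comp_aemeasurable hf).ennreal_ofReal.mul hw.aemeasurable_ofReal
  rw [lintegral_eq_zero_iff' hm.restrict] at h0
  filter_upwards [h0, ae_restrict_of_ae hw.2] with x hx hwx
  simp only [Pi.zero_apply, mul_eq_zero, ENNReal.ofReal_eq_zero, not_le.2 hwx, or_false] at hx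
  rw [abs_nonpos_iff.1 hx, zero_mul, zero_mul]

end SparseTerm

/-! ### Handling of the constant `Cuv`. -/

section Cuv

variable {n m : ℕ}

/-- Of the sum over `h` only the summand `h = m - 1` is kept: its exponent `1 + (m - h) * α` is `1 +
α`, which suffices for all subsets of symbols. -/
theorem le_Cuv (hm : 0 < m) {α p s κ : ℝ} (hκ : 0 ≤ κ) {u v : (Fin n → ℝ) → ℝ} :
    κ * (RHConst (2 * s - 1) u).toReal ^ (1 + (2 * s - 1) / (4 * s)) *
        (ApConst (fun _ => 1) 1 u).toReal * (AinftyConst fun x => u x * v x).toReal ^ (1 + α) *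
      Real.log (Real.exp 1 + κ * (RHConst (2 * s - 1) u).toReal ^ (1 + (2 * s - 1) / (4 * s)) *
        (ApConst (fun _ => 1) 1 u).toReal * (AinftyConst fun x => u x * v x).toReal ^ (1 + α) *
        (ApConst u p v).toReal) ^ (1 + α) ≤ Cuv m α p s κ u v := by
  unfold Cuv
  simp only
  refine le_trans (le_of_eq ?_) (Finset.single_le_sum (s := Finset.range (m + 1)) (a := m - 1)
    (fun h _ => ?_) (by simp))
  · have h1 : (1 : ℝ) + ((m : ℝ) - (m - 1 : ℕ)) * α = 1 + α := by
      rw [Nat.cast_pred hm]; ring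
    simp only [h1]
    congr 4
    ring
  · have h2 : 0 ≤ (AinftyConst fun x => u x * v x).toReal ^ (1 + ((m : ℝ) - h) * α) * κ *
        (RHConst (2 * s - 1) u).toReal ^ (1 + (2 * s - 1) / (4 * s)) *
        (ApConst (fun _ => 1) 1 u).toReal * (ApConst u p v).toReal := by positivity
    have h3 := Real.log_nonneg (x := Real.exp 1 + (AinftyConst fun x => u x * v x).toReal ^
      (1 + ((m : ℝ) - h) * α) * κ * (RHConst (2 * s - 1) u).toReal ^
        (1 + (2 * s - 1) / (4 * s)) * (ApConst (fun _ => 1) 1 u).toReal * (ApConst u p v).toReal)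
      (by linarith [Real.add_one_le_exp 1])
    positivity

theorem log_exp_one_add_mul_le {c x : ℝ} (hc : 1 ≤ c) (hx : 0 ≤ x) :
    Real.log (Real.exp 1 + c * x) ≤ (1 + Real.log c) * Real.log (Real.exp 1 + x) := by
  have he := Real.exp_pos 1
  have h1 : 1 ≤ Real.log (Real.exp 1 + x) := (Real.le_log_iff_exp_le (by linarith)).2 (by linarith)
  have h2 := Real.log_nonneg hc
  calc Real.log (Real.exp 1 + c * x) ≤ Real.log (c * (Real.exp 1 + x)) :=
        Real.log_le_log (by positivity) (by nlinarith)
    _ = Real.log c + Real.log (Real.exp 1 + x) := Real.log_mul (by positivity) (by positivity)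
    _ ≤ _ := by nlinarith

theorem Cuv_mul_le {α p s κ c : ℝ} (hα : 0 ≤ α) (hκ : 0 ≤ κ) (hc : 1 ≤ c)
    {u v : (Fin n → ℝ) → ℝ} :
    Cuv m α p s (c * κ) u v ≤ c * (1 + Real.log c) ^ (1 + α) * Cuv m α p s κ u v := by
  unfold Cuv
  simp only
  rw [Finset.mul_sum]
  refine Finset.sum_le_sum fun h _ => ?_
  set R := (RHConst (2 * s - 1) u).toReal ^ (1 + (2 * s - 1) / (4 * s))
  set W := (AinftyConst fun x => u x * v x).toReal ^ (1 + ((m : ℝ) - h) * α)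
  set a := (ApConst (fun _ => 1) 1 u).toReal
  set K := (ApConst u p v).toReal
  have hR : 0 ≤ R := by positivity
  have hW : 0 ≤ W := by positivity
  have ha : 0 ≤ a := ENNReal.toReal_nonneg
  have hK : 0 ≤ K := ENNReal.toReal_nonneg
  have h0 : 0 ≤ W * κ * R * a * K := by positivity
  have h0' : 0 ≤ W * (c * κ) * R * a * K := by positivity
  have he := Real.exp_one_gt_d9
  have h1 := log_exp_one_add_mul_le hc h0
  have h2 : 0 ≤ Real.log (Real.exp 1 + W * κ * R * a * K) := Real.log_nonneg (by linarith)
  have h3 := Real.log_nonneg hc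
  have h4 : 0 ≤ Real.log (Real.exp 1 + W * (c * κ) * R * a * K) := Real.log_nonneg (by linarith)
  calc c * κ * R * a * W * Real.log (Real.exp 1 + W * (c * κ) * R * a * K) ^ (1 + α)
      ≤ c * κ * R * a * W * ((1 + Real.log c) * Real.log (Real.exp 1 + W * κ * R * a * K)) ^
          (1 + α) := by
        gcongr
        refine le_trans (le_of_eq ?_) h1
        congr 2
        ring
    _ = _ := by rw [Real.mul_rpow (by linarith) h2]; ring

theorem MixedEstimate.mono {C C' α N : ℝ} {u v : (Fin n → ℝ) → ℝ} {F : Set ((Fin n → ℝ) → ℝ)}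
    {G : ((Fin n → ℝ) → ℝ) → (Fin n → ℝ) → ℝ} (h : MixedEstimate C α N u v F G) (hC : C ≤ C') :
    MixedEstimate C' α N u v F G := fun f hf lam hlam =>
  (h f hf lam hlam).trans (mul_le_mul_left (ENNReal.ofReal_le_ofReal hC) _)

end Cuv

/-! ### Comparison of constants and assembly of the weak type bound. -/

section MixedEstimate

variable {n m : ℕ}

/-- At a point `t₀` with `B t₀ > 1` the power bound forces `κ * t₀ ≥ 1`. So `κ` is bounded below in
terms of `B` alone, which lets terms without `κ` be absorbed. -/
theorem exists_one_le_mul {B : ℝ → ℝ} (hB : IsYoung B) :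
    ∃ t₀ : ℝ, 1 ≤ t₀ ∧ ∀ {κ q : ℝ}, 0 < κ → 0 < q → (∀ t : ℝ, 1 ≤ t → B t ≤ (κ * t) ^ q) →
      1 ≤ t₀ * κ := by
  obtain ⟨t₀, ht, hBt⟩ := ((eventually_ge_atTop (1 : ℝ)).and (hB.tendsto.eventually_gt_atTop 1)).exists
  refine ⟨t₀, ht, fun {κ q} hκ hq h => ?_⟩
  by_contra! hlt
  have h1 := hBt.trans_le (h t₀ ht)
  rw [mul_comm] at hlt
  exact absurd (Real.rpow_lt_one (by positivity) hlt hq) (not_lt.2 h1.le)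

theorem le_Cuv_of_weights (hm : 0 < m) {α p s κ : ℝ} (hα : 0 ≤ α) (hs : 1 ≤ s) (hκ : 0 ≤ κ)
    {u v : (Fin n → ℝ) → ℝ} (hu : MemAp (fun _ => 1) 1 u) (hR : RHConst (2 * s - 1) u ≠ ∞)
    (hw : IsWeight fun x => u x * v x) (hW : AinftyConst (fun x => u x * v x) ≠ ∞) :
    κ ≤ Cuv m α p s κ u v := by
  refine le_trans ?_ (le_Cuv hm hκ)
  have hq : 0 ≤ (2 * s - 1) / (4 * s) := by
    have : 0 ≤ 2 * s - 1 := by linarith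
    positivity
  have h1 : 1 ≤ (RHConst (2 * s - 1) u).toReal ^ (1 + (2 * s - 1) / (4 * s)) :=
    Real.one_le_rpow (by
      simpa using ENNReal.toReal_mono hR (one_le_RHConst hu.1 (by linarith))) (by linarith)
  have h2 : 1 ≤ (ApConst (fun _ => 1) 1 u).toReal := by
    simpa using ENNReal.toReal_mono hu.2.ne (one_le_A1Const hu)
  have h3 : 1 ≤ (AinftyConst fun x => u x * v x).toReal ^ (1 + α) :=
    Real.one_le_rpow (hw.one_le_AinftyConst_toReal hW) (by linarith)
  set R := (RHConst (2 * s - 1) u).toReal ^ (1 + (2 * s - 1) / (4 * s))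
  set a := (ApConst (fun _ => 1) 1 u).toReal
  set W := (AinftyConst fun x => u x * v x).toReal ^ (1 + α)
  have h4 : 0 ≤ κ * R * a * W * (ApConst u p v).toReal := by positivity
  have h5 : 1 ≤ Real.log (Real.exp 1 + κ * R * a * W * (ApConst u p v).toReal) ^ (1 + α) :=
    Real.one_le_rpow ((Real.le_log_iff_exp_le (by positivity)).2 (by linarith)) (by linarith)
  calc κ = κ * 1 * 1 * 1 * 1 := by ring
    _ ≤ _ := by gcongr

/-- The height `lam` cancels, and `1 + τ * W ≤ 2 * τ * W` turns the loss of the exponential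
integrability into `W ^ α`; the packing contributes one more `W`. -/
theorem level_const_le {J c₁ C₂ τ lam η α κ R a W : ℝ} (hJ : 0 ≤ J) (hc₁ : 0 ≤ c₁)
    (hC₂ : 0 ≤ C₂) (hτ : 1 ≤ τ) (hlam : 0 < lam) (hη : 0 < η) (hα : 0 ≤ α) (hαm : α ≤ m)
    (hκ : 0 ≤ κ) (hR : 0 ≤ R) (ha : 0 ≤ a) (hW : 1 ≤ W) :
    J * c₁ / lam * (C₂ * κ * R * a * (1 + τ * W) ^ α * (2 ^ m * lam)) * (W / η) ≤
      (1 + J * c₁ * C₂ * (2 * τ) ^ m * 2 ^ m / η) * (κ * R * a * W ^ (1 + α)) := by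
  have h1 : (1 + τ * W) ^ α ≤ (2 * τ) ^ m * W ^ α := by
    calc (1 + τ * W) ^ α ≤ (2 * τ * W) ^ α := by
          gcongr
          nlinarith
      _ = (2 * τ) ^ α * W ^ α := Real.mul_rpow (by positivity) (by positivity)
      _ ≤ (2 * τ) ^ (m : ℝ) * W ^ α := by
          gcongr
          linarith
      _ = _ := by rw [Real.rpow_natCast]
  have h2 : W ^ (1 + α) = W * W ^ α := by
    rw [Real.rpow_add (by linarith), Real.rpow_one]
  have h3 : 0 ≤ κ * R * a * W ^ (1 + α) := by positivity
  calc J * c₁ / lam * (C₂ * κ * R * a * (1 + τ * W) ^ α * (2 ^ m * lam)) * (W / η)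
      = J * c₁ * C₂ * 2 ^ m / η * (κ * R * a) * W * (1 + τ * W) ^ α := by field_simp
    _ ≤ J * c₁ * C₂ * 2 ^ m / η * (κ * R * a) * W * ((2 * τ) ^ m * W ^ α) := by gcongr
    _ = J * c₁ * C₂ * (2 * τ) ^ m * 2 ^ m / η * (κ * R * a * W ^ (1 + α)) := by rw [h2]; ring
    _ ≤ _ := by rw [add_mul, one_mul]; linarith

theorem le_of_le_add_half {C₁ C₃ α X V K Φ y U : ℝ} (hC₁ : 0 ≤ C₁) (hC₃ : 1 ≤ C₃) (hα : 0 ≤ α)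
    (hX : 0 ≤ X) (hXV : X ≤ C₃ * V) (hK : 0 ≤ K) (hΦ : 0 ≤ Φ)
    (hy : y ≤ C₁ * X * Real.log (Real.exp 1 + X * K) ^ (1 + α) * Φ + y / 2)
    (hU : V * Real.log (Real.exp 1 + V * K) ^ (1 + α) ≤ U) :
    y ≤ 2 * C₁ * C₃ * (1 + Real.log C₃) ^ (1 + α) * U * Φ := by
  have hV : 0 ≤ V := by
    by_contra! h
    nlinarith
  have he := Real.add_one_le_exp 1
  have hlogC₃ := Real.log_nonneg hC₃
  have hlog : Real.log (Real.exp 1 + X * K) ≤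
      (1 + Real.log C₃) * Real.log (Real.exp 1 + V * K) := by
    refine le_trans (Real.log_le_log (by positivity) ?_)
      (log_exp_one_add_mul_le hC₃ (x := V * K) (by positivity))
    linarith [mul_le_mul_of_nonneg_right hXV hK]
  have hlog0 : 0 ≤ Real.log (Real.exp 1 + X * K) :=
    Real.log_nonneg (by linarith [mul_nonneg hX hK])
  have hlogV : 0 ≤ Real.log (Real.exp 1 + V * K) :=
    Real.log_nonneg (by linarith [mul_nonneg hV hK])
  calc y ≤ 2 * (C₁ * X * Real.log (Real.exp 1 + X * K) ^ (1 + α) * Φ) := by linarith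
    _ ≤ 2 * (C₁ * (C₃ * V) *
        ((1 + Real.log C₃) * Real.log (Real.exp 1 + V * K)) ^ (1 + α) * Φ) := by gcongr
    _ = 2 * C₁ * C₃ * (1 + Real.log C₃) ^ (1 + α) *
        (V * Real.log (Real.exp 1 + V * K) ^ (1 + α)) * Φ := by
        rw [Real.mul_rpow (by linarith) hlogV]; ring
    _ ≤ _ := by gcongr

set_option maxHeartbeats 1000000 in
/-- The measure of a test set, in terms of the sparse form. -/
theorem exists_lintegral_le_of_sparseForm (hn : 0 < n) (hm : 0 < m) {r : Fin m → ℝ}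
    (hr : ∀ i, 1 ≤ r i) {p s η : ℝ} (c₀ : ℝ) {A B : ℝ → ℝ} (hp : 1 ≤ p) (hs : 1 ≤ s) (hη : 0 < η)
    (hA : IsYoung A) (hB : IsYoung B)
    (hAB : ∃ c : ℝ, ∀ t : ℝ, Real.exp 1 ≤ t →
      youngInv B t * Real.log t ^ recipSum r ≤ c * youngInv A t) :
    ∃ C : ℝ, 0 < C ∧ ∀ {u v f u' : (Fin n → ℝ) → ℝ} {b : Fin m → (Fin n → ℝ) → ℝ}
      {D S : Fin (3 ^ n) → Set (Cube n)} {E : Set (Fin n → ℝ)} {κ ε lam : ℝ},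
      MemAp (fun _ => 1) 1 u → RHConst (2 * s - 1) u < ∞ → MemAp u p v →
      AinftyConst (fun x => u x * v x) ≠ ∞ → AinftyConst (fun x => u x ^ s) ≠ ∞ →
      (∀ i, MemOsc (r i) (b i)) → (∀ i, oscNorm (r i) (b i) ≠ 0) →
      (∀ j, IsDyadicGrid (D j)) → (∀ j, S j ⊆ D j ∧ IsSparse η (S j)) →
      0 < κ → 0 < ε → ε ≤ 1 → 2 * ε ≤ 1 / (rhDim n * (AinftyConst fun x => u x ^ s).toReal) →
      (∀ t : ℝ, 1 ≤ t → B t ≤ (κ * t) ^ (s * (1 + ε))) → AEMeasurable f → 0 < lam →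
      Measurable u' → u =ᵐ[volume] u' → MeasurableSet E →
      ∫⁻ x in E, ENNReal.ofReal (u x * v x) ≠ ∞ →
      ∫⁻ x, ENNReal.ofReal (phi (recipSum r) (symbolNorm r b / lam * |f x|)) *
        ENNReal.ofReal (u x * v x) ≠ ∞ →
      (∀ j, ∀ Q ∈ S j, (E ∩ Q.set).Nonempty →
        ∫⁻ x in Q.set, ENNReal.ofReal (phi (recipSum r) (symbolNorm r b / lam * |f x|)) *
          ENNReal.ofReal (u x * v x) ≤ ∫⁻ x in Q.set, ENNReal.ofReal (u x * v x)) →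
      ENNReal.ofReal lam * ∫⁻ x in E, ENNReal.ofReal (u x * v x) ≤
        ENNReal.ofReal c₀ * sparseForm A b S (fun x => f x * v x) (E.indicator u') →
      ∫⁻ x in E, ENNReal.ofReal (u x * v x) ≤
        ENNReal.ofReal (C * Cuv m (recipSum r) p s κ u v) *
          ∫⁻ x, ENNReal.ofReal (phi (recipSum r) (symbolNorm r b / lam * |f x|)) *
            ENNReal.ofReal (u x * v x) := by
  obtain ⟨c, hc⟩ := hAB
  have hα := recipSum_nonneg hr
  have hαm := recipSum_le hr
  set α := recipSum r with hαdef
  have hs0 : 0 < s := by linarith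
  obtain ⟨t₀, ht₀, hκt⟩ := exists_one_le_mul hB
  obtain ⟨C₁, hC₁, hmain⟩ := tsum_le_of_levels hn hα hp (e := 1 / (8 * s)) (by positivity)
  have hc' : ∀ t : ℝ, Real.exp 1 ≤ t → youngInv B t * Real.log t ^ α ≤ max c 1 * youngInv A t :=
    fun t ht => (hc t ht).trans (mul_le_mul_of_nonneg_right (le_max_left _ _)
      (Real.sInf_nonneg fun x hx => hx.1))
  have hc1 : 0 < max c 1 := lt_max_of_lt_right one_pos
  have hB1 : 0 ≤ B 1 := hB.nonneg zero_le_one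
  have hτ := rhDim_ge_one n
  set c' := max c 1
  set c₁ := max c₀ 0
  have hc₁ : 0 ≤ c₁ := le_max_right _ _
  set C₂ := 14 * c' * (B 1 * t₀ + 1 + 2 * m + 3) * (orliczConst m * (1 + 14 * m)) with hC₂
  have hC₂0 : 0 < C₂ := by
    have := orliczConst_pos m
    positivity
  set J : ℝ := 3 ^ n * 2 ^ m with hJ
  have hJ0 : 0 < J := by positivity
  set C₃ := 1 + J * c₁ * C₂ * (2 * rhDim n) ^ m * 2 ^ m / η with hC₃
  have hC₃1 : 1 ≤ C₃ := by
    have : 0 ≤ J * c₁ * C₂ * (2 * rhDim n) ^ m * 2 ^ m / η := by positivity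
    linarith
  have hlogC₃ := Real.log_nonneg hC₃1
  refine ⟨2 * C₁ * C₃ * (1 + Real.log C₃) ^ (1 + α), by positivity, ?_⟩
  intro u v f u' b D S E κ ε lam hu hR hv hW hUs hb hb0 hD hS hκ hε hε1 hεs hBκ hf hlam hu' huu' hE
    hEt hΦ hZ hform
  have hw := hu.1.mul_of_Ap hp hv
  have hκt₀ := hκt hκ (by positivity) hBκ
  set N := symbolNorm r b with hN
  have hβ0 : ∀ i, 0 < (oscNorm (r i) (b i)).toReal := fun i =>
    ENNReal.toReal_pos (hb0 i) (hb i).2.ne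
  have hN0 : 0 < N := Finset.prod_pos fun i _ => hβ0 i
  set M := N / lam with hM
  have hM0 : 0 < M := by positivity
  -- Twice the norm: the strict inequality is needed to extract an admissible scale from the
  -- Luxemburg infimum.
  set β : Fin m → ℝ := fun i => 2 * (oscNorm (r i) (b i)).toReal with hβ
  have hβM : (∏ i, β i) / M = 2 ^ m * lam := by
    rw [hβ, Finset.prod_mul_distrib, Finset.prod_const, Finset.card_univ, Fintype.card_fin]
    change 2 ^ m * N / M = _
    rw [hM]
    field_simp
  have hbβ : ∀ i, oscNorm (r i) (b i) < ENNReal.ofReal (β i) := fun i => by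
    rw [← ENNReal.ofReal_toReal (hb i).2.ne]
    exact (ENNReal.ofReal_lt_ofReal_iff (by simp only [hβ]; linarith [hβ0 i])).2
      (by simp only [hβ]; linarith [hβ0 i])
  have hBK : B 1 / κ + 1 ≤ B 1 * t₀ + 1 := by
    rw [div_eq_mul_inv]
    gcongr
    rw [inv_le_iff_one_le_mul₀ hκ]
    exact hκt₀
  set R := (RHConst (2 * s - 1) u).toReal ^ (1 + (2 * s - 1) / (4 * s)) with hRdef
  set a := (ApConst (fun _ => 1) 1 u).toReal with hadef
  set W := (AinftyConst fun x => u x * v x).toReal with hWdef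
  set K := (ApConst u p v).toReal with hKdef
  have hR0 : 0 ≤ R := by positivity
  have ha0 : 0 ≤ a := ENNReal.toReal_nonneg
  have hK0 : 0 ≤ K := ENNReal.toReal_nonneg
  have hW1 : 1 ≤ W := hw.one_le_AinftyConst_toReal hW
  -- `J` is the number of pairs of a grid and a subset of symbols. Including it here bounds each
  -- pair by the same `P`, so that summing over the pairs does not multiply the absorbed term `Y /
  -- 2`.
  set Λ := J * c₁ / lam with hΛ
  set Λ' := C₂ * κ * R * a * (1 + rhDim n * W) ^ α * ((∏ i, β i) / M) with hΛ'
  have hΛ0 : 0 ≤ Λ := by positivity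
  have hθ : 0 ≤ 1 + rhDim n * W := by positivity
  have hΛ'0 : 0 ≤ Λ' := by rw [hΛ', hβM]; positivity
  set Φ := ∫⁻ x, ENNReal.ofReal (phi α (M * |f x|)) * ENNReal.ofReal (u x * v x) with hΦdef
  set Y := ∫⁻ x in E, ENNReal.ofReal (u x * v x) with hY
  set P := C₁ * (Λ * Λ' * (W / η)) * Real.log (Real.exp 1 + Λ * Λ' * (W / η) * K) ^ (1 + α) *
    Φ.toReal + Y.toReal / 2 with hP
  have hterm : ∀ j (σ : Finset (Fin m)), ENNReal.ofReal Λ * ∑' Q : S j,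
      sparseTerm A b σ (fun x => f x * v x) (E.indicator u') Q ≤ ENNReal.ofReal P := by
    intro j σ
    refine hmain hη (hD j) (hS j).1 (hS j).2 hu.1 hv hW hE hEt hM0 hΛ0 hΛ'0 hΦ (hZ j)
      (fun Q hQ hX => ⟨lintegral_inter_ne_zero_of_sparseTerm hA.zero hu.1 hX,
        lintegral_ne_zero_of_sparseTerm hw hf hX⟩) (fun Q hQ k l hk hl => ?_)
    refine (sparseTerm_le hr (fun i => by simp only [hβ]; linarith [hβ0 i]) hb hbβ hA hB hc1 hc' hu
      hv.1.2 hw hW hs hR.ne hUs hκ hε hε1 hεs hBκ hBK Q σ hM0 hk hu' huu' hE (l := l) ?_).trans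
      (le_of_eq ?_)
    · rw [lavg_le_iff, mul_assoc, lavg_mul_volume, lintegral_indicator hE,
        Measure.restrict_restrict hE]
      exact hl
    · rw [hΛ', hC₂]
  have hsum : ENNReal.ofReal Λ * sparseForm A b S (fun x => f x * v x) (E.indicator u') ≤
      ENNReal.ofReal J * ENNReal.ofReal P := by
    rw [sparseForm_eq, Finset.mul_sum]
    refine (Finset.sum_le_card_nsmul _ _ (2 ^ m * ENNReal.ofReal P) fun j _ => ?_).trans
      (le_of_eq ?_)
    · rw [Finset.mul_sum]
      refine (Finset.sum_le_card_nsmul _ _ (ENNReal.ofReal P) fun σ _ => hterm j σ).trans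
        (le_of_eq ?_)
      simp
    · rw [hJ, ENNReal.ofReal_mul (by positivity), ENNReal.ofReal_pow (by norm_num),
        ENNReal.ofReal_pow (by norm_num)]
      simp [mul_assoc]
  have hYP : Y ≤ ENNReal.ofReal P := by
    have h0 : ENNReal.ofReal (J * lam) ≠ 0 := by
      rw [Ne, ENNReal.ofReal_eq_zero, not_le]; positivity
    rw [← ENNReal.mul_le_mul_iff_right h0 ENNReal.ofReal_ne_top]
    calc ENNReal.ofReal (J * lam) * Y = ENNReal.ofReal J * (ENNReal.ofReal lam * Y) := by
          rw [ENNReal.ofReal_mul hJ0.le, mul_assoc]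
      _ ≤ ENNReal.ofReal J * (ENNReal.ofReal c₁ *
          sparseForm A b S (fun x => f x * v x) (E.indicator u')) := by
          refine mul_le_mul_right (hform.trans (mul_le_mul_left ?_ _)) _
          exact ENNReal.ofReal_le_ofReal (le_max_left _ _)
      _ = ENNReal.ofReal lam * (ENNReal.ofReal Λ *
          sparseForm A b S (fun x => f x * v x) (E.indicator u')) := by
          rw [← mul_assoc, ← mul_assoc, ← ENNReal.ofReal_mul hJ0.le, ← ENNReal.ofReal_mul hlam.le,
            hΛ, mul_div_cancel₀ _ hlam.ne']
      _ ≤ ENNReal.ofReal lam * (ENNReal.ofReal J * ENNReal.ofReal P) := mul_le_mul_right hsum _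
      _ = _ := by rw [← mul_assoc, ← ENNReal.ofReal_mul hlam.le, mul_comm lam]
  set V := κ * R * a * W ^ (1 + α) with hV
  have hV0 : 0 ≤ V := by positivity
  have hΛV : Λ * Λ' * (W / η) ≤ C₃ * V := by
    rw [hΛ, hΛ', hβM]
    exact level_const_le hJ0.le hc₁ hC₂0.le hτ hlam hη hα hαm hκ.le hR0 ha0 hW1
  have hcuv : V * Real.log (Real.exp 1 + V * K) ^ (1 + α) ≤ Cuv m α p s κ u v := le_Cuv hm hκ.le
  have hΛW0 : 0 ≤ Λ * Λ' * (W / η) := mul_nonneg (mul_nonneg hΛ0 hΛ'0) (by positivity)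
  have hP0 : 0 ≤ P := by
    have : 0 ≤ Real.log (Real.exp 1 + Λ * Λ' * (W / η) * K) := Real.log_nonneg (by
      linarith [Real.add_one_le_exp 1, mul_nonneg hΛW0 hK0])
    positivity
  have hfin := le_of_le_add_half hC₁.le hC₃1 hα hΛW0 hΛV hK0 ENNReal.toReal_nonneg
    (ENNReal.toReal_le_of_le_ofReal hP0 hYP) hcuv
  have hcuv0 : 0 ≤ Cuv m α p s κ u v :=
    hκ.le.trans (le_Cuv_of_weights hm hα hs hκ.le hu hR.ne hw hW)
  rw [← ENNReal.ofReal_toReal hEt, ← ENNReal.ofReal_toReal hΦ, ← ENNReal.ofReal_mul (by positivity)]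
  exact ENNReal.ofReal_le_ofReal hfin

end MixedEstimate

section MixedEstimate

variable {n m : ℕ}

/-- The level set is split by an exceptional union of grid cubes. That union is small by a weak type
bound with constant 1 on each of the `3 ^ n` grids; every sparse cube meeting the rest starts its
levels at `k = 0`. -/
theorem exists_mixedEstimate (hn : 0 < n) (hm : 0 < m) {r : Fin m → ℝ}
    (hr : ∀ i, 1 ≤ r i) {p s η : ℝ} (c₀ : ℝ) {A B : ℝ → ℝ} (hp : 1 ≤ p) (hs : 1 ≤ s) (hη : 0 < η)
    (hA : IsYoung A) (hB : IsYoung B)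
    (hAB : ∃ c : ℝ, ∀ t : ℝ, Real.exp 1 ≤ t →
      youngInv B t * Real.log t ^ recipSum r ≤ c * youngInv A t) :
    ∃ C : ℝ, 0 < C ∧ ∀ {u v : (Fin n → ℝ) → ℝ} {b : Fin m → (Fin n → ℝ) → ℝ}
      {D : Fin (3 ^ n) → Set (Cube n)} {F : Set ((Fin n → ℝ) → ℝ)}
      {G : ((Fin n → ℝ) → ℝ) → (Fin n → ℝ) → ℝ} {κ ε : ℝ},
      MemAp (fun _ => 1) 1 u → RHConst (2 * s - 1) u < ∞ → MemAp u p v →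
      (∀ i, MemOsc (r i) (b i)) → (∀ j, IsDyadicGrid (D j)) → SparseBound A b η c₀ D F G →
      AinftyConst (fun x => u x * v x) ≠ ∞ → AinftyConst (fun x => u x ^ s) ≠ ∞ →
      0 < κ → 0 < ε → ε ≤ 1 → 2 * ε ≤ 1 / (rhDim n * (AinftyConst fun x => u x ^ s).toReal) →
      (∀ t : ℝ, 1 ≤ t → B t ≤ (κ * t) ^ (s * (1 + ε))) →
      MixedEstimate (C * Cuv m (recipSum r) p s κ u v) (recipSum r) (symbolNorm r b) u v F G := by
  obtain ⟨C₀, hC₀, hmain⟩ := exists_lintegral_le_of_sparseForm hn hm hr c₀ hp hs hη hA hB hAB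
  obtain ⟨t₀, ht₀, hκt⟩ := exists_one_le_mul hB
  have hα := recipSum_nonneg hr
  refine ⟨C₀ + 3 ^ n * t₀, by positivity, ?_⟩
  intro u v b D F G κ ε hu hR hv hb hD hG hW hUs hκ hε hε1 hεs hBκ f hf lam hlam
  have hw := hu.1.mul_of_Ap hp hv
  have hκt₀ := hκt hκ (by positivity) hBκ
  have hκC : κ ≤ Cuv m (recipSum r) p s κ u v := le_Cuv_of_weights hm hα hs hκ.le hu hR.ne hw hW
  set X := Cuv m (recipSum r) p s κ u v
  have hX : 0 < X := hκ.trans_le hκC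
  set N := symbolNorm r b with hN
  have hN0 : 0 ≤ N := Finset.prod_nonneg fun i _ => ENNReal.toReal_nonneg
  have hfm : AEMeasurable f := by
    refine ((hG _ hf).1.div hv.1.1.aestronglyMeasurable.aemeasurable).congr ?_
    filter_upwards [hv.1.2] with x hx
    exact mul_div_cancel_right₀ _ hx.ne'
  set Φ := ∫⁻ x, ENNReal.ofReal (phi (recipSum r) (N / lam * |f x|)) *
    ENNReal.ofReal (u x * v x) with hΦ
  have hΦeq : ∫⁻ x, ENNReal.ofReal (phi (recipSum r) (|f x| * N / lam) * (u x * v x)) = Φ := by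
    refine lintegral_congr fun x => ?_
    rw [mul_comm |f x|, mul_div_right_comm, ENNReal.ofReal_mul (phi_nonneg (by positivity))]
  rw [hΦeq]
  by_cases hΦt : Φ = ∞
  · rw [hΦt, ENNReal.mul_top]
    · exact le_top
    · rw [Ne, ENNReal.ofReal_eq_zero, not_le]
      positivity
  set μ := volume.withDensity fun x => ENNReal.ofReal (u x * v x) with hμ
  set ν := volume.withDensity fun x =>
    ENNReal.ofReal (phi (recipSum r) (N / lam * |f x|)) * ENNReal.ofReal (u x * v x) with hν
  -- The cubes on which the mean of `phi` exceeds 1; `Z` depends only on the grids, and not on the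
  -- sparse families, which vary with the test function.
  set Z := ⋃ j, ⋃ Q ∈ {Q ∈ D j | μ Q.set < ν Q.set}, Q.set with hZ
  have hZm : MeasurableSet Z := MeasurableSet.iUnion fun j =>
    MeasurableSet.biUnion ((hD j).countable.mono fun Q hQ => hQ.1) fun Q _ => Q.measurableSet_set
  have hμZ : μ Z ≤ 3 ^ n * Φ := by
    refine (measure_iUnion_fintype_le μ _).trans ?_
    refine (Finset.sum_le_card_nsmul _ _ Φ fun j _ => ?_).trans (le_of_eq (by simp))
    refine (measure_biUnion_le_of_grid hn (hD j)).trans (le_of_eq ?_)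
    rw [hν, withDensity_apply _ MeasurableSet.univ, Measure.restrict_univ]
  refine (hG.measure_le hu.1 hv.1 hw hf hlam hZm (X := ENNReal.ofReal (C₀ * X) * Φ) ?_).trans ?_
  · intro u' E S hu' huu' hE hEZ hEt hS hle
    by_cases h0 : ∀ i, oscNorm (r i) (b i) ≠ 0
    · refine hmain hu hR hv hW hUs hb h0 hD hS hκ hε hε1 hεs hBκ hfm hlam hu' huu' hE hEt hΦt
        (fun j Q hQ hne => ?_) hle
      by_contra! hlt
      rw [← withDensity_set, ← withDensity_set] at hlt
      obtain ⟨x, hxE, hxQ⟩ := hne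
      exact disjoint_left.1 hEZ hxE
        (mem_iUnion.2 ⟨j, mem_iUnion₂.2 ⟨Q, ⟨(hS j).1 hQ, hlt⟩, hxQ⟩⟩)
    · push Not at h0
      obtain ⟨i, hi⟩ := h0
      have h1 : sparseForm A b S (fun x => f x * v x) (E.indicator u') = 0 := by
        rw [sparseForm_eq]
        refine Finset.sum_eq_zero fun j _ => Finset.sum_eq_zero fun σ _ => ?_
        rw [ENNReal.tsum_eq_zero]
        exact fun Q => sparseTerm_eq_zero_of_oscNorm (hr i) hA.zero (hb i).1 hi
      rw [h1, mul_zero, nonpos_iff_eq_zero, mul_eq_zero, ENNReal.ofReal_eq_zero] at hle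
      rw [hle.resolve_left (not_le.2 hlam)]
      exact zero_le
  · have h1 : (3 : ℝ≥0∞) ^ n ≤ ENNReal.ofReal (3 ^ n * t₀ * X) := by
      rw [show (3 : ℝ≥0∞) ^ n = ENNReal.ofReal (3 ^ n) by
        rw [ENNReal.ofReal_pow (by norm_num)]; simp]
      refine ENNReal.ofReal_le_ofReal ?_
      have h2 : 1 ≤ t₀ * X := hκt₀.trans (by gcongr)
      have h3 : (0 : ℝ) < 3 ^ n := by positivity
      nlinarith
    calc μ Z + ENNReal.ofReal (C₀ * X) * Φ
        ≤ ENNReal.ofReal (3 ^ n * t₀ * X) * Φ + ENNReal.ofReal (C₀ * X) * Φ := by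
          gcongr
          exact hμZ.trans (by gcongr)
      _ = _ := by
          rw [← add_mul, ← ENNReal.ofReal_add (by positivity) (by positivity)]
          congr 2
          ring

/-- The logarithm is traded for a small power through `log t ≤ t ^ x / x` with `x = s / (γ * c *
U)`: the power `γ` of `t ^ x` is the available surplus `t ^ (s / (c * U))`, and the cost `1 / x` is
proportional to `U`. -/
theorem rpow_mul_one_add_posLog_le {s γ c U : ℝ} (hs : 1 ≤ s) (hγ : 0 ≤ γ) (hc : 0 < c)
    (hU : 1 ≤ U) {t : ℝ} (ht : 1 ≤ t) :
    t ^ s * (1 + Real.posLog t) ^ γ ≤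
      ((1 + γ * c / s) ^ (γ / s) * U ^ (γ / s) * t) ^ (s * (1 + 1 / (c * U))) := by
  have hs0 : 0 < s := by linarith
  have ht0 : 0 < t := by linarith
  have hU0 : 0 < U := by linarith
  have hlog := Real.log_nonneg ht
  have hd : 1 ≤ (1 + γ * c / s) * U := by
    have : 0 ≤ γ * c / s := by positivity
    nlinarith
  have hκ : 1 ≤ (1 + γ * c / s) ^ (γ / s) * U ^ (γ / s) := by
    rw [← Real.mul_rpow (by positivity) hU0.le]
    exact Real.one_le_rpow hd (by positivity)
  rw [Real.posLog, max_eq_right hlog, Real.mul_rpow (by positivity) ht0.le, mul_comm]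
  have h1 : (1 + Real.log t) ^ γ ≤ ((1 + γ * c / s) * U) ^ γ * t ^ (s / (c * U)) := by
    rcases hγ.eq_or_lt with rfl | hγ
    · simp only [Real.rpow_zero, one_mul]
      exact Real.one_le_rpow ht (by positivity)
    set x := s / (γ * c * U) with hx
    have hx0 : 0 < x := by positivity
    have h2 : 1 + Real.log t ≤ (1 + γ * c / s) * U * t ^ x := by
      have h3 := Real.log_le_rpow_div ht0.le hx0
      have h4 : 1 ≤ t ^ x := Real.one_le_rpow ht hx0.le
      have h5 : t ^ x / x = γ * c / s * U * t ^ x := by rw [hx]; field_simp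
      nlinarith
    calc (1 + Real.log t) ^ γ ≤ ((1 + γ * c / s) * U * t ^ x) ^ γ := by gcongr
      _ = ((1 + γ * c / s) * U) ^ γ * t ^ (s / (c * U)) := by
          rw [Real.mul_rpow (by positivity) (by positivity), ← Real.rpow_mul ht0.le]
          congr 2
          rw [hx]
          field_simp
  calc (1 + Real.log t) ^ γ * t ^ s
      ≤ ((1 + γ * c / s) * U) ^ γ * t ^ (s / (c * U)) * t ^ s := by gcongr
    _ = ((1 + γ * c / s) ^ (γ / s) * U ^ (γ / s)) ^ s * t ^ (s * (1 + 1 / (c * U))) := by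
        rw [mul_assoc, ← Real.rpow_add ht0, ← Real.mul_rpow (by positivity) hU0.le,
          ← Real.rpow_mul (by positivity), div_mul_cancel₀ _ hs0.ne']
        congr 2
        field_simp
        ring
    _ ≤ _ := by
        refine mul_le_mul_of_nonneg_right (Real.rpow_le_rpow_of_exponent_le hκ ?_) (by positivity)
        have : 0 ≤ 1 / (c * U) := by positivity
        nlinarith

/-- Evaluation at `e`, where `1 + log⁺` equals 2. As `B` determines `γ`, a constant depending on `γ`
depends only on `B`. -/
theorem eq_of_rpow_mul_posLog {B : ℝ → ℝ} {s γ γ' : ℝ}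
    (h : ∀ t : ℝ, 0 ≤ t → B t = t ^ s * (1 + Real.posLog t) ^ γ)
    (h' : ∀ t : ℝ, 0 ≤ t → B t = t ^ s * (1 + Real.posLog t) ^ γ') : γ = γ' := by
  have h1 := (h _ (Real.exp_pos 1).le).symm.trans (h' _ (Real.exp_pos 1).le)
  have h2 : 0 < Real.exp 1 ^ s := by positivity
  have h3 := mul_left_cancel₀ h2.ne' h1
  rw [Real.posLog, Real.log_exp, max_eq_right zero_le_one] at h3
  exact (Real.rpow_right_inj (by norm_num) (by norm_num)).1 h3

end MixedEstimate

end MixedWeak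

/-! ### The main theorem. -/

theorem theorem1p2 (n : ℕ) (hn : 0 < n) :
    ∃ τ : ℝ, 0 < τ ∧
      (∀ (m : ℕ) (r : Fin m → ℝ) (p s η c₀ : ℝ) (A B : ℝ → ℝ),
        0 < m → (∀ i, 1 ≤ r i) → 1 ≤ p → 1 ≤ s → 0 < η → IsYoung A → IsYoung B →
        (∃ c : ℝ, ∀ t : ℝ, Real.exp 1 ≤ t →
          youngInv B t * Real.log t ^ recipSum r ≤ c * youngInv A t) →
        (∀ ρ : ℝ, s < ρ → MemB ρ B) →
        ∃ C : ℝ, 0 < C ∧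
          ∀ (u v : (Fin n → ℝ) → ℝ) (b : Fin m → (Fin n → ℝ) → ℝ)
            (T : ((Fin n → ℝ) → ℝ) → (Fin n → ℝ) → ℝ)
            (D : Fin (3 ^ n) → Set (Cube n)) (F : Set ((Fin n → ℝ) → ℝ)),
            MemAp (fun _ => 1) 1 u → RHConst (2 * s - 1) u < ⊤ → MemAp u p v →
            (∀ i, MemOsc (r i) (b i)) → (∀ j, IsDyadicGrid (D j)) →
            SparseBound A b η c₀ D F (iterComm m b T) →
            AinftyConst (fun x => u x * v x) < ⊤ ∧ AinftyConst (fun x => u x ^ s) < ⊤ ∧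
            (∀ κ : ℝ, 0 < κ →
              (∀ t : ℝ, 1 ≤ t →
                B t ≤ (κ * t) ^
                  (s * (1 + 1 / (2 * τ * (AinftyConst (fun x => u x ^ s)).toReal)))) →
              MixedEstimate (C * Cuv m (recipSum r) p s κ u v) (recipSum r) (symbolNorm r b)
                u v F (iterComm m b T)) ∧
            (∀ γ : ℝ, 0 ≤ γ →
              (∀ t : ℝ, 0 ≤ t → B t = t ^ s * (1 + Real.posLog t) ^ γ) →
              MixedEstimate
                (C * Cuv m (recipSum r) p s
                  ((AinftyConst (fun x => u x ^ s)).toReal ^ (γ / s)) u v)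
                (recipSum r) (symbolNorm r b) u v F (iterComm m b T))) ∧
      (∀ s γ : ℝ, 1 ≤ s → 0 ≤ γ → ∃ c : ℝ, 0 < c ∧
        ∀ u : (Fin n → ℝ) → ℝ, MemAp (fun _ => 1) 1 u → RHConst (2 * s - 1) u < ⊤ →
          (AinftyConst (fun x => u x ^ s)).toReal ^ (γ / s) ≤
            c * (RHConst (2 * s - 1) u).toReal ^ (γ / s) *
              (ApConst (fun _ => 1) 1 u).toReal ^ (γ / s)) := by
  have hτ := rhDim_ge_one n
  have hτ0 := rhDim_pos n
  refine ⟨rhDim n, hτ0, ?_, ?_⟩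
  · intro m r p s η c₀ A B hm hr hp hs hη hA hB hAB _
    obtain ⟨C, hC, hmain⟩ := exists_mixedEstimate hn hm hr c₀ hp hs hη hA hB hAB
    obtain ⟨CU, hCU, hUle⟩ := exists_AinftyConst_rpow_le hn hs
    have hα := recipSum_nonneg hr
    -- The admissible `κ` in the logarithmic case is `d * U ^ (γ / s)`. The factor `d` has to be
    -- fixed before `γ` is given, which is possible because `B` determines `γ`.
    obtain ⟨d, hd, hdγ⟩ : ∃ d : ℝ, 1 ≤ d ∧ ∀ γ : ℝ, 0 ≤ γ →
        (∀ t : ℝ, 0 ≤ t → B t = t ^ s * (1 + Real.posLog t) ^ γ) →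
        d = (1 + γ * (2 * rhDim n) / s) ^ (γ / s) := by
      by_cases h : ∃ γ : ℝ, 0 ≤ γ ∧ ∀ t : ℝ, 0 ≤ t → B t = t ^ s * (1 + Real.posLog t) ^ γ
      · obtain ⟨γ, hγ, hγB⟩ := h
        refine ⟨(1 + γ * (2 * rhDim n) / s) ^ (γ / s), Real.one_le_rpow ?_ (by positivity), ?_⟩
        · have : 0 ≤ γ * (2 * rhDim n) / s := by positivity
          linarith
        · intro γ' _ hγ'
          rw [eq_of_rpow_mul_posLog hγB hγ']
      · exact ⟨1, le_rfl, fun γ hγ hγB => absurd ⟨γ, hγ, hγB⟩ h⟩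
    have hlogd := Real.log_nonneg hd
    have hd1 : 1 ≤ d * (1 + Real.log d) ^ (1 + recipSum r) :=
      one_le_mul_of_one_le_of_one_le hd (Real.one_le_rpow (by linarith) (by linarith))
    refine ⟨C * (d * (1 + Real.log d) ^ (1 + recipSum r)), by positivity, ?_⟩
    intro u v b T D F hu hR hv hb hD hG
    have hW := AinftyConst_mul_lt_top hn hp hu hv
    have hUs : AinftyConst (fun x => u x ^ s) < ∞ := (hUle u hu hR).trans_lt
      (ENNReal.mul_lt_top hCU.lt_top (ENNReal.mul_lt_top hR hu.2))
    have hw := hu.1.mul_of_Ap hp hv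
    have hus := hu.1.rpow_of_RH (s := s) (by linarith) (by linarith) hR.ne
    have hU1 := hus.one_le_AinftyConst_toReal hUs.ne
    set U := (AinftyConst fun x => u x ^ s).toReal with hU
    have hε : 0 < 1 / (2 * rhDim n * U) := by positivity
    have hε1 : 1 / (2 * rhDim n * U) ≤ 1 := by
      rw [div_le_one (by positivity)]
      nlinarith
    -- Equality holds: `2 * ε` is exactly the gain allowed by the sharp reverse Hölder inequality
    -- for `u ^ s`.
    have hεs : 2 * (1 / (2 * rhDim n * U)) ≤ 1 / (rhDim n * U) := le_of_eq (by field_simp)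
    refine ⟨hW, hUs, fun κ hκ hBκ => ?_, fun γ hγ hBγ => ?_⟩
    · have h0 := hκ.le.trans (le_Cuv_of_weights (p := p) hm hα hs hκ.le hu hR.ne hw hW.ne)
      refine (hmain hu hR hv hb hD hG hW.ne hUs.ne hκ hε hε1 hεs hBκ).mono ?_
      exact mul_le_mul_of_nonneg_right (le_mul_of_one_le_right hC.le hd1) h0
    · have hκ : 0 < U ^ (γ / s) := by positivity
      refine (hmain (κ := d * U ^ (γ / s)) hu hR hv hb hD hG hW.ne hUs.ne (by positivity) hε hε1 hεs
        fun t ht => ?_).mono ?_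
      · rw [hBγ t (by linarith), hdγ γ hγ hBγ]
        exact rpow_mul_one_add_posLog_le hs hγ (by positivity) hU1 ht
      · rw [mul_assoc C]
        exact mul_le_mul_of_nonneg_left (Cuv_mul_le hα hκ.le hd) hC.le
  · intro s γ hs hγ
    obtain ⟨C, hC, hle⟩ := exists_AinftyConst_rpow_le hn hs
    -- The summand 1 only makes the constant positive.
    refine ⟨(C.toReal + 1) ^ (γ / s), by positivity, fun u hu hR => ?_⟩
    have h1 := ENNReal.toReal_mono
      (ENNReal.mul_ne_top hC (ENNReal.mul_ne_top hR.ne hu.2.ne)) (hle u hu hR)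
    rw [ENNReal.toReal_mul, ENNReal.toReal_mul] at h1
    rw [mul_assoc, ← Real.mul_rpow ENNReal.toReal_nonneg ENNReal.toReal_nonneg,
      ← Real.mul_rpow (by positivity) (by positivity)]
    refine Real.rpow_le_rpow ENNReal.toReal_nonneg (h1.trans ?_) (by positivity)
    gcongr
    linarith
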